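/- Fix $m\ge 1$ and a measurable space $\mathcal X$. For each $n$ let $X_1,\dots,X_n$ ($X_i=X_{n,i}$) be i.i.d. $\mathcal X$-valued random variables, whose common law may depend on $n$; let $a=a_n:[n]^m\to\mathbb R$ be a weight function and $h=h_n:\mathcal X^m\to\mathbb R$ a measurable kernel, neither assumed symmetric. Let $I_n^m$ be the set of $m$-tuples of pairwise distinct elements of $[n]$, and put $$U_n=\frac{(n-m)!}{n!}\sum_{\boldsymbol i\in I_n^m}a(\boldsymbol i)\,h(X_{i_1},\dots,X_{i_m}),\qquad \sigma_n^2=\mathrm{Var}(U_n),\qquad \theta(\boldsymbol i)=E\,h(X_{i_1},\dots,X_{i_m}).$$ For $i\in[n]$ let $$h_{1,i}(x)=\frac{(n-m)!}{(n-1)!}\sum_{\boldsymbol j}\sum_{l=1}^m a(\pi_l(i;\boldsymbol j))\big\{f^{(l)}_{\boldsymbol j}(x)-\theta(\pi_l(i;\boldsymbol j))\big\},$$ where $\boldsymbol j$ runs over the $(m-1)$-tuples of pairwise distinct elements of $[n]\setminus\{i\}$, $\pi_l(y;\boldsymbol z)$ inserts $y$ at position $l$ of $\boldsymbol z$, and $f^{(l)}_{\boldsymbol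 j}(x)=E\,h(\pi_l(x;Y_1,\dots,Y_{m-1}))$ for independent $Y_k$ distributed as $X_{j_k}$. Let $V(n)=\mathrm{Var}\{n^{-1}\sum_{i=1}^n h_{1,i}(X_i)\}$. Let $A_{K,q}(n)$ be the average of $|a(\boldsymbol i^{(1)})\cdots a(\boldsymbol i^{(K)})|$ over all $K$-tuples of elements of $I_n^m$ whose index sets have at least $q$ elements common to all $K$ (an empty average is $0$). Let $$M_1(n)=\max_{\boldsymbol i,\boldsymbol j\in I_n^m}|\theta(\boldsymbol i)-\theta(\boldsymbol j)|,$$ $$M_2(n)=\max\Big|E\big[E\{h(X_{r_1},\dots,X_{r_m})h(X_{s_1},\dots,X_{s_m})\mid X_{k_p}\}\big]-E\big[E\{h(X_{k_1},\dots,X_{k_m})h(X_{s_1},\dots,X_{s_m})\mid X_{k_p}\}\big]\Big|,$$ the latter maximum being over $p,q\in[m]$ and $\boldsymbol r,\boldsymbol s,\boldsymbol k\in I_n^m$ such that $\boldsymbol r$ and $\boldsymbol s$ have exactly the index $r_p=s_q$ in common and $\boldsymbol k$ and $\boldsymbol s$ have exactly the index $k_p=s_q$ in common (an empty maximum is $0$).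 Given $X_1,\dots,X_n$, let $X_1^*,\dots,X_n^*$ be i.i.d. draws from the empirical distribution of $X_1,\dots,X_n$, let $U_n^*=\frac{(n-m)!}{n!}\sum_{\boldsymbol i\in I_n^m}a(\boldsymbol i)h(X^*_{i_1},\dots,X^*_{i_m})$, and let $\mathrm{Var}^*$ be the conditional variance given $X_1,\dots,X_n$. Assume that $V(n)>0$ for all large $n$, that there are constants $M(n)>0$ with $\max_{\boldsymbol i\in I_n^m}E\{h(X_{i_1},\dots,X_{i_m})^4\}\le M(n)$ for every $n$, and that, as $n\to\infty$, $$n^{-2}V(n)^{-1}A_{2,2}(n)M(n)^{1/2}\to0,\qquad n^{-2}V(n)^{-3/2}A_{3,1}(n)M(n)^{3/4}\to0,$$ $$\limsup_{n\to\infty}\max_{1\le i_1,\dots,i_m\le n}E\{h(X_{i_1},\dots,X_{i_m})^2\}<\infty,\qquad n^{-2}\sigma_n^{-2}A_{2,1}(n)\to0.$$ Then $$\frac1n\sum_{i=1}^n\sum_{j=1}^n\Big\{\frac{h_{1,i}(X_j)}{n\sigma_n}\Big\}^2\xrightarrow{P}1,\qquad \frac1{n^2}\sum_{i=1}^n\Big\{\sum_{j=1}^n\frac{h_{1,i}(X_j)}{n\sigma_n}\Big\}^2\xrightarrow{P}0,$$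 $$n^{-1}\sigma_n^{-2}A_{2,1}(n)\{M_1(n)^2+M_2(n)+n^{-1}\}\to0,$$ and the Efron bootstrap variance estimate is consistent: $$\big|\mathrm{Var}^*(\sigma_n^{-1}U_n^*)-\mathrm{Var}(\sigma_n^{-1}U_n)\big|\xrightarrow{P}0.$$ -/

import Mathlib

open MeasureTheory ProbabilityTheory Filter Topology
open scoped ENNReal Nat

namespace WeightedU

/-! Weighted U-statistics of degree `m = d + 1` (so that `m ≥ 1`), for a fixed sample size `n`.
The indices `1, …, n` are the elements of `Fin n`. -/

section Combinatorics

open scoped Classical in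
/-- The index set `I_n^m` of `m`-tuples from `[n]` without repeated entries. -/
noncomputable def indexSet (m n : ℕ) : Finset (Fin m → Fin n) :=
  Finset.univ.filter fun I => Function.Injective I

open scoped Classical in
/-- The index set `I_{n-1}^{d}(-i)` of `d`-tuples from `[n] \ {i}` without repeated entries. -/
noncomputable def indexSetAvoiding (d : ℕ) {n : ℕ} (i : Fin n) : Finset (Fin d → Fin n) :=
  Finset.univ.filter fun J => Function.Injective J ∧ ∀ k, J k ≠ i

open scoped Classical in
/-- The set of indices that occur in each of the `K` tuples `T 0, …, T (K - 1)`. -/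
noncomputable def commonIndices {K m n : ℕ} (T : Fin K → Fin m → Fin n) : Finset (Fin n) :=
  Finset.univ.filter fun v => ∀ k, v ∈ Set.range (T k)

open scoped Classical in
/-- `(I_n^m)_{≥ q}^{⊗ K}`: the `K`-tuples of elements of `I_n^m` that share at least `q` common
indices. -/
noncomputable def sharingAtLeast (K q m n : ℕ) : Finset (Fin K → Fin m → Fin n) :=
  Finset.univ.filter fun T => (∀ k, T k ∈ indexSet m n) ∧ q ≤ (commonIndices T).card

/-- The average weight `A_{K,q}(n)`. It is `0` if there is no tuple to average over. -/
noncomputable def avgWeight (K q : ℕ) {m n : ℕ} (a : (Fin m → Fin n) → ℝ) : ℝ :=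
  ((sharingAtLeast K q m n).card : ℝ)⁻¹ * ∑ T ∈ sharingAtLeast K q m n, |∏ k, a (T k)|

end Combinatorics

section Statistic

variable {S : Type*}

/-- The weighted U-statistic
`(n-m)!/n! ∑_{I_n^m} a(i₁, …, i_m) h(x_{i₁}, …, x_{i_m})` at the data points `x₁, …, x_n`. -/
noncomputable def uStat {m n : ℕ} (a : (Fin m → Fin n) → ℝ) (h : (Fin m → S) → ℝ)
    (x : Fin n → S) : ℝ :=
  ((n - m)! : ℝ) / (n ! : ℝ) * ∑ I ∈ indexSet m n, a I * h (fun k => x (I k))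

/-- The empirical distribution of the data points `x₁, …, x_n`. -/
noncomputable def empirical [MeasurableSpace S] {n : ℕ} (x : Fin n → S) : Measure S :=
  (n : ℝ≥0∞)⁻¹ • ∑ i, Measure.dirac (x i)

/-- The conditional law, given that the data are `x₁, …, x_n`, of Efron's bootstrap sample
`(X₁*, …, X_n*)`: `n` independent draws from the empirical distribution. -/
noncomputable def bootstrapLaw [MeasurableSpace S] {n : ℕ} (x : Fin n → S) :
    Measure (Fin n → S) :=
  Measure.pi fun _ : Fin n => empirical x

/-- `Var*(g(X₁*, …, X_n*))`, the variance conditional on the data being `x₁, …, x_n`. -/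
noncomputable def bootstrapVar [MeasurableSpace S] {n : ℕ} (g : (Fin n → S) → ℝ)
    (x : Fin n → S) : ℝ :=
  variance g (bootstrapLaw x)

end Statistic

section Population

variable {Ω S : Type*} [MeasurableSpace Ω] [MeasurableSpace S]

/-- The random variable `U_n = U_n(X₁, …, X_n)`. -/
noncomputable def U {m n : ℕ} (a : (Fin m → Fin n) → ℝ) (h : (Fin m → S) → ℝ)
    (X : Fin n → Ω → S) (ω : Ω) : ℝ :=
  uStat a h (fun i => X i ω)

/-- The standard deviation `σ_n` of `U_n`. -/
noncomputable def sigma (μ : Measure Ω) {m n : ℕ} (a : (Fin m → Fin n) → ℝ)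
    (h : (Fin m → S) → ℝ) (X : Fin n → Ω → S) : ℝ :=
  √(variance (U a h X) μ)

/-- `θ(i₁, …, i_m) = E h(X_{i₁}, …, X_{i_m})`. -/
noncomputable def theta (μ : Measure Ω) {m n : ℕ} (h : (Fin m → S) → ℝ) (X : Fin n → Ω → S)
    (I : Fin m → Fin n) : ℝ :=
  ∫ ω, h (fun k => X (I k) ω) ∂μ

/-- `f^{(l)}_{i₁, …, i_{m-1}}(x)`: the integral of `h` with `x` inserted at position `l` and the
other arguments distributed as independent copies of `X_{i₁}, …, X_{i_{m-1}}`. -/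
noncomputable def proj (μ : Measure Ω) {d n : ℕ} (h : (Fin (d + 1) → S) → ℝ)
    (X : Fin n → Ω → S) (l : Fin (d + 1)) (J : Fin d → Fin n) (x : S) : ℝ :=
  ∫ y : Fin d → S, h (Fin.insertNth (α := fun _ => S) l x y)
    ∂(Measure.pi fun k => μ.map (X (J k)))

/-- The first order expansion `h_{1,i;i₁, …, i_{m-1}}(x)`. -/
noncomputable def h1At (μ : Measure Ω) {d n : ℕ} (a : (Fin (d + 1) → Fin n) → ℝ)
    (h : (Fin (d + 1) → S) → ℝ) (X : Fin n → Ω → S) (i : Fin n) (J : Fin d → Fin n)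
    (x : S) : ℝ :=
  ∑ l : Fin (d + 1), a (Fin.insertNth (α := fun _ => Fin n) l i J) *
    (proj μ h X l J x - theta μ h X (Fin.insertNth (α := fun _ => Fin n) l i J))

/-- The first order expansion `h_{1,i}(x)`. -/
noncomputable def h1 (μ : Measure Ω) {d n : ℕ} (a : (Fin (d + 1) → Fin n) → ℝ)
    (h : (Fin (d + 1) → S) → ℝ) (X : Fin n → Ω → S) (i : Fin n) (x : S) : ℝ :=
  ((n - (d + 1))! : ℝ) / ((n - 1)! : ℝ) * ∑ J ∈ indexSetAvoiding d i, h1At μ a h X i J x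

/-- `V(n) = Var(n⁻¹ ∑ᵢ h_{1,i}(X_i))`. -/
noncomputable def V (μ : Measure Ω) {d n : ℕ} (a : (Fin (d + 1) → Fin n) → ℝ)
    (h : (Fin (d + 1) → S) → ℝ) (X : Fin n → Ω → S) : ℝ :=
  variance (fun ω => (n : ℝ)⁻¹ * ∑ i, h1 μ a h X i (X i ω)) μ

/-- `M₁(n)`, the maximal difference of two values of `θ` on `I_n^m`. -/
noncomputable def M1 (μ : Measure Ω) {m n : ℕ} (h : (Fin m → S) → ℝ) (X : Fin n → Ω → S) : ℝ :=
  sSup {v : ℝ | ∃ I ∈ indexSet m n, ∃ J ∈ indexSet m n, v = |theta μ h X I - theta μ h X J|}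

/-- `E[E{h(X_{r₁}, …, X_{r_m}) h(X_{s₁}, …, X_{s_m}) | X_c}]`. -/
noncomputable def meanCondProd (μ : Measure Ω) {m n : ℕ} (h : (Fin m → S) → ℝ)
    (X : Fin n → Ω → S) (r s : Fin m → Fin n) (c : Fin n) : ℝ :=
  ∫ ω, (μ[fun ω' => h (fun k => X (r k) ω') * h (fun k => X (s k) ω') |
    MeasurableSpace.comap (X c) inferInstance]) ω ∂μ

/-- `M₂(n)`: the maximum over positions `p`, `q` and over `r, s, k ∈ I_n^m` such that `r` and `s`
have exactly the index `r_p = s_q` in common, and `k` and `s` exactly the index `k_p = s_q`. -/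
noncomputable def M2 (μ : Measure Ω) {m n : ℕ} (h : (Fin m → S) → ℝ) (X : Fin n → Ω → S) : ℝ :=
  sSup {v : ℝ | ∃ (p q : Fin m), ∃ r ∈ indexSet m n, ∃ s ∈ indexSet m n, ∃ k ∈ indexSet m n,
    (r p = s q ∧ Set.range r ∩ Set.range s = {s q}) ∧
    (k p = s q ∧ Set.range k ∩ Set.range s = {s q}) ∧
    v = |meanCondProd μ h X r s (k p) - meanCondProd μ h X k s (k p)|}

end Population

end WeightedU

set_option linter.unusedSectionVars false

/-! Write $m=d+1$, let $Q$ be the common law of the data for the given $n$, and let $g_l$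
(`projKernel`) be the centred conditional mean of $h$ given its $l$-th argument. Because the data
are i.i.d., $\theta$ is constant on $I_n^m$ and $f^{(l)}_{\boldsymbol j}$ does not depend on
$\boldsymbol j$. Hence $h_{1,i}=\sum_l w_{l,i}\,g_l$ with deterministic weights (`IsSample.h1_eq`).
For the same reason $M_1$ and $M_2$ vanish, and the third claim is the last hypothesis in disguise.

Variance. $U_n$ is a constant plus $n^{-1}\sum_i h_{1,i}(X_i)$ plus a remainder $R$ (`U_eq`). The
kernel of $R$ integrates to zero over all arguments but one. So $R$ is orthogonal to the linear
part, and two of its summands are orthogonal unless their tuples share two indices. This gives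
$\sigma_n^2=V(n)+\mathrm{Var}\,R$ exactly, with $\mathrm{Var}\,R\le Cn^{-2}A_{2,2}(n)E h^2$
(`IsSample.variance_U`, `IsSample.integral_remainder_sq_le`), and therefore $V(n)/\sigma_n^2\to1$.

First two claims. The first average is a mean of $n$ i.i.d. terms with expectation
$V(n)/\sigma_n^2$. Its variance is at most a sum of fourth powers of normalised weights
(`IsSample.integral_normAvg_sub_sq_le`); these weights are eventually at most $1$, so third powers
suffice, and they are controlled by $A_{3,1}(n)$. The second average has expectation
$n^{-1}V(n)/\sigma_n^2$.

Bootstrap. The variance decomposition holds for samples from any law, hence also conditionally on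
the data, with $Q$ replaced by the empirical distribution (`isSample_bootstrapLaw`). The leading
term of $\mathrm{Var}^*$ is then the first average with empirical projections $\hat g_l$ in place of
$g_l$ (`V_bootstrap_eq`). The remainder is at most its weight factor times the second moment of $h$
under independent empirical draws. Only a fraction $O(1/n)$ of all tuples has repeated entries, so
that moment has mean at most $E h^2+O(1/n)$. At the sample points, $\hat g_l-g_l$ has mean square
$O(1/n)$ (`SecondMomentBound.integral_projError_le`). Together with squared weights of total order
$nA_{2,1}(n)/(n\sigma_n)^2$ this leaves $n^{-2}\sigma_n^{-2}A_{2,1}(n)\to0$.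

All four errors are bounded for fixed $n$; the limits are taken only in the main theorem. -/

namespace WeightedU

/-! ### Counting tuples with prescribed coincidences -/

section Counting

theorem mem_indexSet {m n : ℕ} {I : Fin m → Fin n} : I ∈ indexSet m n ↔ Function.Injective I := by
  simp [indexSet]

theorem mem_indexSetAvoiding {d n : ℕ} {i : Fin n} {J : Fin d → Fin n} :
    J ∈ indexSetAvoiding d i ↔ Function.Injective J ∧ ∀ k, J k ≠ i := by
  simp [indexSetAvoiding]

theorem mem_sharingAtLeast {K q m n : ℕ} {T : Fin K → Fin m → Fin n} :
    T ∈ sharingAtLeast K q m n ↔ (∀ k, T k ∈ indexSet m n) ∧ q ≤ (commonIndices T).card := by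
  simp [sharingAtLeast]

theorem mem_commonIndices {K m n : ℕ} {T : Fin K → Fin m → Fin n} {v : Fin n} :
    v ∈ commonIndices T ↔ ∀ k, v ∈ Set.range (T k) := by
  simp [commonIndices]

/-- If the value at `k` is determined by the other values on the set `s`, then freeing this value
shows that `s` occupies at most one `n`-th of any set that contains all the modified functions. -/
theorem mul_card_le_of_update {m n : ℕ} (k : Fin m) (s t : Finset (Fin m → Fin n))
    (g : (Fin m → Fin n) → Fin n)
    (hg : ∀ J ∈ s, ∀ u, g (Function.update J k u) = J k)
    (ht : ∀ J ∈ s, ∀ u, Function.update J k u ∈ t) : n * s.card ≤ t.card := by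
  have h := Finset.card_le_card_of_injOn (s := s ×ˢ (Finset.univ : Finset (Fin n))) (t := t)
    (fun p => Function.update p.1 k p.2) (fun p hp => ht _ (by simpa using hp) _) (by
      rintro ⟨J, u⟩ hJ ⟨J', u'⟩ hJ' hEq
      simp only [Finset.coe_product, Finset.coe_univ, Set.mem_prod, Set.mem_univ, and_true,
        Finset.mem_coe] at hJ hJ' hEq
      have hk : u = u' := by simpa using congrFun hEq k
      have h1 := hg J hJ u
      have h2 := hg J' hJ' u'
      rw [hEq] at h1
      have hJk : J k = J' k := h1.symm.trans h2
      refine Prod.ext (funext fun j => ?_) hk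
      by_cases hj : j = k
      · subst hj; exact hJk
      · simpa [hj] using congrFun hEq j)
  simpa [Finset.card_product, mul_comm] using h

theorem card_tuples (m n : ℕ) : (Finset.univ : Finset (Fin m → Fin n)).card = n ^ m := by
  simp

open scoped Classical in
theorem mul_card_eval_eq_le {m n : ℕ} (k : Fin m) (v : Fin n) :
    n * (Finset.univ.filter fun J : Fin m → Fin n => J k = v).card ≤ n ^ m := by
  rw [← card_tuples m n]
  exact mul_card_le_of_update k _ _ (fun _ => v) (by simp +contextual) (by simp)

open scoped Classical in
theorem mul_card_eval_eq_eval_le {m n : ℕ} {k l : Fin m} (hkl : k ≠ l) :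
    n * (Finset.univ.filter fun J : Fin m → Fin n => J k = J l).card ≤ n ^ m := by
  rw [← card_tuples m n]
  exact mul_card_le_of_update k _ _ (fun J => J l) (by simp +contextual [hkl.symm]) (by simp)

open scoped Classical in
theorem sq_mul_card_eval_eq_eval_eq_le {m n : ℕ} {k l : Fin m} (hkl : k ≠ l) (v w : Fin n) :
    n ^ 2 * (Finset.univ.filter fun J : Fin m → Fin n => J k = v ∧ J l = w).card ≤ n ^ m := by
  have h := mul_card_le_of_update k
    (Finset.univ.filter fun J : Fin m → Fin n => J k = v ∧ J l = w)
    (Finset.univ.filter fun J : Fin m → Fin n => J l = w) (fun _ => v)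
    (by simp +contextual) (by simp +contextual [hkl.symm])
  calc _ = n * (n * (Finset.univ.filter fun J : Fin m → Fin n => J k = v ∧ J l = w).card) := by
        ring
    _ ≤ n * (Finset.univ.filter fun J : Fin m → Fin n => J l = w).card := Nat.mul_le_mul_left _ h
    _ ≤ _ := mul_card_eval_eq_le l w

open scoped Classical in
/-- The injective tuples in which the index `i` occurs. -/
noncomputable def indexSetThrough (m : ℕ) {n : ℕ} (i : Fin n) : Finset (Fin m → Fin n) :=
  (indexSet m n).filter fun I => i ∈ Set.range I

theorem mem_indexSetThrough {m n : ℕ} {i : Fin n} {I : Fin m → Fin n} :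
    I ∈ indexSetThrough m i ↔ Function.Injective I ∧ i ∈ Set.range I := by
  simp [indexSetThrough, mem_indexSet]

theorem mul_card_indexSetThrough_le {m n : ℕ} (i : Fin n) :
    n * (indexSetThrough m i).card ≤ m * n ^ m := by
  classical
  have hsub : indexSetThrough m i ⊆
      Finset.univ.biUnion fun p : Fin m => Finset.univ.filter fun I : Fin m → Fin n => I p = i := by
    intro I hI
    obtain ⟨p, hp⟩ := (mem_indexSetThrough.1 hI).2
    simpa using ⟨p, hp⟩
  calc n * (indexSetThrough m i).card
      ≤ n * ∑ p : Fin m, (Finset.univ.filter fun I : Fin m → Fin n => I p = i).card :=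
        Nat.mul_le_mul_left _ ((Finset.card_le_card hsub).trans Finset.card_biUnion_le)
    _ = ∑ p : Fin m, n * (Finset.univ.filter fun I : Fin m → Fin n => I p = i).card := by
        rw [Finset.mul_sum]
    _ ≤ ∑ _p : Fin m, n ^ m := Finset.sum_le_sum fun p _ => mul_card_eval_eq_le p i
    _ = m * n ^ m := by simp

/-- Sort the families by a common index $i$: each of the $K$ members is one of at most $m\,n^{m-1}$
tuples through $i$. Powers of $n$ are kept on the left so that the count stays in `ℕ` without
division. -/
theorem pow_mul_card_sharingAtLeast_one_le (K m n : ℕ) :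
    n ^ K * (sharingAtLeast K 1 m n).card ≤ n * (m * n ^ m) ^ K := by
  classical
  have hsub : sharingAtLeast K 1 m n ⊆
      Finset.univ.biUnion fun i : Fin n => Fintype.piFinset fun _ : Fin K => indexSetThrough m i := by
    intro T hT
    obtain ⟨hT1, hT2⟩ := mem_sharingAtLeast.1 hT
    obtain ⟨v, hv⟩ := Finset.card_pos.1 hT2
    rw [mem_commonIndices] at hv
    simp only [Finset.mem_biUnion, Finset.mem_univ, true_and, Fintype.mem_piFinset]
    exact ⟨v, fun k => mem_indexSetThrough.2 ⟨mem_indexSet.1 (hT1 k), hv k⟩⟩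
  calc n ^ K * (sharingAtLeast K 1 m n).card
      ≤ n ^ K * ∑ i : Fin n, (indexSetThrough m i).card ^ K := by
        refine Nat.mul_le_mul_left _ ((Finset.card_le_card hsub).trans ?_)
        refine Finset.card_biUnion_le.trans (le_of_eq ?_)
        simp [Fintype.card_piFinset]
    _ = ∑ i : Fin n, (n * (indexSetThrough m i).card) ^ K := by
        rw [Finset.mul_sum]; simp [mul_pow]
    _ ≤ ∑ _i : Fin n, (m * n ^ m) ^ K :=
        Finset.sum_le_sum fun i _ => Nat.pow_le_pow_left (mul_card_indexSetThrough_le i) K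
    _ = _ := by simp

/-- Since $v\ne w$, they occupy two different positions, which leaves $n^{m-2}$ tuples for each of
at most $m^2$ pairs of positions. -/
theorem sq_mul_card_through_pair_le {m n : ℕ} {v w : Fin n} (hvw : v ≠ w) :
    n ^ 2 * (indexSetThrough m v ∩ indexSetThrough m w).card ≤ m ^ 2 * n ^ m := by
  classical
  have hsub : indexSetThrough m v ∩ indexSetThrough m w ⊆
      (Finset.univ.filter fun p : Fin m × Fin m => p.1 ≠ p.2).biUnion
        fun p => Finset.univ.filter fun I : Fin m → Fin n => I p.1 = v ∧ I p.2 = w := by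
    intro I hI
    obtain ⟨p, hp⟩ := (mem_indexSetThrough.1 (Finset.mem_inter.1 hI).1).2
    obtain ⟨q, hq⟩ := (mem_indexSetThrough.1 (Finset.mem_inter.1 hI).2).2
    simp only [Finset.mem_biUnion, Finset.mem_filter, Finset.mem_univ, true_and]
    exact ⟨(p, q), fun h => hvw (by rw [← hp, ← hq]; exact congrArg I h), hp, hq⟩
  calc n ^ 2 * (indexSetThrough m v ∩ indexSetThrough m w).card
      ≤ n ^ 2 * ∑ p ∈ (Finset.univ.filter fun p : Fin m × Fin m => p.1 ≠ p.2),
          (Finset.univ.filter fun I : Fin m → Fin n => I p.1 = v ∧ I p.2 = w).card :=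
        Nat.mul_le_mul_left _ ((Finset.card_le_card hsub).trans Finset.card_biUnion_le)
    _ ≤ ∑ _p ∈ (Finset.univ.filter fun p : Fin m × Fin m => p.1 ≠ p.2), n ^ m := by
        rw [Finset.mul_sum]
        exact Finset.sum_le_sum fun p hp =>
          sq_mul_card_eval_eq_eval_eq_le (Finset.mem_filter.1 hp).2 v w
    _ ≤ ∑ _p : Fin m × Fin m, n ^ m :=
        Finset.sum_le_sum_of_subset (Finset.filter_subset _ _)
    _ = _ := by simp [sq]

theorem sq_mul_card_sharingAtLeast_two_le (m n : ℕ) :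
    n ^ 2 * (sharingAtLeast 2 2 m n).card ≤ m ^ 4 * (n ^ m) ^ 2 := by
  classical
  have hsub : sharingAtLeast 2 2 m n ⊆
      (Finset.univ.filter fun p : Fin n × Fin n => p.1 ≠ p.2).biUnion fun p =>
        Fintype.piFinset fun _ : Fin 2 => indexSetThrough m p.1 ∩ indexSetThrough m p.2 := by
    intro T hT
    obtain ⟨hT1, hT2⟩ := mem_sharingAtLeast.1 hT
    obtain ⟨v, hv, w, hw, hvw⟩ := Finset.one_lt_card.1 hT2
    rw [mem_commonIndices] at hv hw
    simp only [Finset.mem_biUnion, Finset.mem_filter, Finset.mem_univ, true_and,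
      Fintype.mem_piFinset, Finset.mem_inter]
    exact ⟨(v, w), hvw, fun k => ⟨mem_indexSetThrough.2 ⟨mem_indexSet.1 (hT1 k), hv k⟩,
      mem_indexSetThrough.2 ⟨mem_indexSet.1 (hT1 k), hw k⟩⟩⟩
  -- Each of the two tuples contributes $n^2$ for its two prescribed entries, and the choice of the
  -- pair of common indices costs $n^2$. The surplus $n^2$ is cancelled at the end, which requires
  -- $n>0$.
  have key : n ^ 4 * (sharingAtLeast 2 2 m n).card ≤ n ^ 2 * (m ^ 4 * (n ^ m) ^ 2) := by
    calc n ^ 4 * (sharingAtLeast 2 2 m n).card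
        ≤ n ^ 4 * ∑ p ∈ (Finset.univ.filter fun p : Fin n × Fin n => p.1 ≠ p.2),
            (indexSetThrough m p.1 ∩ indexSetThrough m p.2).card ^ 2 := by
          refine Nat.mul_le_mul_left _ ((Finset.card_le_card hsub).trans ?_)
          refine Finset.card_biUnion_le.trans (le_of_eq ?_)
          simp [Fintype.card_piFinset]
      _ = ∑ p ∈ (Finset.univ.filter fun p : Fin n × Fin n => p.1 ≠ p.2),
            (n ^ 2 * (indexSetThrough m p.1 ∩ indexSetThrough m p.2).card) ^ 2 := by
          rw [Finset.mul_sum]; exact Finset.sum_congr rfl fun p _ => by ring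
      _ ≤ ∑ _p ∈ (Finset.univ.filter fun p : Fin n × Fin n => p.1 ≠ p.2),
            (m ^ 2 * n ^ m) ^ 2 := Finset.sum_le_sum fun p hp =>
          Nat.pow_le_pow_left (sq_mul_card_through_pair_le (Finset.mem_filter.1 hp).2) 2
      _ ≤ ∑ _p : Fin n × Fin n, (m ^ 2 * n ^ m) ^ 2 :=
          Finset.sum_le_sum_of_subset (Finset.filter_subset _ _)
      _ = _ := by simp; ring
  rcases Nat.eq_zero_or_pos n with rfl | hn
  · simp
  · refine le_of_mul_le_mul_left (a := n ^ 2) ?_ (pow_pos hn 2)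
    calc _ = n ^ 4 * (sharingAtLeast 2 2 m n).card := by ring
      _ ≤ _ := key

open scoped Classical in
/-- Up to the factor `m ^ 2`, at most one `n`-th of all `m`-tuples has repeated entries. -/
theorem mul_card_not_injective_le (m n : ℕ) :
    n * (Finset.univ.filter fun J : Fin m → Fin n => ¬ Function.Injective J).card
      ≤ m ^ 2 * n ^ m := by
  have hsub : (Finset.univ.filter fun J : Fin m → Fin n => ¬ Function.Injective J) ⊆
      (Finset.univ.filter fun p : Fin m × Fin m => p.1 ≠ p.2).biUnion
        fun p => Finset.univ.filter fun I : Fin m → Fin n => I p.1 = I p.2 := by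
    intro I hI
    simp only [Finset.mem_filter, Finset.mem_univ, true_and, Function.Injective, not_forall] at hI
    obtain ⟨p, q, hpq, hne⟩ := hI
    simp only [Finset.mem_biUnion, Finset.mem_filter, Finset.mem_univ, true_and]
    exact ⟨(p, q), hne, hpq⟩
  calc _ ≤ n * ∑ p ∈ (Finset.univ.filter fun p : Fin m × Fin m => p.1 ≠ p.2),
          (Finset.univ.filter fun I : Fin m → Fin n => I p.1 = I p.2).card :=
        Nat.mul_le_mul_left _ ((Finset.card_le_card hsub).trans Finset.card_biUnion_le)
    _ ≤ ∑ _p ∈ (Finset.univ.filter fun p : Fin m × Fin m => p.1 ≠ p.2), n ^ m := by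
        rw [Finset.mul_sum]
        exact Finset.sum_le_sum fun p hp => mul_card_eval_eq_eval_le (Finset.mem_filter.1 hp).2
    _ ≤ ∑ _p : Fin m × Fin m, n ^ m :=
        Finset.sum_le_sum_of_subset (Finset.filter_subset _ _)
    _ = _ := by simp [sq]

open scoped Classical in
/-- Few tuples `J` have a repeated entry or meet a given finite list of indices. -/
theorem mul_card_meeting_le {d e n : ℕ} (L : Fin e → Fin n) :
    n * (Finset.univ.filter fun J : Fin d → Fin n =>
      ¬ (Function.Injective J ∧ ∀ k j, J k ≠ L j)).card ≤ (d ^ 2 + d * e) * n ^ d := by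
  have hsub : (Finset.univ.filter fun J : Fin d → Fin n =>
      ¬ (Function.Injective J ∧ ∀ k j, J k ≠ L j)) ⊆
      (Finset.univ.filter fun J : Fin d → Fin n => ¬ Function.Injective J) ∪
      Finset.univ.biUnion fun p : Fin d × Fin e =>
        Finset.univ.filter fun J : Fin d → Fin n => J p.1 = L p.2 := by
    intro J hJ
    simp only [Finset.mem_filter, Finset.mem_univ, true_and, not_and_or, not_forall,
      not_not] at hJ
    simp only [Finset.mem_union, Finset.mem_biUnion, Finset.mem_filter, Finset.mem_univ, true_and]
    exact hJ.imp id fun ⟨k, j, h⟩ => ⟨(k, j), h⟩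
  calc _ ≤ n * ((Finset.univ.filter fun J : Fin d → Fin n => ¬ Function.Injective J).card +
        ∑ p : Fin d × Fin e, (Finset.univ.filter fun J : Fin d → Fin n => J p.1 = L p.2).card) :=
        Nat.mul_le_mul_left _ (((Finset.card_le_card hsub).trans (Finset.card_union_le _ _)).trans
          (Nat.add_le_add_left Finset.card_biUnion_le _))
    _ ≤ d ^ 2 * n ^ d + ∑ _p : Fin d × Fin e, n ^ d := by
        rw [mul_add, Finset.mul_sum]
        exact Nat.add_le_add (mul_card_not_injective_le d n)
          (Finset.sum_le_sum fun p _ => mul_card_eval_eq_le p.1 (L p.2))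
    _ = _ := by simp; ring

end Counting

/-! ### Weights: from sums over tuples to the averages $A_{K,q}$ -/

section Weights

theorem insertNth_injective_iff {d n : ℕ} {l : Fin (d + 1)} {i : Fin n} {J : Fin d → Fin n} :
    Function.Injective (Fin.insertNth (α := fun _ => Fin n) l i J) ↔
      Function.Injective J ∧ ∀ k, J k ≠ i := by
  constructor
  · intro h
    refine ⟨fun k k' hk => ?_, fun k hk => ?_⟩
    · have := @h (l.succAbove k) (l.succAbove k') (by simpa using hk)
      simpa using this
    · have := @h (l.succAbove k) l (by simpa using hk)
      exact Fin.succAbove_ne l k this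
  · rintro ⟨h1, h2⟩ k k' hk
    induction k using l.succAboveCases with
    | x =>
      induction k' using l.succAboveCases with
      | x => rfl
      | p k' => simp only [Fin.insertNth_apply_same, Fin.insertNth_apply_succAbove] at hk
                exact absurd hk.symm (h2 k')
    | p k =>
      induction k' using l.succAboveCases with
      | x => simp only [Fin.insertNth_apply_same, Fin.insertNth_apply_succAbove] at hk
             exact absurd hk (h2 k)
      | p k' =>
        simp only [Fin.insertNth_apply_succAbove] at hk
        rw [h1 hk]

theorem sum_indexSet_insertNth {d n : ℕ} (l : Fin (d + 1)) (F : (Fin (d + 1) → Fin n) → ℝ) :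
    ∑ I ∈ indexSet (d + 1) n, F I =
      ∑ i : Fin n, ∑ J ∈ indexSetAvoiding d i,
        F (Fin.insertNth (α := fun _ => Fin n) l i J) := by
  classical
  rw [Finset.sum_sigma']
  symm
  refine Finset.sum_bij (fun p _ => Fin.insertNth (α := fun _ => Fin n) l p.1 p.2) ?_ ?_ ?_ ?_
  · rintro ⟨i, J⟩ hp
    simp only [Finset.mem_sigma, Finset.mem_univ, true_and] at hp
    exact mem_indexSet.2 (insertNth_injective_iff.2 (mem_indexSetAvoiding.1 hp))
  · rintro ⟨i, J⟩ _ ⟨i', J'⟩ _ hEq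
    simp only at hEq
    obtain ⟨h1, h2⟩ := Fin.insertNth_inj.1 hEq
    subst h1 h2; rfl
  · intro I hI
    have hI' : Fin.insertNth (α := fun _ => Fin n) l (I l) (l.removeNth I) = I :=
      Fin.insertNth_self_removeNth l I
    refine ⟨⟨I l, l.removeNth I⟩, ?_, hI'⟩
    simp only [Finset.mem_sigma, Finset.mem_univ, true_and]
    rw [mem_indexSetAvoiding, ← insertNth_injective_iff (l := l), hI']
    exact mem_indexSet.1 hI
  · intros; rfl

/-- The total weight at which the argument `l` is filled with the index `i`, normalised as in
`h1`. -/
noncomputable def weightCoef {d n : ℕ} (a : (Fin (d + 1) → Fin n) → ℝ) (l : Fin (d + 1))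
    (i : Fin n) : ℝ :=
  ((n - (d + 1))! : ℝ) / ((n - 1)! : ℝ) *
    ∑ J ∈ indexSetAvoiding d i, a (Fin.insertNth (α := fun _ => Fin n) l i J)

/-- The normalising factor `(n-m)!/n!`. -/
noncomputable def normFactor (m n : ℕ) : ℝ := ((n - m)! : ℝ) / (n ! : ℝ)

theorem normFactor_nonneg (m n : ℕ) : 0 ≤ normFactor m n := by
  unfold normFactor; positivity

/-- The normalisers of $h_{1,i}$ and $U_n$ differ exactly by the factor $n$, because $n!=n\,(n-1)!$.
-/
theorem weightCoef_eq {d n : ℕ} (hn : 0 < n) (a : (Fin (d + 1) → Fin n) → ℝ) (l : Fin (d + 1))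
    (i : Fin n) : weightCoef a l i = n * normFactor (d + 1) n *
      ∑ J ∈ indexSetAvoiding d i, a (Fin.insertNth (α := fun _ => Fin n) l i J) := by
  unfold weightCoef normFactor
  congr 1
  have h1 : (n ! : ℝ) = n * ((n - 1)! : ℝ) := by
    rw [← Nat.mul_factorial_pred hn.ne']; push_cast; rfl
  have h2 : (n : ℝ) ≠ 0 := by exact_mod_cast hn.ne'
  have h3 : ((n - 1)! : ℝ) ≠ 0 := by exact_mod_cast Nat.factorial_ne_zero _
  rw [h1]; field_simp

/-- The normaliser is of order $n^{-m}$: from $n\le m(n-m+1)$ follows $n^m\le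
m^m\,n(n-1)\cdots(n-m+1)$. -/
theorem normFactor_mul_pow_le {m n : ℕ} (h : m ≤ n) : normFactor m n * (n : ℝ) ^ m ≤ (m : ℝ) ^ m := by
  rcases Nat.eq_zero_or_pos m with rfl | hm
  · simp [normFactor, div_self (show (n ! : ℝ) ≠ 0 by exact_mod_cast Nat.factorial_ne_zero _)]
  have h1 : n ^ m ≤ m ^ m * n.descFactorial m := by
    calc n ^ m ≤ (m * (n + 1 - m)) ^ m := by
          refine Nat.pow_le_pow_left ?_ m
          obtain ⟨k, rfl⟩ := Nat.exists_eq_add_of_le h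
          have : m + k + 1 - m = k + 1 := by omega
          rw [this]; nlinarith
      _ = m ^ m * (n + 1 - m) ^ m := mul_pow _ _ _
      _ ≤ _ := Nat.mul_le_mul_left _ (Nat.pow_sub_le_descFactorial n m)
  have h2 : ((n - m)! : ℝ) * n.descFactorial m = n ! := by
    exact_mod_cast Nat.factorial_mul_descFactorial h
  have h3 : (0 : ℝ) < n ! := by exact_mod_cast Nat.factorial_pos _
  unfold normFactor
  rw [div_mul_eq_mul_div, div_le_iff₀ h3, ← h2]
  have h4 : (n : ℝ) ^ m ≤ (m : ℝ) ^ m * n.descFactorial m := by exact_mod_cast h1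
  have h5 : (0 : ℝ) ≤ (n - m)! := by positivity
  nlinarith [mul_le_mul_of_nonneg_left h4 h5]

/-- Regrouping the tuples by their $l$-th entry turns a weighted sum of functions of single entries
into an average over single indices. This identifies the linear part of $U_n$ with $n^{-1}\sum_i
h_{1,i}(X_i)$. -/
theorem sum_indexSet_mul_sum_eq {d n : ℕ} (hn : 0 < n) (a : (Fin (d + 1) → Fin n) → ℝ)
    (w : Fin (d + 1) → Fin n → ℝ) :
    normFactor (d + 1) n * ∑ I ∈ indexSet (d + 1) n, a I * ∑ l, w l (I l) =
      (n : ℝ)⁻¹ * ∑ i, ∑ l, weightCoef a l i * w l i := by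
  have hn' : (n : ℝ) ≠ 0 := by exact_mod_cast hn.ne'
  have h1 : ∑ I ∈ indexSet (d + 1) n, a I * ∑ l, w l (I l) =
      ∑ l, ∑ i, (∑ J ∈ indexSetAvoiding d i,
        a (Fin.insertNth (α := fun _ => Fin n) l i J)) * w l i := by
    simp_rw [Finset.mul_sum]
    rw [Finset.sum_comm]
    refine Finset.sum_congr rfl fun l _ => ?_
    rw [sum_indexSet_insertNth l fun I => a I * w l (I l)]
    simp [Finset.sum_mul]
  rw [h1, Finset.sum_comm, Finset.mul_sum, Finset.mul_sum]
  refine Finset.sum_congr rfl fun i _ => ?_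
  rw [Finset.mul_sum, Finset.mul_sum]
  refine Finset.sum_congr rfl fun l _ => ?_
  rw [weightCoef_eq hn]
  field_simp

/-- The sum of the absolute weights of the tuples through `i`. -/
noncomputable def absWeight {m n : ℕ} (a : (Fin m → Fin n) → ℝ) (i : Fin n) : ℝ :=
  ∑ I ∈ indexSetThrough m i, |a I|

theorem absWeight_nonneg {m n : ℕ} (a : (Fin m → Fin n) → ℝ) (i : Fin n) : 0 ≤ absWeight a i :=
  Finset.sum_nonneg fun _ _ => abs_nonneg _

/-- Insertion of $i$ at position $l$ is injective, and its values are among the tuples through $i$.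
-/
theorem abs_weightCoef_le {d n : ℕ} (hn : 0 < n) (a : (Fin (d + 1) → Fin n) → ℝ) (l : Fin (d + 1))
    (i : Fin n) : |weightCoef a l i| ≤ n * normFactor (d + 1) n * absWeight a i := by
  classical
  have h0 := normFactor_nonneg (d + 1) n
  rw [weightCoef_eq hn, abs_mul, abs_of_nonneg (by positivity)]
  refine mul_le_mul_of_nonneg_left ((Finset.abs_sum_le_sum_abs _ _).trans ?_) (by positivity)
  rw [← Finset.sum_image (f := fun I => |a I|)
    (g := fun J => Fin.insertNth (α := fun _ => Fin n) l i J)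
    (fun J _ J' _ h => (Fin.insertNth_inj.1 h).2)]
  refine Finset.sum_le_sum_of_subset_of_nonneg ?_ fun _ _ _ => abs_nonneg _
  intro I hI
  obtain ⟨J, hJ, rfl⟩ := Finset.mem_image.1 hI
  exact mem_indexSetThrough.2 ⟨insertNth_injective_iff.2 (mem_indexSetAvoiding.1 hJ), l, by simp⟩

theorem avgWeight_nonneg (K q : ℕ) {m n : ℕ} (a : (Fin m → Fin n) → ℝ) : 0 ≤ avgWeight K q a := by
  unfold avgWeight; positivity

theorem sum_sharingAtLeast (K q : ℕ) {m n : ℕ} (a : (Fin m → Fin n) → ℝ) :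
    ∑ T ∈ sharingAtLeast K q m n, |∏ k, a (T k)| =
      (sharingAtLeast K q m n).card * avgWeight K q a := by
  unfold avgWeight
  rcases (sharingAtLeast K q m n).eq_empty_or_nonempty with h | h
  · simp [h]
  · rw [mul_inv_cancel_left₀]
    exact_mod_cast h.card_pos.ne'

/-- The $K$-th power expands into $K$-tuples of index tuples all passing through $i$. Summing over
$i$ counts each such family once per common index, hence at most $m$ times. For this last bound
$K>0$ matters: every index is common to an empty family. -/
theorem sum_absWeight_pow_le {K m n : ℕ} (hK : 0 < K) (a : (Fin m → Fin n) → ℝ) :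
    ∑ i, absWeight a i ^ K ≤ m * ∑ T ∈ sharingAtLeast K 1 m n, |∏ k, a (T k)| := by
  classical
  have h1 : ∀ i, absWeight a i ^ K =
      ∑ T ∈ sharingAtLeast K 1 m n, if i ∈ commonIndices T then |∏ k, a (T k)| else 0 := by
    intro i
    unfold absWeight
    rw [Finset.sum_pow', ← Finset.sum_filter]
    refine Finset.sum_congr ?_ fun T _ => (Finset.abs_prod _ _).symm
    ext T
    simp only [Fintype.mem_piFinset, mem_indexSetThrough, Finset.mem_filter, mem_sharingAtLeast,
      mem_indexSet, mem_commonIndices]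
    constructor
    · intro h
      exact ⟨⟨fun k => (h k).1, Finset.card_pos.2 ⟨i, mem_commonIndices.2 fun k => (h k).2⟩⟩,
        fun k => (h k).2⟩
    · exact fun h k => ⟨h.1.1 k, h.2 k⟩
  simp_rw [h1]
  rw [Finset.sum_comm, Finset.mul_sum]
  refine Finset.sum_le_sum fun T _ => ?_
  rw [Finset.sum_ite_mem, Finset.sum_const, nsmul_eq_mul, Finset.univ_inter]
  refine mul_le_mul_of_nonneg_right ?_ (abs_nonneg _)
  have : commonIndices T ⊆ Finset.univ.image (T ⟨0, hK⟩) := by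
    intro v hv
    obtain ⟨k, hk⟩ := mem_commonIndices.1 hv ⟨0, hK⟩
    exact Finset.mem_image.2 ⟨k, Finset.mem_univ _, hk⟩
  have := (Finset.card_le_card this).trans Finset.card_image_le
  simp only [Finset.card_univ, Fintype.card_fin] at this
  exact_mod_cast this

/-- A sum is its number of terms times its average. There are at most $n(m\,n^{m-1})^K$ terms, and
the normalisers absorb all powers of $n$ except one. -/
theorem pow_mul_sum_sharingAtLeast_one_le {K m n : ℕ} (hmn : m ≤ n) (a : (Fin m → Fin n) → ℝ) :
    (n * normFactor m n) ^ K * ∑ T ∈ sharingAtLeast K 1 m n, |∏ k, a (T k)| ≤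
      ((m : ℝ) ^ (m + 1)) ^ K * n * avgWeight K 1 a := by
  have h0 := normFactor_nonneg m n
  have hA := avgWeight_nonneg K 1 a
  have h1 : (n : ℝ) ^ K * (sharingAtLeast K 1 m n).card ≤ n * (m * (n : ℝ) ^ m) ^ K := by
    exact_mod_cast pow_mul_card_sharingAtLeast_one_le K m n
  have h2 : (normFactor m n * (n : ℝ) ^ m) ^ K ≤ ((m : ℝ) ^ m) ^ K :=
    pow_le_pow_left₀ (by positivity) (normFactor_mul_pow_le hmn) K
  rw [sum_sharingAtLeast]
  calc (n * normFactor m n) ^ K * ((sharingAtLeast K 1 m n).card * avgWeight K 1 a)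
      = normFactor m n ^ K * ((n : ℝ) ^ K * (sharingAtLeast K 1 m n).card) * avgWeight K 1 a := by
        rw [mul_pow]; ring
    _ ≤ normFactor m n ^ K * (n * (m * (n : ℝ) ^ m) ^ K) * avgWeight K 1 a := by gcongr
    _ = (normFactor m n * (n : ℝ) ^ m) ^ K * ((m : ℝ) ^ K * n * avgWeight K 1 a) := by
        rw [mul_pow, mul_pow]; ring
    _ ≤ ((m : ℝ) ^ m) ^ K * ((m : ℝ) ^ K * n * avgWeight K 1 a) := by gcongr
    _ = _ := by rw [pow_succ, mul_pow]; ring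

theorem sum_pow_absWeight_le {K m n : ℕ} (hK : 0 < K) (hmn : m ≤ n) (a : (Fin m → Fin n) → ℝ) :
    ∑ i, (n * normFactor m n * absWeight a i) ^ K ≤
      m * ((m : ℝ) ^ (m + 1)) ^ K * n * avgWeight K 1 a := by
  have h0 := normFactor_nonneg m n
  simp_rw [mul_pow _ (absWeight a _)]
  rw [← Finset.mul_sum]
  calc (n * normFactor m n) ^ K * ∑ i, absWeight a i ^ K
      ≤ (n * normFactor m n) ^ K * (m * ∑ T ∈ sharingAtLeast K 1 m n, |∏ k, a (T k)|) := by
        gcongr; exact sum_absWeight_pow_le hK a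
    _ = m * ((n * normFactor m n) ^ K * ∑ T ∈ sharingAtLeast K 1 m n, |∏ k, a (T k)|) := by ring
    _ ≤ m * (((m : ℝ) ^ (m + 1)) ^ K * n * avgWeight K 1 a) :=
        mul_le_mul_of_nonneg_left (pow_mul_sum_sharingAtLeast_one_le hmn a) (by positivity)
    _ = _ := by ring

theorem sq_normFactor_mul_sum_two_two_le {m n : ℕ} (hn : 0 < n) (hmn : m ≤ n)
    (a : (Fin m → Fin n) → ℝ) :
    normFactor m n ^ 2 * ∑ T ∈ sharingAtLeast 2 2 m n, |∏ k, a (T k)| ≤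
      (m : ℝ) ^ 4 * ((m : ℝ) ^ m) ^ 2 * ((n : ℝ) ^ 2)⁻¹ * avgWeight 2 2 a := by
  have h0 := normFactor_nonneg m n
  have hA := avgWeight_nonneg 2 2 a
  have hn' : (0 : ℝ) < n := by exact_mod_cast hn
  have h1 : (n : ℝ) ^ 2 * (sharingAtLeast 2 2 m n).card ≤ (m : ℝ) ^ 4 * ((n : ℝ) ^ m) ^ 2 := by
    exact_mod_cast sq_mul_card_sharingAtLeast_two_le m n
  have h2 : (normFactor m n * (n : ℝ) ^ m) ^ 2 ≤ ((m : ℝ) ^ m) ^ 2 :=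
    pow_le_pow_left₀ (by positivity) (normFactor_mul_pow_le hmn) 2
  rw [sum_sharingAtLeast]
  calc normFactor m n ^ 2 * ((sharingAtLeast 2 2 m n).card * avgWeight 2 2 a)
      = normFactor m n ^ 2 * ((n : ℝ) ^ 2 * (sharingAtLeast 2 2 m n).card) *
          ((n : ℝ) ^ 2)⁻¹ * avgWeight 2 2 a := by field_simp
    _ ≤ normFactor m n ^ 2 * ((m : ℝ) ^ 4 * ((n : ℝ) ^ m) ^ 2) *
          ((n : ℝ) ^ 2)⁻¹ * avgWeight 2 2 a := by gcongr
    _ = (normFactor m n * (n : ℝ) ^ m) ^ 2 * ((m : ℝ) ^ 4 * ((n : ℝ) ^ 2)⁻¹ * avgWeight 2 2 a) := by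
        ring
    _ ≤ ((m : ℝ) ^ m) ^ 2 * ((m : ℝ) ^ 4 * ((n : ℝ) ^ 2)⁻¹ * avgWeight 2 2 a) := by gcongr
    _ = _ := by ring

/-- The alternative bound through $A_{2,1}$ loses a factor $n$. It serves the part of the bootstrap
second moment that comes from repeated indices, which brings its own factor $n^{-1}$. -/
theorem sq_normFactor_mul_sum_two_two_le' {m n : ℕ} (hn : 0 < n) (hmn : m ≤ n)
    (a : (Fin m → Fin n) → ℝ) :
    normFactor m n ^ 2 * ∑ T ∈ sharingAtLeast 2 2 m n, |∏ k, a (T k)| ≤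
      ((m : ℝ) ^ (m + 1)) ^ 2 * (n : ℝ)⁻¹ * avgWeight 2 1 a := by
  have hn' : (0 : ℝ) < n := by exact_mod_cast hn
  have h0 := normFactor_nonneg m n
  have hsub : sharingAtLeast 2 2 m n ⊆ sharingAtLeast 2 1 m n := fun T hT => by
    rw [mem_sharingAtLeast] at hT ⊢
    exact ⟨hT.1, le_trans (by norm_num) hT.2⟩
  calc normFactor m n ^ 2 * ∑ T ∈ sharingAtLeast 2 2 m n, |∏ k, a (T k)|
      ≤ normFactor m n ^ 2 * ∑ T ∈ sharingAtLeast 2 1 m n, |∏ k, a (T k)| := by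
        gcongr
    _ = ((n : ℝ) ^ 2)⁻¹ * ((n * normFactor m n) ^ 2 *
          ∑ T ∈ sharingAtLeast 2 1 m n, |∏ k, a (T k)|) := by field_simp
    _ ≤ ((n : ℝ) ^ 2)⁻¹ * (((m : ℝ) ^ (m + 1)) ^ 2 * n * avgWeight 2 1 a) :=
        mul_le_mul_of_nonneg_left (pow_mul_sum_sharingAtLeast_one_le hmn a) (by positivity)
    _ = _ := by field_simp

end Weights

theorem integral_comp_of_measurePreserving {α β : Type*} [MeasurableSpace α] [MeasurableSpace β]
    {μ : Measure α} {ν : Measure β} {T : α → β} (hT : MeasurePreserving T μ ν) {f : β → ℝ}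
    (hf : Measurable f) : ∫ x, f (T x) ∂μ = ∫ y, f y ∂ν := by
  rw [← hT.map_eq, integral_map hT.measurable.aemeasurable hf.aestronglyMeasurable]

/-! ### Kernel projections, degeneracy and moment bounds -/

section Kernel

variable {S : Type*} [MeasurableSpace S]

/-- `E h(x at position l, independent draws from Q elsewhere)`. -/
noncomputable def condKernel (Q : Measure S) {d : ℕ} (h : (Fin (d + 1) → S) → ℝ)
    (l : Fin (d + 1)) (x : S) : ℝ :=
  ∫ y : Fin d → S, h (Fin.insertNth (α := fun _ => S) l x y) ∂(Measure.pi fun _ => Q)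

/-- The mean of the kernel under independent draws from `Q`. -/
noncomputable def meanKernel (Q : Measure S) {m : ℕ} (h : (Fin m → S) → ℝ) : ℝ :=
  ∫ z, h z ∂(Measure.pi fun _ => Q)

/-- The centred first order projection of the kernel at position `l`. -/
noncomputable def projKernel (Q : Measure S) {d : ℕ} (h : (Fin (d + 1) → S) → ℝ)
    (l : Fin (d + 1)) (x : S) : ℝ :=
  condKernel Q h l x - meanKernel Q h

/-- The part of the kernel that remains after subtracting mean and first order projections. -/
noncomputable def degKernel (Q : Measure S) {d : ℕ} (h : (Fin (d + 1) → S) → ℝ)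
    (z : Fin (d + 1) → S) : ℝ :=
  h z - meanKernel Q h - ∑ l, projKernel Q h l (z l)

variable {d : ℕ} {h : (Fin (d + 1) → S) → ℝ} {Q : Measure S}

theorem measurable_insertNth (l : Fin (d + 1)) :
    Measurable fun p : S × (Fin d → S) => Fin.insertNth (α := fun _ => S) l p.1 p.2 :=
  (MeasurableEquiv.piFinSuccAbove (fun _ => S) l).symm.measurable

theorem measurePreserving_insertNth [IsProbabilityMeasure Q] (l : Fin (d + 1)) :
    MeasurePreserving (fun p : S × (Fin d → S) => Fin.insertNth (α := fun _ => S) l p.1 p.2)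
      (Q.prod (Measure.pi fun _ => Q)) (Measure.pi fun _ => Q) :=
  (measurePreserving_piFinSuccAbove (fun _ : Fin (d + 1) => Q) l).symm _

variable [IsProbabilityMeasure Q]

theorem measurable_condKernel (hh : Measurable h) (l : Fin (d + 1)) :
    Measurable (condKernel Q h l) := by
  have : StronglyMeasurable (Function.uncurry fun (x : S) (y : Fin d → S) =>
      h (Fin.insertNth (α := fun _ => S) l x y)) :=
    (hh.comp (measurable_insertNth l)).stronglyMeasurable
  exact (this.integral_prod_right (ν := Measure.pi fun _ => Q)).measurable

theorem measurable_projKernel (hh : Measurable h) (l : Fin (d + 1)) :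
    Measurable (projKernel Q h l) :=
  (measurable_condKernel hh l).sub_const _

theorem measurable_degKernel (hh : Measurable h) : Measurable (degKernel Q h) := by
  unfold degKernel
  have := fun l => measurable_projKernel (Q := Q) hh l
  fun_prop

/-- Jensen's inequality, obtained from the monotonicity of $L^p$ norms on a probability space.
Stated in `ℝ≥0∞`, it needs no integrability. -/
theorem enorm_integral_pow_le {α : Type*} [MeasurableSpace α] {ν : Measure α}
    [IsProbabilityMeasure ν] {f : α → ℝ} (hf : AEStronglyMeasurable f ν) {k : ℕ} (hk : k ≠ 0) :
    ‖∫ x, f x ∂ν‖ₑ ^ k ≤ ∫⁻ x, ‖f x‖ₑ ^ k ∂ν := by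
  have h1 : ‖∫ x, f x ∂ν‖ₑ ≤ eLpNorm f (k : ℝ≥0∞) ν := by
    refine (enorm_integral_le_lintegral_enorm f).trans ?_
    rw [← eLpNorm_one_eq_lintegral_enorm]
    exact eLpNorm_le_eLpNorm_of_exponent_le (by exact_mod_cast Nat.one_le_iff_ne_zero.2 hk) hf
  have h2 := eLpNorm_nnreal_pow_eq_lintegral (μ := ν) (f := f) (p := (k : NNReal))
    (by exact_mod_cast hk)
  simp only [NNReal.coe_natCast, ENNReal.rpow_natCast, ENNReal.coe_natCast] at h2
  rw [← h2]
  exact pow_le_pow_left' h1 k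

/-- Conditional expectation contracts $L^k$: Jensen in the integrated arguments, then Tonelli, since
inserting an argument carries the product law to the product law. -/
theorem lintegral_enorm_condKernel_pow_le (hh : Measurable h) (l : Fin (d + 1)) {k : ℕ}
    (hk : k ≠ 0) :
    ∫⁻ x, ‖condKernel Q h l x‖ₑ ^ k ∂Q ≤ ∫⁻ z, ‖h z‖ₑ ^ k ∂(Measure.pi fun _ => Q) := by
  have hm := measurable_insertNth (S := S) l
  calc ∫⁻ x, ‖condKernel Q h l x‖ₑ ^ k ∂Q
      ≤ ∫⁻ x, ∫⁻ y, ‖h (Fin.insertNth (α := fun _ => S) l x y)‖ₑ ^ k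
          ∂(Measure.pi fun _ : Fin d => Q) ∂Q := by
        refine lintegral_mono fun x => enorm_integral_pow_le ?_ hk
        exact (hh.comp (hm.comp measurable_prodMk_left)).aestronglyMeasurable
    _ = ∫⁻ p, ‖h (Fin.insertNth (α := fun _ => S) l p.1 p.2)‖ₑ ^ k
          ∂(Q.prod (Measure.pi fun _ : Fin d => Q)) := by
        rw [lintegral_prod]
        exact ((hh.comp hm).enorm.pow_const k).aemeasurable
    _ = _ := (measurePreserving_insertNth l).lintegral_comp (hh.enorm.pow_const k)

theorem memLp_natCast_iff {α : Type*} [MeasurableSpace α] {ν : Measure α} {f : α → ℝ}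
    (hf : AEStronglyMeasurable f ν) {k : ℕ} (hk : k ≠ 0) :
    MemLp f k ν ↔ ∫⁻ x, ‖f x‖ₑ ^ k ∂ν < ∞ := by
  have := eLpNorm_lt_top_iff_lintegral_rpow_enorm_lt_top (μ := ν) (f := f) (p := (k : ℝ≥0∞))
    (by exact_mod_cast hk) (by simp)
  simp only [ENNReal.toReal_natCast, ENNReal.rpow_natCast] at this
  rw [← this]
  exact ⟨fun h => h.2, fun h => ⟨hf, h⟩⟩

theorem integral_pow_eq_toReal {α : Type*} [MeasurableSpace α] {ν : Measure α} {f : α → ℝ}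
    (hf : AEStronglyMeasurable f ν) {k : ℕ} (hk : Even k) :
    ∫ x, f x ^ k ∂ν = (∫⁻ x, ‖f x‖ₑ ^ k ∂ν).toReal := by
  rw [integral_eq_lintegral_of_nonneg_ae (ae_of_all _ fun x => hk.pow_nonneg _) (hf.pow k)]
  congr 1
  refine lintegral_congr fun x => ?_
  rw [← hk.pow_abs, ENNReal.ofReal_pow (abs_nonneg _), Real.enorm_eq_ofReal_abs]

theorem memLp_condKernel (hh : Measurable h) {k : ℕ} (hk : k ≠ 0)
    (hp : MemLp h k (Measure.pi fun _ => Q)) (l : Fin (d + 1)) : MemLp (condKernel Q h l) k Q :=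
  (memLp_natCast_iff (measurable_condKernel hh l).aestronglyMeasurable hk).2
    ((lintegral_enorm_condKernel_pow_le hh l hk).trans_lt
      ((memLp_natCast_iff hh.aestronglyMeasurable hk).1 hp))

theorem memLp_projKernel (hh : Measurable h) {k : ℕ} (hk : k ≠ 0)
    (hp : MemLp h k (Measure.pi fun _ => Q)) (l : Fin (d + 1)) : MemLp (projKernel Q h l) k Q :=
  (memLp_condKernel hh hk hp l).sub (memLp_const _)

theorem integral_condKernel_pow_le (hh : Measurable h) {k : ℕ} (hk : k ≠ 0) (hk' : Even k)
    (hp : MemLp h k (Measure.pi fun _ => Q)) (l : Fin (d + 1)) :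
    ∫ x, condKernel Q h l x ^ k ∂Q ≤ ∫ z, h z ^ k ∂(Measure.pi fun _ => Q) := by
  rw [integral_pow_eq_toReal (measurable_condKernel hh l).aestronglyMeasurable hk',
    integral_pow_eq_toReal hh.aestronglyMeasurable hk']
  exact ENNReal.toReal_mono ((memLp_natCast_iff hh.aestronglyMeasurable hk).1 hp).ne
    (lintegral_enorm_condKernel_pow_le hh l hk)

theorem meanKernel_pow_le (hh : Measurable h) {k : ℕ} (hk : k ≠ 0) (hk' : Even k)
    (hp : MemLp h k (Measure.pi fun _ => Q)) :
    meanKernel Q h ^ k ≤ ∫ z, h z ^ k ∂(Measure.pi fun _ => Q) := by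
  have h1 := enorm_integral_pow_le (ν := Measure.pi fun _ : Fin (d + 1) => Q)
    hh.aestronglyMeasurable hk
  rw [integral_pow_eq_toReal hh.aestronglyMeasurable hk']
  have h2 := ENNReal.toReal_mono ((memLp_natCast_iff hh.aestronglyMeasurable hk).1 hp).ne h1
  rw [ENNReal.toReal_pow, toReal_enorm, Real.norm_eq_abs, hk'.pow_abs] at h2
  exact h2

theorem integrable_pow_of_memLp {α : Type*} [MeasurableSpace α] {ν : Measure α} {f : α → ℝ}
    {k : ℕ} (hk : k ≠ 0) (hp : MemLp f k ν) : Integrable (fun x => f x ^ k) ν := by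
  have := hp.integrable_norm_pow hk
  refine (integrable_norm_iff (hp.1.pow k)).1 ?_
  simpa using this

theorem integral_projKernel_sq_le (hh : Measurable h) (hp : MemLp h 2 (Measure.pi fun _ => Q))
    (l : Fin (d + 1)) :
    ∫ x, projKernel Q h l x ^ 2 ∂Q ≤ 4 * ∫ z, h z ^ 2 ∂(Measure.pi fun _ => Q) := by
  have hp' : MemLp h (2 : ℕ) (Measure.pi fun _ => Q) := by exact_mod_cast hp
  have h1 := integral_condKernel_pow_le hh two_ne_zero even_two hp' l
  have h2 := meanKernel_pow_le hh two_ne_zero even_two hp'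
  have hi := integrable_pow_of_memLp two_ne_zero (memLp_condKernel hh two_ne_zero hp' l)
  calc ∫ x, projKernel Q h l x ^ 2 ∂Q
      ≤ ∫ x, (2 * condKernel Q h l x ^ 2 + 2 * meanKernel Q h ^ 2) ∂Q := by
        refine integral_mono
          (integrable_pow_of_memLp two_ne_zero (memLp_projKernel hh two_ne_zero hp' l))
          ((hi.const_mul 2).add (integrable_const _)) fun x => ?_
        simp only [projKernel]
        nlinarith [sq_nonneg (condKernel Q h l x + meanKernel Q h)]
    _ = 2 * (∫ x, condKernel Q h l x ^ 2 ∂Q) + 2 * meanKernel Q h ^ 2 := by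
        rw [integral_add (hi.const_mul 2) (integrable_const _), integral_const_mul]; simp
    _ ≤ _ := by linarith

theorem integral_projKernel_pow_four_le (hh : Measurable h)
    (hp : MemLp h 4 (Measure.pi fun _ => Q)) (l : Fin (d + 1)) :
    ∫ x, projKernel Q h l x ^ 4 ∂Q ≤ 16 * ∫ z, h z ^ 4 ∂(Measure.pi fun _ => Q) := by
  have hp' : MemLp h (4 : ℕ) (Measure.pi fun _ => Q) := by exact_mod_cast hp
  have he : Even 4 := ⟨2, rfl⟩
  have h1 := integral_condKernel_pow_le hh four_ne_zero he hp' l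
  have h2 := meanKernel_pow_le hh four_ne_zero he hp'
  have hi := integrable_pow_of_memLp four_ne_zero (memLp_condKernel hh four_ne_zero hp' l)
  calc ∫ x, projKernel Q h l x ^ 4 ∂Q
      ≤ ∫ x, (8 * condKernel Q h l x ^ 4 + 8 * meanKernel Q h ^ 4) ∂Q := by
        refine integral_mono
          (integrable_pow_of_memLp four_ne_zero (memLp_projKernel hh four_ne_zero hp' l))
          ((hi.const_mul 8).add (integrable_const _)) fun x => ?_
        simp only [projKernel]
        generalize condKernel Q h l x = u
        generalize meanKernel Q h = v
        -- The factor $8$: $(u-v)^4\le4(u^2+v^2)^2\le8(u^4+v^4)$.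
        have e1 : (u - v) ^ 2 ≤ 2 * (u ^ 2 + v ^ 2) := by nlinarith [sq_nonneg (u + v)]
        have e2 : ((u - v) ^ 2) ^ 2 ≤ (2 * (u ^ 2 + v ^ 2)) ^ 2 :=
          pow_le_pow_left₀ (sq_nonneg _) e1 2
        nlinarith [sq_nonneg (u ^ 2 - v ^ 2)]
    _ = 8 * (∫ x, condKernel Q h l x ^ 4 ∂Q) + 8 * meanKernel Q h ^ 4 := by
        rw [integral_add (hi.const_mul 8) (integrable_const _), integral_const_mul]; simp
    _ ≤ _ := by linarith

theorem integrable_comp_insertNth {f : (Fin (d + 1) → S) → ℝ}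
    (hf : Integrable f (Measure.pi fun _ => Q)) (l : Fin (d + 1)) :
    Integrable (fun p : S × (Fin d → S) => f (Fin.insertNth (α := fun _ => S) l p.1 p.2))
      (Q.prod (Measure.pi fun _ => Q)) :=
  (measurePreserving_insertNth l).integrable_comp_of_integrable hf

theorem integral_condKernel (hi : Integrable h (Measure.pi fun _ => Q)) (l : Fin (d + 1)) :
    ∫ x, condKernel Q h l x ∂Q = meanKernel Q h := by
  have h1 := integral_prod _ (integrable_comp_insertNth hi l)
  have h2 := (measurePreserving_insertNth (Q := Q) l).integral_comp
    (MeasurableEquiv.piFinSuccAbove (fun _ => S) l).symm.measurableEmbedding h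
  unfold meanKernel condKernel
  rw [← h2, h1]

theorem integral_projKernel (hh : Measurable h) (hi : Integrable h (Measure.pi fun _ => Q))
    (l : Fin (d + 1)) : ∫ x, projKernel Q h l x ∂Q = 0 := by
  have hc : Integrable (condKernel Q h l) Q := by
    refine memLp_one_iff_integrable.1 ?_
    have := memLp_condKernel (k := 1) hh one_ne_zero
      (by simpa using memLp_one_iff_integrable.2 hi) l
    simpa using this
  unfold projKernel
  rw [integral_sub hc (integrable_const _), integral_condKernel hi l]
  simp

/-- Given the $l$-th argument $x$, the conditional mean of $h$ is exactly its mean plus $g_l(x)$,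
both of which have been subtracted; the other projections integrate to zero. The statement is only
almost sure because the sections of $h$ are integrable only for almost every $x$. -/
theorem ae_integral_degKernel_insertNth (hh : Measurable h)
    (hi : Integrable h (Measure.pi fun _ => Q)) (l : Fin (d + 1)) :
    ∀ᵐ x ∂Q, ∫ y, degKernel Q h (Fin.insertNth (α := fun _ => S) l x y)
      ∂(Measure.pi fun _ : Fin d => Q) = 0 := by
  have hg : ∀ k, Integrable (projKernel Q h k) Q := fun k => by
    refine memLp_one_iff_integrable.1 ?_
    have := memLp_projKernel (k := 1) hh one_ne_zero
      (by simpa using memLp_one_iff_integrable.2 hi) k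
    simpa using this
  filter_upwards [(integrable_comp_insertNth hi l).prod_right_ae] with x hx
  have hy : ∀ k : Fin d, Integrable (fun y : Fin d → S => projKernel Q h (l.succAbove k) (y k))
      (Measure.pi fun _ => Q) := fun k =>
    (measurePreserving_eval (fun _ : Fin d => Q) k).integrable_comp_of_integrable (hg _)
  have hy0 : ∀ k : Fin d, ∫ y : Fin d → S, projKernel Q h (l.succAbove k) (y k)
      ∂(Measure.pi fun _ => Q) = 0 := fun k => by
    rw [← integral_projKernel hh hi (l.succAbove k)]
    exact integral_comp_of_measurePreserving (measurePreserving_eval (fun _ : Fin d => Q) k)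
      (measurable_projKernel hh _)
  have hEq : ∀ y : Fin d → S, degKernel Q h (Fin.insertNth (α := fun _ => S) l x y) =
      h (Fin.insertNth (α := fun _ => S) l x y) - (meanKernel Q h + projKernel Q h l x) -
        ∑ k : Fin d, projKernel Q h (l.succAbove k) (y k) := fun y => by
    unfold degKernel
    rw [Fin.sum_univ_succAbove _ l]
    simp only [Fin.insertNth_apply_same, Fin.insertNth_apply_succAbove]
    ring
  simp_rw [hEq]
  have hx' : Integrable (fun y : Fin d → S => h (Fin.insertNth (α := fun _ => S) l x y) -
      (meanKernel Q h + projKernel Q h l x)) (Measure.pi fun _ => Q) :=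
    hx.sub (integrable_const _)
  rw [integral_sub hx' (integrable_finsetSum _ fun k _ => hy k),
    integral_sub hx (integrable_const _), integral_finsetSum _ fun k _ => hy k]
  simp only [hy0, Finset.sum_const_zero, sub_zero, integral_const, probReal_univ, one_smul]
  simp [projKernel, condKernel]

theorem memLp_degKernel (hh : Measurable h) (hp : MemLp h 2 (Measure.pi fun _ => Q)) :
    MemLp (degKernel Q h) 2 (Measure.pi fun _ => Q) := by
  have hp' : MemLp h (2 : ℕ) (Measure.pi fun _ => Q) := by exact_mod_cast hp
  refine (hp.sub (memLp_const _)).sub (memLp_finsetSum _ fun l _ => ?_)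
  have := (memLp_projKernel hh two_ne_zero hp' l).comp_measurePreserving
    (measurePreserving_eval (fun _ : Fin (d + 1) => Q) l)
  exact_mod_cast this

theorem integral_degKernel_sq_le (hh : Measurable h) (hp : MemLp h 2 (Measure.pi fun _ => Q)) :
    ∫ z, degKernel Q h z ^ 2 ∂(Measure.pi fun _ => Q) ≤
      (6 + 12 * ((d : ℝ) + 1) ^ 2) * ∫ z, h z ^ 2 ∂(Measure.pi fun _ => Q) := by
  have hp' : MemLp h (2 : ℕ) (Measure.pi fun _ => Q) := by exact_mod_cast hp
  have h2 := meanKernel_pow_le hh two_ne_zero even_two hp'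
  have hI : Integrable (fun z => h z ^ 2) (Measure.pi fun _ => Q) :=
    integrable_pow_of_memLp two_ne_zero hp'
  have hg : ∀ l : Fin (d + 1), Integrable (fun z : Fin (d + 1) → S => projKernel Q h l (z l) ^ 2)
      (Measure.pi fun _ => Q) := fun l =>
    (measurePreserving_eval (fun _ : Fin (d + 1) => Q) l).integrable_comp_of_integrable
      (integrable_pow_of_memLp two_ne_zero (memLp_projKernel hh two_ne_zero hp' l))
  have hg' : ∀ l : Fin (d + 1), ∫ z : Fin (d + 1) → S, projKernel Q h l (z l) ^ 2
      ∂(Measure.pi fun _ => Q) ≤ 4 * ∫ z, h z ^ 2 ∂(Measure.pi fun _ => Q) := fun l => by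
    refine le_trans (le_of_eq ?_) (integral_projKernel_sq_le hh hp l)
    exact integral_comp_of_measurePreserving (measurePreserving_eval (fun _ : Fin (d + 1) => Q) l)
      ((measurable_projKernel hh l).pow_const 2)
  -- The inequality $(u-v-w)^2\le3(u^2+v^2+w^2)$, with Cauchy–Schwarz for the sum of $d+1$
  -- projections. The final constants are $6=3+3$ and $12(d+1)^2=3(d+1)\cdot4(d+1)$.
  have hpt : ∀ z, degKernel Q h z ^ 2 ≤ (3 * h z ^ 2 + 3 * meanKernel Q h ^ 2) +
      3 * ((d : ℝ) + 1) * ∑ l, projKernel Q h l (z l) ^ 2 := fun z => by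
    have hs := sq_sum_le_card_mul_sum_sq (s := (Finset.univ : Finset (Fin (d + 1))))
      (f := fun l => projKernel Q h l (z l))
    simp only [Finset.card_univ, Fintype.card_fin, Nat.cast_add, Nat.cast_one] at hs
    unfold degKernel
    set s := ∑ l, projKernel Q h l (z l)
    nlinarith [sq_nonneg (h z + meanKernel Q h), sq_nonneg (h z + s),
      sq_nonneg (meanKernel Q h - s)]
  have hA : Integrable (fun z => 3 * h z ^ 2 + 3 * meanKernel Q h ^ 2) (Measure.pi fun _ => Q) :=
    (hI.const_mul 3).add (integrable_const _)
  have hB := (integrable_finsetSum (Finset.univ : Finset (Fin (d + 1)))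
    fun l _ => hg l).const_mul (3 * ((d : ℝ) + 1))
  calc _ ≤ ∫ z, ((3 * h z ^ 2 + 3 * meanKernel Q h ^ 2) +
      3 * ((d : ℝ) + 1) * ∑ l, projKernel Q h l (z l) ^ 2) ∂(Measure.pi fun _ => Q) := by
        refine integral_mono ?_ (hA.add hB) hpt
        refine integrable_pow_of_memLp two_ne_zero ?_
        exact_mod_cast memLp_degKernel hh hp
    _ = 3 * (∫ z, h z ^ 2 ∂(Measure.pi fun _ => Q)) + 3 * meanKernel Q h ^ 2 +
        3 * ((d : ℝ) + 1) * ∑ l : Fin (d + 1), ∫ z : Fin (d + 1) → S, projKernel Q h l (z l) ^ 2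
          ∂(Measure.pi fun _ => Q) := by
        rw [integral_add hA hB, integral_add (hI.const_mul 3) (integrable_const _),
          integral_const_mul (3 : ℝ) fun z => h z ^ 2, integral_const_mul (3 * ((d : ℝ) + 1)),
          integral_finsetSum _ fun l _ => hg l]
        simp
    _ ≤ 3 * (∫ z, h z ^ 2 ∂(Measure.pi fun _ => Q)) +
        3 * (∫ z, h z ^ 2 ∂(Measure.pi fun _ => Q)) +
        3 * ((d : ℝ) + 1) * ∑ _l : Fin (d + 1), 4 * ∫ z, h z ^ 2 ∂(Measure.pi fun _ => Q) := by
        gcongr with l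
        exact hg' l
    _ = _ := by simp; ring

end Kernel

/-! ### First order decomposition of $U_n$ and its variance -/

section Sample

variable {Ω S : Type*} [MeasurableSpace Ω] [MeasurableSpace S]

/-- `X₁, …, X_n` are independent with common law `Q`. -/
structure IsSample {n : ℕ} (μ : Measure Ω) (X : Fin n → Ω → S) (Q : Measure S) : Prop where
  measurable : ∀ i, Measurable (X i)
  indep : iIndepFun X μ
  law : ∀ i, μ.map (X i) = Q

variable {n : ℕ} {μ : Measure Ω} [IsProbabilityMeasure μ] {X : Fin n → Ω → S} {Q : Measure S}

theorem IsSample.measurePreserving (hs : IsSample μ X Q) (i : Fin n) :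
    MeasurePreserving (X i) μ Q := ⟨hs.measurable i, hs.law i⟩

theorem IsSample.measurable_tuple (hs : IsSample μ X Q) {ι : Type*} (I : ι → Fin n) :
    Measurable fun ω k => X (I k) ω :=
  measurable_pi_lambda _ fun k => hs.measurable (I k)

theorem IsSample.measurePreserving_tuple (hs : IsSample μ X Q) {ι : Type*} [Fintype ι]
    {I : ι → Fin n} (hI : Function.Injective I) :
    MeasurePreserving (fun ω k => X (I k) ω) μ (Measure.pi fun _ => Q) := by
  refine ⟨hs.measurable_tuple I, ?_⟩
  rw [(iIndepFun_iff_map_fun_eq_pi_map fun k => (hs.measurable (I k)).aemeasurable).1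
    (hs.indep.precomp hI)]
  simp [hs.law]

theorem IsSample.indepFun_tuple (hs : IsSample μ X Q) {ι κ : Type*} {I : ι → Fin n}
    {J : κ → Fin n} (hIJ : ∀ k j, I k ≠ J j) :
    IndepFun (fun ω k => X (I k) ω) (fun ω j => X (J j) ω) μ := by
  classical
  have h1 := hs.indep.indepFun_finset (Finset.univ.filter fun i => i ∈ Set.range I)
    (Finset.univ.filter fun i => i ∈ Set.range J) (by
      rw [Finset.disjoint_left]
      intro i hi hj
      obtain ⟨k, hk⟩ := (Finset.mem_filter.1 hi).2
      obtain ⟨j, hj⟩ := (Finset.mem_filter.1 hj).2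
      exact hIJ k j (hk.trans hj.symm)) hs.measurable
  have hm : Measurable fun (z : {i // i ∈ Finset.univ.filter fun i => i ∈ Set.range I} → S) k =>
      z ⟨I k, by simp⟩ := measurable_pi_lambda _ fun k => measurable_pi_apply _
  have hm' : Measurable fun (z : {i // i ∈ Finset.univ.filter fun i => i ∈ Set.range J} → S) j =>
      z ⟨J j, by simp⟩ := measurable_pi_lambda _ fun k => measurable_pi_apply _
  exact h1.comp hm hm'

theorem integral_mul_eq_zero_of_indepFun {α β : Type*} [MeasurableSpace α] [MeasurableSpace β]
    {A : Ω → α} {B : Ω → β} (hA : Measurable A) (hB : Measurable B) (hAB : IndepFun A B μ)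
    {F : α × β → ℝ} (hF : Measurable F) {G : α → ℝ} (hG : Measurable G)
    (h0 : ∀ᵐ x ∂(μ.map A), ∫ y, F (x, y) ∂(μ.map B) = 0) :
    ∫ ω, F (A ω, B ω) * G (A ω) ∂μ = 0 := by
  have : IsProbabilityMeasure (μ.map A) := Measure.isProbabilityMeasure_map hA.aemeasurable
  have : IsProbabilityMeasure (μ.map B) := Measure.isProbabilityMeasure_map hB.aemeasurable
  have hmap := (indepFun_iff_map_prod_eq_prod_map_map hA.aemeasurable hB.aemeasurable).1 hAB
  have hm : Measurable fun p : α × β => F p * G p.1 := hF.mul (hG.comp measurable_fst)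
  have h1 : ∫ ω, F (A ω, B ω) * G (A ω) ∂μ =
      ∫ p, F p * G p.1 ∂((μ.map A).prod (μ.map B)) := by
    rw [← hmap, integral_map (hA.prodMk hB).aemeasurable hm.aestronglyMeasurable]
  rw [h1]
  by_cases hi : Integrable (fun p : α × β => F p * G p.1) ((μ.map A).prod (μ.map B))
  · rw [integral_prod _ hi]
    refine integral_eq_zero_of_ae ?_
    filter_upwards [h0] with x hx
    simp only [Pi.zero_apply]
    rw [integral_mul_const, hx, zero_mul]
  -- A non-integrable product has integral $0$ by convention, so no integrability has to be assumed.
  · exact integral_undef hi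

theorem abs_integral_mul_le_of_sq_le {f g : Ω → ℝ} (hf : MemLp f 2 μ) (hg : MemLp g 2 μ) {b : ℝ}
    (hfb : ∫ ω, f ω ^ 2 ∂μ ≤ b) (hgb : ∫ ω, g ω ^ 2 ∂μ ≤ b) : |∫ ω, f ω * g ω ∂μ| ≤ b := by
  calc |∫ ω, f ω * g ω ∂μ| ≤ ∫ ω, |f ω * g ω| ∂μ := abs_integral_le_integral_abs
    _ ≤ ∫ ω, (2⁻¹ * f ω ^ 2 + 2⁻¹ * g ω ^ 2) ∂μ := by
        refine integral_mono (hf.integrable_mul hg).abs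
          ((hf.integrable_sq.const_mul _).add (hg.integrable_sq.const_mul _)) fun ω => ?_
        simp only
        rw [abs_le]
        constructor <;> nlinarith [sq_nonneg (f ω + g ω), sq_nonneg (f ω - g ω)]
    _ = 2⁻¹ * (∫ ω, f ω ^ 2 ∂μ) + 2⁻¹ * ∫ ω, g ω ^ 2 ∂μ := by
        rw [integral_add (hf.integrable_sq.const_mul _) (hg.integrable_sq.const_mul _),
          integral_const_mul, integral_const_mul]
    _ ≤ b := by linarith

/-- A function that is centred in the arguments other than `x` at the indices `I` is orthogonal to
every function of observations whose indices do not occur in `I`. -/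
theorem IsSample.integral_mul_eq_zero [IsProbabilityMeasure Q] (hs : IsSample μ X Q) {d : ℕ}
    {F : S × (Fin d → S) → ℝ} (hF : Measurable F)
    (h0 : ∀ᵐ x ∂Q, ∫ y, F (x, y) ∂(Measure.pi fun _ => Q) = 0)
    {v : Fin n} {I : Fin d → Fin n} (hI : Function.Injective I) (hv : ∀ k, v ≠ I k)
    {κ : Type*} {J : κ → Fin n} (hJ : ∀ j k, J j ≠ I k) {G : (κ → S) → ℝ} (hG : Measurable G) :
    ∫ ω, F (X v ω, fun k => X (I k) ω) * G (fun j => X (J j) ω) ∂μ = 0 := by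
  -- The index $v$ is adjoined to $J$: $F$ is centred only conditionally on $X_v$, so $X_v$ must be
  -- held fixed together with the arguments of $G$.
  let J' : Option κ → Fin n := fun o => o.elim v J
  have hJ' : ∀ o k, J' o ≠ I k := fun o k => by
    cases o with
    | none => exact hv k
    | some j => exact hJ j k
  have hind := hs.indepFun_tuple hJ'
  have hlaw := (hs.measurePreserving_tuple hI).map_eq
  refine integral_mul_eq_zero_of_indepFun (A := fun ω o => X (J' o) ω)
    (B := fun ω k => X (I k) ω) (hs.measurable_tuple J') (hs.measurable_tuple I) hind
    (F := fun p => F (p.1 none, p.2)) (G := fun z => G fun j => z (some j)) ?_ ?_ ?_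
  · exact hF.comp (((measurable_pi_apply none).comp measurable_fst).prodMk measurable_snd)
  · exact hG.comp (measurable_pi_lambda _ fun j => measurable_pi_apply _)
  · rw [hlaw]
    refine ae_of_ae_map (f := fun z : Option κ → S => z none)
      (p := fun x => ∫ y, F (x, y) ∂(Measure.pi fun _ => Q) = 0)
      (measurable_pi_apply none).aemeasurable ?_
    rw [Measure.map_map (measurable_pi_apply none) (hs.measurable_tuple J')]
    change ∀ᵐ x ∂(μ.map (X v)), _
    rw [hs.law]
    exact h0

variable [IsProbabilityMeasure Q] {d : ℕ} {h : (Fin (d + 1) → S) → ℝ}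

/-- The degenerate part of the kernel is orthogonal to functions of observations that share at most
one index with it. -/
theorem IsSample.integral_degKernel_mul_eq_zero (hs : IsSample μ X Q) (hh : Measurable h)
    (hi : Integrable h (Measure.pi fun _ => Q)) {I : Fin (d + 1) → Fin n}
    (hI : Function.Injective I) (l : Fin (d + 1)) {κ : Type*} {J : κ → Fin n}
    (hJ : ∀ j k, J j = I k → k = l) {G : (κ → S) → ℝ} (hG : Measurable G) :
    ∫ ω, degKernel Q h (fun k => X (I k) ω) * G (fun j => X (J j) ω) ∂μ = 0 := by
  have hI' : Function.Injective (fun k => I (l.succAbove k)) :=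
    hI.comp Fin.succAbove_right_injective
  have := hs.integral_mul_eq_zero
    (F := fun p => degKernel Q h (Fin.insertNth (α := fun _ => S) l p.1 p.2))
    ((measurable_degKernel hh).comp (measurable_insertNth l))
    (ae_integral_degKernel_insertNth hh hi l) (v := I l) hI'
    (fun k hk => Fin.succAbove_ne l k (hI hk).symm)
    (fun j k hk => Fin.succAbove_ne l k (hJ j _ hk)) hG
  rw [← this]
  refine integral_congr_ae (ae_of_all _ fun ω => ?_)
  simp only
  congr 2
  exact (Fin.insertNth_self_removeNth l fun k => X (I k) ω).symm

/-- The linear combination of first order projections that makes up `h1`. -/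
noncomputable def projSum (Q : Measure S) (a : (Fin (d + 1) → Fin n) → ℝ)
    (h : (Fin (d + 1) → S) → ℝ) (i : Fin n) (x : S) : ℝ :=
  ∑ l, weightCoef a l i * projKernel Q h l x

theorem measurable_projSum (hh : Measurable h) (a : (Fin (d + 1) → Fin n) → ℝ) (i : Fin n) :
    Measurable (projSum Q a h i) := by
  unfold projSum
  have := fun l => measurable_projKernel (Q := Q) hh l
  fun_prop

theorem memLp_projSum (hh : Measurable h) {k : ℕ} (hk : k ≠ 0)
    (hp : MemLp h k (Measure.pi fun _ => Q)) (a : (Fin (d + 1) → Fin n) → ℝ) (i : Fin n) :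
    MemLp (projSum Q a h i) k Q :=
  memLp_finsetSum _ fun l _ => (memLp_projKernel hh hk hp l).const_mul _

theorem integral_projSum (hh : Measurable h) (hi : Integrable h (Measure.pi fun _ => Q))
    (a : (Fin (d + 1) → Fin n) → ℝ) (i : Fin n) : ∫ x, projSum Q a h i x ∂Q = 0 := by
  have hg : ∀ k, Integrable (projKernel Q h k) Q := fun k => by
    refine memLp_one_iff_integrable.1 ?_
    have := memLp_projKernel (k := 1) hh one_ne_zero
      (by simpa using memLp_one_iff_integrable.2 hi) k
    simpa using this
  unfold projSum
  rw [integral_finsetSum _ fun l _ => (hg l).const_mul _]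
  simp [integral_const_mul, integral_projKernel hh hi]

/-- With a common law the bracket in $h_{1,i}$ is $g_l(x)$ for every injective tuple, so the sum
over the remaining indices acts on the weights alone. This reduces $n$ different functions to $d+1$
projections. -/
theorem IsSample.h1_eq (hs : IsSample μ X Q) (hh : Measurable h) (a : (Fin (d + 1) → Fin n) → ℝ)
    (i : Fin n) (x : S) : h1 μ a h X i x = projSum Q a h i x := by
  unfold h1 h1At projSum weightCoef
  rw [Finset.sum_comm]
  rw [Finset.mul_sum]
  refine Finset.sum_congr rfl fun l _ => ?_
  rw [mul_assoc, Finset.sum_mul]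
  congr 1
  refine Finset.sum_congr rfl fun J hJ => ?_
  have hI := insertNth_injective_iff (l := l).2 (mem_indexSetAvoiding.1 hJ)
  unfold projKernel
  congr 2
  · simp [proj, condKernel, hs.law]
  · exact integral_comp_of_measurePreserving (hs.measurePreserving_tuple hI) hh

theorem IsSample.V_eq (hs : IsSample μ X Q) (hh : Measurable h)
    (hp : MemLp h 2 (Measure.pi fun _ => Q)) (a : (Fin (d + 1) → Fin n) → ℝ) :
    V μ a h X = ((n : ℝ) ^ 2)⁻¹ * ∑ i, ∫ x, projSum Q a h i x ^ 2 ∂Q := by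
  have hp' : MemLp h (2 : ℕ) (Measure.pi fun _ => Q) := by exact_mod_cast hp
  have hL : ∀ i, MemLp (fun ω => projSum Q a h i (X i ω)) 2 μ := fun i => by
    have := (memLp_projSum hh two_ne_zero hp' a i).comp_measurePreserving (hs.measurePreserving i)
    exact_mod_cast this
  unfold V
  simp_rw [hs.h1_eq hh a]
  rw [variance_const_mul, inv_pow]
  congr 1
  have := IndepFun.variance_sum (μ := μ) (s := Finset.univ)
    (X := fun i ω => projSum Q a h i (X i ω)) (fun i _ => hL i)
    (fun i _ j _ hij => (hs.indep.indepFun hij).comp (measurable_projSum hh a i)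
      (measurable_projSum hh a j))
  have h2 : (fun ω => ∑ i, projSum Q a h i (X i ω)) = ∑ i, fun ω => projSum Q a h i (X i ω) := by
    ext ω; simp
  rw [h2, this]
  refine Finset.sum_congr rfl fun i _ => ?_
  rw [variance_of_integral_eq_zero (hL i).1.aemeasurable]
  · exact integral_comp_of_measurePreserving (f := fun x => projSum Q a h i x ^ 2)
      (hs.measurePreserving i) ((measurable_projSum hh a i).pow_const 2)
  · rw [integral_comp_of_measurePreserving (hs.measurePreserving i) (measurable_projSum hh a i)]
    exact integral_projSum hh (hp.integrable one_le_two) a i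

/-- The remainder of the first order expansion of `U`. -/
noncomputable def remainder (Q : Measure S) (a : (Fin (d + 1) → Fin n) → ℝ)
    (h : (Fin (d + 1) → S) → ℝ) (X : Fin n → Ω → S) (ω : Ω) : ℝ :=
  normFactor (d + 1) n * ∑ I ∈ indexSet (d + 1) n, a I * degKernel Q h (fun k => X (I k) ω)

/-- Insert $h=E h+\sum_l g_l+{}$`degKernel` into every summand. This is the Hoeffding decomposition
stopped after the first order. -/
theorem U_eq (hn : 0 < n) (a : (Fin (d + 1) → Fin n) → ℝ) (X : Fin n → Ω → S) (ω : Ω) :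
    U a h X ω = normFactor (d + 1) n * (∑ I ∈ indexSet (d + 1) n, a I) * meanKernel Q h +
      ((n : ℝ)⁻¹ * ∑ i, projSum Q a h i (X i ω) + remainder Q a h X ω) := by
  have h1 := sum_indexSet_mul_sum_eq hn a fun l i => projKernel Q h l (X i ω)
  unfold projSum
  rw [← h1]
  unfold U uStat remainder degKernel
  change normFactor (d + 1) n * _ = _
  rw [mul_assoc, ← mul_add, ← mul_add]
  congr 1
  rw [Finset.sum_mul, ← Finset.sum_add_distrib, ← Finset.sum_add_distrib]
  refine Finset.sum_congr rfl fun I _ => ?_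
  ring

theorem IsSample.memLp_degKernel (hs : IsSample μ X Q) (hh : Measurable h)
    (hp : MemLp h 2 (Measure.pi fun _ => Q)) {I : Fin (d + 1) → Fin n}
    (hI : Function.Injective I) : MemLp (fun ω => degKernel Q h (fun k => X (I k) ω)) 2 μ :=
  (WeightedU.memLp_degKernel hh hp).comp_measurePreserving (hs.measurePreserving_tuple hI)

theorem IsSample.memLp_remainder (hs : IsSample μ X Q) (hh : Measurable h)
    (hp : MemLp h 2 (Measure.pi fun _ => Q)) (a : (Fin (d + 1) → Fin n) → ℝ) :
    MemLp (remainder Q a h X) 2 μ :=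
  (memLp_finsetSum _ fun _ hI =>
    (hs.memLp_degKernel hh hp (mem_indexSet.1 hI)).const_mul _).const_mul _

theorem IsSample.memLp_linear (hs : IsSample μ X Q) (hh : Measurable h)
    (hp : MemLp h 2 (Measure.pi fun _ => Q)) (a : (Fin (d + 1) → Fin n) → ℝ) :
    MemLp (fun ω => (n : ℝ)⁻¹ * ∑ i, projSum Q a h i (X i ω)) 2 μ := by
  have hp' : MemLp h (2 : ℕ) (Measure.pi fun _ => Q) := by exact_mod_cast hp
  have hL : ∀ i, MemLp (fun ω => projSum Q a h i (X i ω)) 2 μ := fun i => by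
    have := (memLp_projSum hh two_ne_zero hp' a i).comp_measurePreserving (hs.measurePreserving i)
    exact_mod_cast this
  exact (memLp_finsetSum _ fun i _ => hL i).const_mul _

theorem IsSample.integral_linear (hs : IsSample μ X Q) (hh : Measurable h)
    (hp : MemLp h 2 (Measure.pi fun _ => Q)) (a : (Fin (d + 1) → Fin n) → ℝ) :
    ∫ ω, (n : ℝ)⁻¹ * ∑ i, projSum Q a h i (X i ω) ∂μ = 0 := by
  have hp' : MemLp h (2 : ℕ) (Measure.pi fun _ => Q) := by exact_mod_cast hp
  have hL : ∀ i, Integrable (fun ω => projSum Q a h i (X i ω)) μ := fun i =>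
    ((memLp_projSum hh two_ne_zero hp' a i).comp_measurePreserving
      (hs.measurePreserving i)).integrable (by norm_num)
  rw [integral_const_mul, integral_finsetSum _ fun i _ => hL i]
  refine mul_eq_zero_of_right _ (Finset.sum_eq_zero fun i _ => ?_)
  rw [integral_comp_of_measurePreserving (hs.measurePreserving i) (measurable_projSum hh a i)]
  exact integral_projSum hh (hp.integrable one_le_two) a i

theorem IsSample.integral_linear_mul_remainder (hs : IsSample μ X Q) (hh : Measurable h)
    (hp : MemLp h 2 (Measure.pi fun _ => Q)) (a : (Fin (d + 1) → Fin n) → ℝ) :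
    ∫ ω, ((n : ℝ)⁻¹ * ∑ i, projSum Q a h i (X i ω)) * remainder Q a h X ω ∂μ = 0 := by
  have hp' : MemLp h (2 : ℕ) (Measure.pi fun _ => Q) := by exact_mod_cast hp
  have hL : ∀ i, MemLp (fun ω => projSum Q a h i (X i ω)) 2 μ := fun i => by
    have := (memLp_projSum hh two_ne_zero hp' a i).comp_measurePreserving (hs.measurePreserving i)
    exact_mod_cast this
  have hz : ∀ i, ∀ I ∈ indexSet (d + 1) n,
      ∫ ω, degKernel Q h (fun k => X (I k) ω) * projSum Q a h i (X i ω) ∂μ = 0 := by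
    intro i I hI
    -- A single index meets the tuple in at most one position; if it does not occur there, any
    -- position serves, here $0$.
    obtain ⟨l, hl⟩ : ∃ l : Fin (d + 1), ∀ (_j : Unit) k, i = I k → k = l := by
      by_cases hex : ∃ l, i = I l
      · obtain ⟨l, hl⟩ := hex
        exact ⟨l, fun _ k hk => mem_indexSet.1 hI (hk.symm.trans hl)⟩
      · exact ⟨0, fun _ k hk => absurd ⟨k, hk⟩ hex⟩
    exact hs.integral_degKernel_mul_eq_zero hh (hp.integrable one_le_two) (mem_indexSet.1 hI) l
      (J := fun _ : Unit => i) hl (G := fun z => projSum Q a h i (z ()))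
      ((measurable_projSum hh a i).comp (measurable_pi_apply _))
  have hEq : ∀ ω, ((n : ℝ)⁻¹ * ∑ i, projSum Q a h i (X i ω)) * remainder Q a h X ω =
      ∑ i, ∑ I ∈ indexSet (d + 1) n, (n : ℝ)⁻¹ * normFactor (d + 1) n * a I *
        (degKernel Q h (fun k => X (I k) ω) * projSum Q a h i (X i ω)) := fun ω => by
    unfold remainder
    rw [mul_assoc, Finset.sum_mul, Finset.mul_sum]
    refine Finset.sum_congr rfl fun i _ => ?_
    rw [Finset.mul_sum, Finset.mul_sum, Finset.mul_sum]
    refine Finset.sum_congr rfl fun I _ => ?_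
    ring
  have hint : ∀ i, ∀ I ∈ indexSet (d + 1) n, Integrable (fun ω =>
      (n : ℝ)⁻¹ * normFactor (d + 1) n * a I *
        (degKernel Q h (fun k => X (I k) ω) * projSum Q a h i (X i ω))) μ := fun i I hI =>
    ((hs.memLp_degKernel hh hp (mem_indexSet.1 hI)).integrable_mul (hL i)).const_mul _
  simp_rw [hEq]
  rw [integral_finsetSum _ fun i _ => integrable_finsetSum _ fun I hI => hint i I hI]
  refine Finset.sum_eq_zero fun i _ => ?_
  rw [integral_finsetSum _ fun I hI => hint i I hI]
  refine Finset.sum_eq_zero fun I hI => ?_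
  rw [integral_const_mul, hz i I hI, mul_zero]

/-- In the expanded square, two tuples with at most one common index contribute nothing, by
degeneracy. Each remaining expectation is bounded by the second moment of the degenerate kernel. -/
theorem IsSample.integral_remainder_sq_le (hs : IsSample μ X Q) (hh : Measurable h)
    (hp : MemLp h 2 (Measure.pi fun _ => Q)) (a : (Fin (d + 1) → Fin n) → ℝ) :
    ∫ ω, remainder Q a h X ω ^ 2 ∂μ ≤
      normFactor (d + 1) n ^ 2 * (∑ T ∈ sharingAtLeast 2 2 (d + 1) n, |∏ k, a (T k)|) *
        ((6 + 12 * ((d : ℝ) + 1) ^ 2) * ∫ z, h z ^ 2 ∂(Measure.pi fun _ => Q)) := by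
  classical
  set E := (6 + 12 * ((d : ℝ) + 1) ^ 2) * ∫ z, h z ^ 2 ∂(Measure.pi fun _ => Q) with hE
  have hD := fun I (hI : I ∈ indexSet (d + 1) n) =>
    hs.memLp_degKernel hh hp (mem_indexSet.1 hI)
  have hD2 : ∀ I ∈ indexSet (d + 1) n,
      ∫ ω, degKernel Q h (fun k => X (I k) ω) ^ 2 ∂μ ≤ E := fun I hI => by
    refine le_trans (le_of_eq ?_) (integral_degKernel_sq_le hh hp)
    exact integral_comp_of_measurePreserving (f := fun z => degKernel Q h z ^ 2)
      (hs.measurePreserving_tuple (mem_indexSet.1 hI)) ((measurable_degKernel hh).pow_const 2)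
  have hmul : ∀ I ∈ indexSet (d + 1) n, ∀ J ∈ indexSet (d + 1) n,
      Integrable (fun ω => degKernel Q h (fun k => X (I k) ω) *
        degKernel Q h (fun k => X (J k) ω)) μ := fun I hI J hJ => (hD I hI).integrable_mul (hD J hJ)
  have habs : ∀ I ∈ indexSet (d + 1) n, ∀ J ∈ indexSet (d + 1) n,
      |∫ ω, degKernel Q h (fun k => X (I k) ω) * degKernel Q h (fun k => X (J k) ω) ∂μ| ≤ E := fun I hI J hJ =>
    abs_integral_mul_le_of_sq_le (hD I hI) (hD J hJ) (hD2 I hI) (hD2 J hJ)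
  have hexp : ∀ ω, remainder Q a h X ω ^ 2 = ∑ T ∈ Fintype.piFinset fun _ : Fin 2 =>
      indexSet (d + 1) n, normFactor (d + 1) n ^ 2 * (∏ k, a (T k)) *
        (degKernel Q h (fun k => X (T 0 k) ω) * degKernel Q h (fun k => X (T 1 k) ω)) := fun ω => by
    unfold remainder
    rw [mul_pow, Finset.sum_pow', Finset.mul_sum]
    refine Finset.sum_congr rfl fun T _ => ?_
    simp only [Fin.prod_univ_two]
    ring
  have hmem : ∀ T ∈ Fintype.piFinset fun _ : Fin 2 => indexSet (d + 1) n,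
      ∀ k, T k ∈ indexSet (d + 1) n := fun T hT => Fintype.mem_piFinset.1 hT
  simp_rw [hexp]
  rw [integral_finsetSum _ fun T hT => (hmul _ (hmem T hT 0) _ (hmem T hT 1)).const_mul _]
  simp_rw [integral_const_mul]
  have hsub : sharingAtLeast 2 2 (d + 1) n ⊆ Fintype.piFinset fun _ : Fin 2 =>
      indexSet (d + 1) n := fun T hT => Fintype.mem_piFinset.2 (mem_sharingAtLeast.1 hT).1
  rw [← Finset.sum_subset hsub]
  · rw [Finset.mul_sum, Finset.sum_mul]
    refine Finset.sum_le_sum fun T hT => ?_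
    rw [mul_assoc, mul_assoc]
    refine mul_le_mul_of_nonneg_left ?_ (sq_nonneg _)
    refine (le_abs_self _).trans ?_
    rw [abs_mul]
    have hT' := (mem_sharingAtLeast.1 hT).1
    exact mul_le_mul_of_nonneg_left (habs _ (hT' 0) _ (hT' 1)) (abs_nonneg _)
  · intro T hT hT2
    refine mul_eq_zero_of_right _ ?_
    have h0 := mem_indexSet.1 (hmem T hT 0)
    have hcard : (commonIndices T).card ≤ 1 := by
      by_contra hc
      exact hT2 (mem_sharingAtLeast.2 ⟨hmem T hT, by omega⟩)
    rw [Finset.card_le_one] at hcard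
    -- Every coincidence between the two tuples produces a common index, and there is at most one;
    -- by injectivity all coincidences therefore occur at a single position $l$ of `T 0`.
    have hcomm : ∀ j k, T 1 j = T 0 k → T 0 k ∈ commonIndices T := fun j k hjk =>
      mem_commonIndices.2 fun r => by
        fin_cases r
        · exact ⟨k, rfl⟩
        · exact ⟨j, hjk⟩
    obtain ⟨l, hl⟩ : ∃ l : Fin (d + 1), ∀ j k, T 1 j = T 0 k → k = l := by
      by_cases hex : ∃ j l, T 1 j = T 0 l
      · obtain ⟨j', l, hl⟩ := hex
        exact ⟨l, fun j k hk => h0 (hcard _ (hcomm j k hk) _ (hcomm j' l hl))⟩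
      · exact ⟨0, fun j k hk => absurd ⟨j, k, hk⟩ hex⟩
    exact hs.integral_degKernel_mul_eq_zero hh (hp.integrable one_le_two) h0 l hl
      (measurable_degKernel hh)

/-- Pythagoras: the linear part is centred and orthogonal to the remainder, so their covariance
vanishes. -/
theorem IsSample.variance_U (hs : IsSample μ X Q) (hn : 0 < n) (hh : Measurable h)
    (hp : MemLp h 2 (Measure.pi fun _ => Q)) (a : (Fin (d + 1) → Fin n) → ℝ) :
    variance (U a h X) μ = V μ a h X + variance (remainder Q a h X) μ := by
  have hL := hs.memLp_linear hh hp a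
  have hR := hs.memLp_remainder hh hp a
  have h1 : U a h X = fun ω => (((fun ω => (n : ℝ)⁻¹ * ∑ i, projSum Q a h i (X i ω)) +
      remainder Q a h X) ω) +
      normFactor (d + 1) n * (∑ I ∈ indexSet (d + 1) n, a I) * meanKernel Q h := by
    ext ω
    rw [U_eq (Q := Q) hn a X ω, add_comm]; rfl
  rw [h1, variance_add_const (hL.add hR).1, variance_add hL hR, covariance_eq_sub hL hR]
  have h2 := hs.integral_linear_mul_remainder hh hp a
  have h3 := hs.integral_linear hh hp a
  simp only [Pi.mul_apply]
  rw [h2, h3]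
  unfold V
  simp_rw [hs.h1_eq hh a]
  ring

theorem IsSample.V_le_variance_U (hs : IsSample μ X Q) (hn : 0 < n) (hh : Measurable h)
    (hp : MemLp h 2 (Measure.pi fun _ => Q)) (a : (Fin (d + 1) → Fin n) → ℝ) :
    V μ a h X ≤ variance (U a h X) μ := by
  rw [hs.variance_U hn hh hp a]
  linarith [variance_nonneg (remainder Q a h X) μ]

theorem IsSample.variance_U_le (hs : IsSample μ X Q) (hn : 0 < n) (hh : Measurable h)
    (hp : MemLp h 2 (Measure.pi fun _ => Q)) (a : (Fin (d + 1) → Fin n) → ℝ) :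
    variance (U a h X) μ ≤ V μ a h X +
      normFactor (d + 1) n ^ 2 * (∑ T ∈ sharingAtLeast 2 2 (d + 1) n, |∏ k, a (T k)|) *
        ((6 + 12 * ((d : ℝ) + 1) ^ 2) * ∫ z, h z ^ 2 ∂(Measure.pi fun _ => Q)) := by
  rw [hs.variance_U hn hh hp a]
  have h1 := variance_le_expectation_sq (hs.memLp_remainder hh hp a).1
  have h2 := hs.integral_remainder_sq_le hh hp a
  simp only [Pi.pow_apply] at h1
  linarith

end Sample

/-! ### The empirical distribution and the bootstrap sample -/

section Empirical

variable {S : Type*} [MeasurableSpace S] {n : ℕ}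

/-- The uniform distribution on the indices. -/
noncomputable def uniformIndex (n : ℕ) : Measure (Fin n) :=
  (n : ℝ≥0∞)⁻¹ • ∑ i, Measure.dirac i

theorem uniformIndex_singleton (i : Fin n) : uniformIndex n {i} = (n : ℝ≥0∞)⁻¹ := by
  classical
  simp [uniformIndex, Set.indicator_apply]

theorem isProbabilityMeasure_uniformIndex (hn : 0 < n) :
    IsProbabilityMeasure (uniformIndex n) := by
  refine ⟨?_⟩
  simp only [uniformIndex, Measure.smul_apply, Measure.coe_finsetSum, Finset.sum_apply,
    measure_univ, Finset.sum_const, Finset.card_univ, Fintype.card_fin, nsmul_eq_mul, mul_one,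
    smul_eq_mul]
  exact ENNReal.inv_mul_cancel (by exact_mod_cast hn.ne') (by simp)

theorem empirical_eq_map (x : Fin n → S) : empirical x = (uniformIndex n).map x := by
  have hx : Measurable x := measurable_of_countable x
  unfold empirical uniformIndex
  rw [Measure.map_smul]
  congr 1
  ext s hs
  rw [Measure.map_apply hx hs]
  simp only [Measure.coe_finsetSum, Finset.sum_apply]
  refine Finset.sum_congr rfl fun i _ => ?_
  rw [Measure.dirac_apply' _ hs, Measure.dirac_apply' _ (hx hs)]
  rfl

theorem isProbabilityMeasure_empirical (hn : 0 < n) (x : Fin n → S) :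
    IsProbabilityMeasure (empirical x) := by
  have := isProbabilityMeasure_uniformIndex hn
  rw [empirical_eq_map]
  exact Measure.isProbabilityMeasure_map (measurable_of_countable x).aemeasurable

/-- Drawing from the empirical distribution is drawing indices uniformly. On the finite space of
index tuples every function is measurable and integrable, so empirical integrals become finite sums
even if points of $S$ are not measurable. -/
theorem pi_empirical_eq_map (hn : 0 < n) (k : ℕ) (x : Fin n → S) :
    Measure.pi (fun _ : Fin k => empirical x) =
      (Measure.pi fun _ : Fin k => uniformIndex n).map fun J j => x (J j) := by
  have := isProbabilityMeasure_uniformIndex hn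
  have := isProbabilityMeasure_empirical hn x
  rw [empirical_eq_map] at this ⊢
  exact (Measure.pi_map_pi (f := fun _ => x)
    fun _ => (measurable_of_countable x).aemeasurable).symm

theorem integral_pi_empirical (hn : 0 < n) {k : ℕ} (x : Fin n → S) {g : (Fin k → S) → ℝ}
    (hg : Measurable g) :
    ∫ z, g z ∂(Measure.pi fun _ : Fin k => empirical x) =
      ((n : ℝ) ^ k)⁻¹ * ∑ J : Fin k → Fin n, g fun j => x (J j) := by
  have := isProbabilityMeasure_uniformIndex hn
  rw [pi_empirical_eq_map hn, integral_map (measurable_of_countable _).aemeasurable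
    hg.aestronglyMeasurable, integral_fintype Integrable.of_finite, Finset.mul_sum]
  refine Finset.sum_congr rfl fun J _ => ?_
  rw [Measure.real, Measure.pi_singleton]
  simp [uniformIndex_singleton]

theorem integral_empirical (hn : 0 < n) (x : Fin n → S) {g : S → ℝ} (hg : Measurable g) :
    ∫ z, g z ∂(empirical x) = (n : ℝ)⁻¹ * ∑ i, g (x i) := by
  have := isProbabilityMeasure_uniformIndex hn
  rw [empirical_eq_map, integral_map (measurable_of_countable _).aemeasurable
    hg.aestronglyMeasurable, integral_fintype Integrable.of_finite, Finset.mul_sum]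
  refine Finset.sum_congr rfl fun J _ => ?_
  rw [Measure.real, uniformIndex_singleton]
  simp

theorem memLp_pi_empirical (hn : 0 < n) {k : ℕ} (x : Fin n → S) {g : (Fin k → S) → ℝ}
    (hg : Measurable g) (p : ℝ≥0∞) : MemLp g p (Measure.pi fun _ : Fin k => empirical x) := by
  have := isProbabilityMeasure_uniformIndex hn
  rw [pi_empirical_eq_map hn, memLp_map_measure_iff hg.aestronglyMeasurable
    (measurable_of_countable _).aemeasurable]
  exact MemLp.of_discrete

/-- This makes every result on samples from $Q$ available for the bootstrap with $Q$ replaced by the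
empirical distribution. -/
theorem isSample_bootstrapLaw (hn : 0 < n) (x : Fin n → S) :
    IsSample (bootstrapLaw x) (fun i y => y i) (empirical x) := by
  have := isProbabilityMeasure_empirical hn x
  exact ⟨fun i => measurable_pi_apply i,
    iIndepFun_pi (X := fun _ : Fin n => (id : S → S)) fun _ => aemeasurable_id,
    fun i => (measurePreserving_eval (fun _ : Fin n => empirical x) i).map_eq⟩

end Empirical

/-! ### Mean square error of the empirical projections -/

section Moments

variable {Ω S : Type*} [MeasurableSpace Ω] [MeasurableSpace S]
variable {n : ℕ} {μ : Measure Ω} [IsProbabilityMeasure μ] {X : Fin n → Ω → S} {Q : Measure S}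
  [IsProbabilityMeasure Q] {d : ℕ} {h : (Fin (d + 1) → S) → ℝ}

theorem IsSample.memLp_sum (hs : IsSample μ X Q) {f : S → ℝ} {p : ℝ≥0∞} (hp : MemLp f p Q) :
    MemLp (fun ω => ∑ j, f (X j ω)) p μ :=
  memLp_finsetSum _ fun j _ => hp.comp_measurePreserving (hs.measurePreserving j)

theorem IsSample.integral_sum_sq (hs : IsSample μ X Q) {f : S → ℝ} (hf : Measurable f)
    (hp : MemLp f 2 Q) (h0 : ∫ x, f x ∂Q = 0) :
    ∫ ω, (∑ j, f (X j ω)) ^ 2 ∂μ = n * ∫ x, f x ^ 2 ∂Q := by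
  have hL : ∀ j, MemLp (fun ω => f (X j ω)) 2 μ := fun j =>
    hp.comp_measurePreserving (hs.measurePreserving j)
  have h1 : ∀ j, ∫ ω, f (X j ω) ∂μ = 0 := fun j => by
    rw [integral_comp_of_measurePreserving (hs.measurePreserving j) hf, h0]
  have hv := IndepFun.variance_sum (μ := μ) (s := Finset.univ) (X := fun j ω => f (X j ω))
    (fun j _ => hL j) (fun i _ j _ hij => (hs.indep.indepFun hij).comp hf hf)
  have hfun : (∑ j, fun ω => f (X j ω)) = fun ω => ∑ j, f (X j ω) := by ext ω; simp
  rw [hfun, variance_of_integral_eq_zero (hs.memLp_sum hp).1.aemeasurable] at hv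
  · rw [hv]
    simp_rw [variance_of_integral_eq_zero (hL _).1.aemeasurable (h1 _)]
    rw [Finset.sum_congr rfl fun j _ => integral_comp_of_measurePreserving
      (f := fun x => f x ^ 2) (hs.measurePreserving j) (hf.pow_const 2)]
    simp
  · rw [integral_finsetSum _ fun j _ => (hL j).integrable one_le_two]
    exact Finset.sum_eq_zero fun j _ => h1 j

/-- The kernel minus its conditional mean given the argument at position `l`. -/
noncomputable def condCentred (Q : Measure S) (h : (Fin (d + 1) → S) → ℝ) (l : Fin (d + 1))
    (p : S × (Fin d → S)) : ℝ :=
  h (Fin.insertNth (α := fun _ => S) l p.1 p.2) - condKernel Q h l p.1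

theorem measurable_condCentred (hh : Measurable h) (l : Fin (d + 1)) :
    Measurable (condCentred Q h l) :=
  (hh.comp (measurable_insertNth l)).sub ((measurable_condKernel hh l).comp measurable_fst)

theorem ae_integral_condCentred (hi : Integrable h (Measure.pi fun _ => Q)) (l : Fin (d + 1)) :
    ∀ᵐ x ∂Q, ∫ y, condCentred Q h l (x, y) ∂(Measure.pi fun _ : Fin d => Q) = 0 := by
  filter_upwards [(integrable_comp_insertNth hi l).prod_right_ae] with x hx
  simp only [condCentred]
  rw [integral_sub hx (integrable_const _)]
  simp [condKernel]

/-- The estimation error is a von Mises average over all index tuples, repetitions included. This is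
why second moments of $h$ are needed at tuples with repeated entries. -/
theorem condKernel_empirical_sub (hn : 0 < n) (hh : Measurable h) (l : Fin (d + 1))
    (x : Fin n → S) (y : S) :
    condKernel (empirical x) h l y - condKernel Q h l y =
      ((n : ℝ) ^ d)⁻¹ * ∑ J : Fin d → Fin n, condCentred Q h l (y, fun k => x (J k)) := by
  have hn' : (n : ℝ) ^ d ≠ 0 := pow_ne_zero _ (by exact_mod_cast hn.ne')
  have h1 := integral_pi_empirical hn (k := d) x
    (hh.comp ((measurable_insertNth l).comp (measurable_prodMk_left (x := y))))
  unfold condCentred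
  rw [Finset.sum_sub_distrib, mul_sub]
  congr 1
  simp [hn']

/-- All values of the kernel at the sample, also at tuples with repeated indices, have second
moments bounded by `B`. -/
structure SecondMomentBound (μ : Measure Ω) (X : Fin n → Ω → S) (Q : Measure S)
    (h : (Fin (d + 1) → S) → ℝ) (B : ℝ) : Prop where
  memLp : ∀ I : Fin (d + 1) → Fin n, MemLp (fun ω => h fun k => X (I k) ω) 2 μ
  le : ∀ I : Fin (d + 1) → Fin n, ∫ ω, h (fun k => X (I k) ω) ^ 2 ∂μ ≤ B
  memLp_pi : MemLp h 2 (Measure.pi fun _ => Q)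
  pi_le : ∫ z, h z ^ 2 ∂(Measure.pi fun _ => Q) ≤ B

variable {B : ℝ}

theorem SecondMomentBound.nonneg (hB : SecondMomentBound μ X Q h B) : 0 ≤ B :=
  (integral_nonneg fun _ => sq_nonneg _).trans hB.pi_le

theorem SecondMomentBound.memLp_condCentred (hB : SecondMomentBound μ X Q h B)
    (hs : IsSample μ X Q) (hh : Measurable h) (l : Fin (d + 1)) (j : Fin n) (J : Fin d → Fin n) :
    MemLp (fun ω => condCentred Q h l (X j ω, fun k => X (J k) ω)) 2 μ := by
  have hp' : MemLp h (2 : ℕ) (Measure.pi fun _ => Q) := by exact_mod_cast hB.memLp_pi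
  have h2 : MemLp (fun ω => condKernel Q h l (X j ω)) 2 μ := by
    have := (memLp_condKernel hh two_ne_zero hp' l).comp_measurePreserving (hs.measurePreserving j)
    exact_mod_cast this
  have h1 := hB.memLp (Fin.insertNth (α := fun _ => Fin n) l j J)
  refine (h1.sub h2).ae_eq (ae_of_all _ fun ω => ?_)
  simp only [Pi.sub_apply, condCentred]
  congr 2
  ext k
  induction k using l.succAboveCases <;> simp

theorem SecondMomentBound.integral_condCentred_sq_le (hB : SecondMomentBound μ X Q h B)
    (hs : IsSample μ X Q) (hh : Measurable h) (l : Fin (d + 1)) (j : Fin n) (J : Fin d → Fin n) :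
    ∫ ω, condCentred Q h l (X j ω, fun k => X (J k) ω) ^ 2 ∂μ ≤ 4 * B := by
  have hp' : MemLp h (2 : ℕ) (Measure.pi fun _ => Q) := by exact_mod_cast hB.memLp_pi
  have h2 : MemLp (fun ω => condKernel Q h l (X j ω)) 2 μ := by
    have := (memLp_condKernel hh two_ne_zero hp' l).comp_measurePreserving (hs.measurePreserving j)
    exact_mod_cast this
  have h1 := hB.memLp (Fin.insertNth (α := fun _ => Fin n) l j J)
  have h3 : ∫ ω, condKernel Q h l (X j ω) ^ 2 ∂μ ≤ B := by
    rw [integral_comp_of_measurePreserving (f := fun x => condKernel Q h l x ^ 2)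
      (hs.measurePreserving j) ((measurable_condKernel hh l).pow_const 2)]
    exact (integral_condKernel_pow_le hh two_ne_zero even_two hp' l).trans hB.pi_le
  have h4 := hB.le (Fin.insertNth (α := fun _ => Fin n) l j J)
  calc ∫ ω, condCentred Q h l (X j ω, fun k => X (J k) ω) ^ 2 ∂μ
      ≤ ∫ ω, (2 * h (fun k => X (Fin.insertNth (α := fun _ => Fin n) l j J k) ω) ^ 2 +
          2 * condKernel Q h l (X j ω) ^ 2) ∂μ := by
        refine integral_mono (hB.memLp_condCentred hs hh l j J).integrable_sq
          ((h1.integrable_sq.const_mul 2).add (h2.integrable_sq.const_mul 2)) fun ω => ?_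
        have hEq : Fin.insertNth (α := fun _ => S) l (X j ω) (fun k => X (J k) ω) =
            fun k => X (Fin.insertNth (α := fun _ => Fin n) l j J k) ω := by
          ext k
          induction k using l.succAboveCases <;> simp
        simp only [condCentred, hEq]
        nlinarith [sq_nonneg (h (fun k => X (Fin.insertNth (α := fun _ => Fin n) l j J k) ω) +
          condKernel Q h l (X j ω))]
    _ = 2 * (∫ ω, h (fun k => X (Fin.insertNth (α := fun _ => Fin n) l j J k) ω) ^ 2 ∂μ) +
          2 * ∫ ω, condKernel Q h l (X j ω) ^ 2 ∂μ := by
        rw [integral_add (h1.integrable_sq.const_mul 2) (h2.integrable_sq.const_mul 2),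
          integral_const_mul, integral_const_mul]
    _ ≤ _ := by linarith

open scoped Classical in
-- If $J$ is injective and avoids $j$ and $J'$, then the observations at $J$ are independent of
-- everything else in the product, and centring gives zero. Otherwise the product is bounded by the
-- second moments.
theorem SecondMomentBound.integral_condCentred_mul_le (hB : SecondMomentBound μ X Q h B)
    (hs : IsSample μ X Q) (hh : Measurable h) (l : Fin (d + 1)) (j : Fin n)
    (J J' : Fin d → Fin n) :
    ∫ ω, condCentred Q h l (X j ω, fun k => X (J k) ω) *
      condCentred Q h l (X j ω, fun k => X (J' k) ω) ∂μ ≤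
      if ¬ (Function.Injective J ∧
        ∀ k r, J k ≠ Fin.cons (α := fun _ : Fin (d + 1) => Fin n) j J' r)
      then 4 * B else 0 := by
  split_ifs with hc
  · refine le_of_eq ?_
    have := hs.integral_mul_eq_zero (measurable_condCentred (Q := Q) hh l)
      (ae_integral_condCentred (hB.memLp_pi.integrable one_le_two) l) (v := j) hc.1
      (fun k hk => hc.2 k 0 (by simpa using hk.symm))
      (J := Fin.cons (α := fun _ : Fin (d + 1) => Fin n) j J') (fun r k hr => hc.2 k r hr.symm)
      (G := fun z => condCentred Q h l (z 0, fun k => z k.succ))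
      ((measurable_condCentred hh l).comp ((measurable_pi_apply 0).prodMk
        (measurable_pi_lambda _ fun k => measurable_pi_apply _)))
    simpa using this
  · exact (le_abs_self _).trans (abs_integral_mul_le_of_sq_le (hB.memLp_condCentred hs hh l j J)
      (hB.memLp_condCentred hs hh l j J') (hB.integral_condCentred_sq_le hs hh l j J)
      (hB.integral_condCentred_sq_le hs hh l j J'))

/-- The conditional means of the kernel under the empirical distribution estimate those under `Q`
with mean square error of order `1 / n`. -/
theorem SecondMomentBound.integral_condKernel_empirical_sub_sq_le
    (hB : SecondMomentBound μ X Q h B)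
    (hn : 0 < n) (hs : IsSample μ X Q) (hh : Measurable h) (l : Fin (d + 1)) (j : Fin n) :
    ∫ ω, (condKernel (empirical fun i => X i ω) h l (X j ω) - condKernel Q h l (X j ω)) ^ 2 ∂μ ≤
      4 * (2 * (d : ℝ) ^ 2 + d) * B * (n : ℝ)⁻¹ := by
  classical
  have hn' : (0 : ℝ) < n := by exact_mod_cast hn
  have hB0 := hB.nonneg
  have hexp : ∀ ω, (condKernel (empirical fun i => X i ω) h l (X j ω) -
      condKernel Q h l (X j ω)) ^ 2 = (((n : ℝ) ^ d)⁻¹) ^ 2 *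
        ∑ J' : Fin d → Fin n, ∑ J : Fin d → Fin n,
          condCentred Q h l (X j ω, fun k => X (J k) ω) *
          condCentred Q h l (X j ω, fun k => X (J' k) ω) := fun ω => by
    rw [condKernel_empirical_sub hn hh l, mul_pow, sq (∑ J : Fin d → Fin n, _), Finset.mul_sum]
    congr 1
    refine Finset.sum_congr rfl fun J' _ => ?_
    rw [Finset.sum_mul]
  have hint : ∀ J' J : Fin d → Fin n, Integrable (fun ω =>
      condCentred Q h l (X j ω, fun k => X (J k) ω) *
          condCentred Q h l (X j ω, fun k => X (J' k) ω)) μ := fun J' J =>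
    (hB.memLp_condCentred hs hh l j J).integrable_mul (hB.memLp_condCentred hs hh l j J')
  simp_rw [hexp]
  rw [integral_const_mul, integral_finsetSum _ fun J' _ => integrable_finsetSum _
    fun J _ => hint J' J]
  have hinner : ∀ J' : Fin d → Fin n, ∫ ω, ∑ J : Fin d → Fin n,
      condCentred Q h l (X j ω, fun k => X (J k) ω) *
          condCentred Q h l (X j ω, fun k => X (J' k) ω) ∂μ ≤
        4 * B * ((2 * (d : ℝ) ^ 2 + d) * (n : ℝ) ^ d * (n : ℝ)⁻¹) := fun J' => by
    rw [integral_finsetSum _ fun J _ => hint J' J]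
    refine (Finset.sum_le_sum fun J _ =>
      hB.integral_condCentred_mul_le hs hh l j J J').trans ?_
    rw [← Finset.sum_filter, Finset.sum_const, nsmul_eq_mul, mul_comm]
    refine mul_le_mul_of_nonneg_left ?_ (by positivity)
    -- The list to be avoided is $j$ followed by $J'$, of length $d+1$; hence the constant
    -- $d^2+d(d+1)=2d^2+d$.
    have hc := mul_card_meeting_le (d := d) (Fin.cons (α := fun _ : Fin (d + 1) => Fin n) j J')
    rw [← div_eq_mul_inv, le_div_iff₀ hn', mul_comm]
    have hc' : (n : ℝ) * ((Finset.univ.filter fun J : Fin d → Fin n => ¬ (Function.Injective J ∧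
        ∀ k r, J k ≠ Fin.cons (α := fun _ : Fin (d + 1) => Fin n) j J' r)).card : ℝ) ≤
        ((d : ℝ) ^ 2 + d * (d + 1)) * (n : ℝ) ^ d := by exact_mod_cast hc
    exact hc'.trans (le_of_eq (by ring))
  calc _ ≤ (((n : ℝ) ^ d)⁻¹) ^ 2 * ∑ _J' : Fin d → Fin n,
        4 * B * ((2 * (d : ℝ) ^ 2 + d) * (n : ℝ) ^ d * (n : ℝ)⁻¹) := by
        gcongr with J'
        exact hinner J'
    _ = _ := by
        simp only [Finset.sum_const, Finset.card_univ, Fintype.card_pi, Fintype.card_fin,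
          Finset.prod_const, nsmul_eq_mul, Nat.cast_pow]
        field_simp

theorem SecondMomentBound.memLp_condKernel_empirical_sub (hB : SecondMomentBound μ X Q h B)
    (hn : 0 < n) (hs : IsSample μ X Q) (hh : Measurable h) (l : Fin (d + 1)) (j : Fin n) :
    MemLp (fun ω => condKernel (empirical fun i => X i ω) h l (X j ω) -
      condKernel Q h l (X j ω)) 2 μ := by
  simp_rw [condKernel_empirical_sub hn hh l]
  exact (memLp_finsetSum _ fun J _ => hB.memLp_condCentred hs hh l j J).const_mul _

/-- An upper bound for the mean square distance, over the sample, of the first order projections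
under the empirical distribution and under `Q`. -/
noncomputable def projError (Q : Measure S) (h : (Fin (d + 1) → S) → ℝ) (x : Fin n → S) : ℝ :=
  ∑ l : Fin (d + 1), (6 * ((n : ℝ)⁻¹ *
      ∑ j, (condKernel (empirical x) h l (x j) - condKernel Q h l (x j)) ^ 2) +
    3 * ((n : ℝ)⁻¹ * ∑ j, projKernel Q h l (x j)) ^ 2)

theorem sum_projKernel_empirical_sub_sq_le (hn : 0 < n) (hh : Measurable h) (x : Fin n → S) :
    (n : ℝ)⁻¹ * ∑ j, ∑ l, (projKernel (empirical x) h l (x j) - projKernel Q h l (x j)) ^ 2 ≤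
      projError Q h x := by
  have hn' : (0 : ℝ) < n := by exact_mod_cast hn
  have := isProbabilityMeasure_empirical hn x
  rw [Finset.sum_comm, Finset.mul_sum]
  unfold projError
  refine Finset.sum_le_sum fun l _ => ?_
  set u : Fin n → ℝ := fun j => condKernel (empirical x) h l (x j) - condKernel Q h l (x j) with hu
  set g : ℝ := (n : ℝ)⁻¹ * ∑ j, projKernel Q h l (x j) with hg
  set w : ℝ := (n : ℝ)⁻¹ * ∑ j, u j with hw
  -- The empirical mean of the kernel is the sample average of its empirical conditional means. The
  -- error of the centring thus splits into the average $w$ of the errors $u_j$ and the sample mean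
  -- $g$ of the true projection.
  have hmean : meanKernel (empirical x) h = w + g + meanKernel Q h := by
    rw [← integral_condKernel ((memLp_pi_empirical hn x hh 1).integrable le_rfl) l,
      integral_empirical hn x (measurable_condKernel hh l), hw, hg, ← mul_add,
      ← Finset.sum_add_distrib]
    have : ∀ j, u j + projKernel Q h l (x j) =
        condKernel (empirical x) h l (x j) - meanKernel Q h := fun j => by
      simp only [hu, projKernel]; ring
    simp_rw [this, Finset.sum_sub_distrib]
    simp only [Finset.sum_const, Finset.card_univ, Fintype.card_fin, nsmul_eq_mul]
    field_simp
    ring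
  have hdiff : ∀ j, projKernel (empirical x) h l (x j) - projKernel Q h l (x j) = u j - w - g := by
    intro j
    simp only [projKernel, hmean, hu]; ring
  have hw2 : w ^ 2 ≤ (n : ℝ)⁻¹ * ∑ j, u j ^ 2 := by
    have := sq_sum_le_card_mul_sum_sq (s := (Finset.univ : Finset (Fin n))) (f := u)
    simp only [Finset.card_univ, Fintype.card_fin] at this
    rw [hw, mul_pow]
    calc ((n : ℝ)⁻¹) ^ 2 * (∑ j, u j) ^ 2 ≤ ((n : ℝ)⁻¹) ^ 2 * (n * ∑ j, u j ^ 2) := by gcongr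
      _ = _ := by field_simp
  simp_rw [hdiff]
  calc (n : ℝ)⁻¹ * ∑ j, (u j - w - g) ^ 2 ≤ (n : ℝ)⁻¹ * ∑ j, (3 * u j ^ 2 + 3 * (w ^ 2 + g ^ 2)) := by
        gcongr with j
        nlinarith [sq_nonneg (u j + w), sq_nonneg (u j + g), sq_nonneg (w - g)]
    _ = 3 * ((n : ℝ)⁻¹ * ∑ j, u j ^ 2) + 3 * (w ^ 2 + g ^ 2) := by
        rw [Finset.sum_add_distrib, ← Finset.mul_sum]
        simp only [Finset.sum_const, Finset.card_univ, Fintype.card_fin, nsmul_eq_mul]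
        field_simp
    -- By `hw2` the term in $w$ is absorbed in the average of $u_j^2$, which gives $6=3+3$.
    _ ≤ _ := by linarith

theorem SecondMomentBound.integrable_projError (hB : SecondMomentBound μ X Q h B)
    (hn : 0 < n) (hs : IsSample μ X Q) (hh : Measurable h) :
    Integrable (fun ω => projError Q h fun i => X i ω) μ := by
  have hp' : MemLp h (2 : ℕ) (Measure.pi fun _ => Q) := by exact_mod_cast hB.memLp_pi
  have hg : ∀ l, MemLp (projKernel Q h l) 2 Q := fun l => by
    exact_mod_cast memLp_projKernel hh two_ne_zero hp' l
  refine integrable_finsetSum _ fun l _ => ?_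
  exact (((integrable_finsetSum _ fun j _ => (hB.memLp_condKernel_empirical_sub hn hs hh l
    j).integrable_sq).const_mul _).const_mul _).add
    (((hs.memLp_sum (hg l)).const_mul _).integrable_sq.const_mul _)

theorem SecondMomentBound.integral_projError_le (hB : SecondMomentBound μ X Q h B)
    (hn : 0 < n) (hs : IsSample μ X Q) (hh : Measurable h) :
    ∫ ω, projError Q h (fun i => X i ω) ∂μ ≤
      ((d : ℝ) + 1) * (24 * (2 * (d : ℝ) ^ 2 + d) + 12) * B * (n : ℝ)⁻¹ := by
  have hn' : (0 : ℝ) < n := by exact_mod_cast hn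
  have hp' : MemLp h (2 : ℕ) (Measure.pi fun _ => Q) := by exact_mod_cast hB.memLp_pi
  have hg : ∀ l, MemLp (projKernel Q h l) 2 Q := fun l => by
    exact_mod_cast memLp_projKernel hh two_ne_zero hp' l
  have hi1 : ∀ l : Fin (d + 1), Integrable (fun ω => 6 * ((n : ℝ)⁻¹ *
      ∑ j, (condKernel (empirical fun i => X i ω) h l (X j ω) -
        condKernel Q h l (X j ω)) ^ 2)) μ := fun l =>
    ((integrable_finsetSum _ fun j _ => (hB.memLp_condKernel_empirical_sub hn hs hh l
      j).integrable_sq).const_mul _).const_mul _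
  have hi2 : ∀ l : Fin (d + 1), Integrable (fun ω =>
      3 * ((n : ℝ)⁻¹ * ∑ j, projKernel Q h l (X j ω)) ^ 2) μ := fun l =>
    ((hs.memLp_sum (hg l)).const_mul _).integrable_sq.const_mul _
  have hi : ∀ l : Fin (d + 1), Integrable (fun ω => 6 * ((n : ℝ)⁻¹ *
      ∑ j, (condKernel (empirical fun i => X i ω) h l (X j ω) -
        condKernel Q h l (X j ω)) ^ 2) +
      3 * ((n : ℝ)⁻¹ * ∑ j, projKernel Q h l (X j ω)) ^ 2) μ := fun l => (hi1 l).add (hi2 l)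
  simp only [projError]
  rw [integral_finsetSum _ fun l _ => hi l]
  have hl : ∀ l : Fin (d + 1), ∫ ω, (6 * ((n : ℝ)⁻¹ *
      ∑ j, (condKernel (empirical fun i => X i ω) h l (X j ω) - condKernel Q h l (X j ω)) ^ 2) +
      3 * ((n : ℝ)⁻¹ * ∑ j, projKernel Q h l (X j ω)) ^ 2) ∂μ ≤
      (24 * (2 * (d : ℝ) ^ 2 + d) + 12) * B * (n : ℝ)⁻¹ := fun l => by
    rw [integral_add (hi1 l) (hi2 l), integral_const_mul, integral_const_mul, integral_const_mul,
      integral_finsetSum _ fun j _ =>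
        (hB.memLp_condKernel_empirical_sub hn hs hh l j).integrable_sq]
    simp_rw [mul_pow]
    rw [integral_const_mul, hs.integral_sum_sq (measurable_projKernel hh l) (hg l)
      (integral_projKernel hh (hB.memLp_pi.integrable one_le_two) l)]
    have e1 : ∑ j, ∫ ω, (condKernel (empirical fun i => X i ω) h l (X j ω) -
        condKernel Q h l (X j ω)) ^ 2 ∂μ ≤ ∑ _j : Fin n, 4 * (2 * (d : ℝ) ^ 2 + d) * B * (n : ℝ)⁻¹ :=
      Finset.sum_le_sum fun j _ => hB.integral_condKernel_empirical_sub_sq_le hn hs hh l j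
    have e2 : ∫ x, projKernel Q h l x ^ 2 ∂Q ≤ 4 * B :=
      (integral_projKernel_sq_le hh hB.memLp_pi l).trans (by linarith [hB.pi_le])
    calc _ ≤ 6 * ((n : ℝ)⁻¹ * ∑ _j : Fin n, 4 * (2 * (d : ℝ) ^ 2 + d) * B * (n : ℝ)⁻¹) +
          3 * (((n : ℝ)⁻¹) ^ 2 * (n * (4 * B))) := by gcongr
      _ = _ := by
        simp only [Finset.sum_const, Finset.card_univ, Fintype.card_fin, nsmul_eq_mul]
        field_simp
        ring
  calc _ ≤ ∑ _l : Fin (d + 1), (24 * (2 * (d : ℝ) ^ 2 + d) + 12) * B * (n : ℝ)⁻¹ :=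
        Finset.sum_le_sum fun l _ => hl l
    _ = _ := by
        simp only [Finset.sum_const, Finset.card_univ, Fintype.card_fin, nsmul_eq_mul]
        push_cast
        ring

/-- Second moment of the kernel under independent draws from the empirical distribution. -/
theorem SecondMomentBound.integral_empirical_sq_le (hB : SecondMomentBound μ X Q h B)
    (hn : 0 < n) (hs : IsSample μ X Q) (hh : Measurable h) :
    Integrable (fun ω => ∫ z, h z ^ 2 ∂(Measure.pi fun _ => empirical fun i => X i ω)) μ ∧
    ∫ ω, ∫ z, h z ^ 2 ∂(Measure.pi fun _ => empirical fun i => X i ω) ∂μ ≤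
      (∫ z, h z ^ 2 ∂(Measure.pi fun _ => Q)) + ((d : ℝ) + 1) ^ 2 * B * (n : ℝ)⁻¹ := by
  classical
  have hn' : (0 : ℝ) < n := by exact_mod_cast hn
  have hB0 := hB.nonneg
  simp_rw [integral_pi_empirical hn _ (hh.pow_const 2)]
  have hint : ∀ I : Fin (d + 1) → Fin n, Integrable (fun ω => h (fun k => X (I k) ω) ^ 2) μ :=
    fun I => (hB.memLp I).integrable_sq
  refine ⟨(integrable_finsetSum _ fun I _ => hint I).const_mul _, ?_⟩
  rw [integral_const_mul, integral_finsetSum _ fun I _ => hint I]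
  set E := ∫ z, h z ^ 2 ∂(Measure.pi fun _ => Q) with hE
  have hE0 : 0 ≤ E := integral_nonneg fun _ => sq_nonneg _
  -- Injective tuples contribute the exact moment $E$, which is later paired with $A_{2,2}$ and
  -- $M(n)^{1/2}$. The cruder $B$ is spent only on the rare tuples with repetitions.
  have hle : ∀ I : Fin (d + 1) → Fin n, ∫ ω, h (fun k => X (I k) ω) ^ 2 ∂μ ≤
      E + if ¬ Function.Injective I then B else 0 := fun I => by
    split_ifs with hI
    · rw [add_zero]
      exact (integral_comp_of_measurePreserving (f := fun z => h z ^ 2)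
        (hs.measurePreserving_tuple hI) (hh.pow_const 2)).le
    · linarith [hB.le I]
  have hcard := mul_card_not_injective_le (d + 1) n
  have hcard' : ((Finset.univ.filter fun J : Fin (d + 1) → Fin n =>
      ¬ Function.Injective J).card : ℝ) ≤ ((d : ℝ) + 1) ^ 2 * (n : ℝ) ^ (d + 1) * (n : ℝ)⁻¹ := by
    rw [← div_eq_mul_inv, le_div_iff₀ hn', mul_comm]
    exact_mod_cast hcard
  calc _ ≤ ((n : ℝ) ^ (d + 1))⁻¹ * ∑ I : Fin (d + 1) → Fin n,
        (E + if ¬ Function.Injective I then B else 0) := by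
        gcongr with I
        exact hle I
    _ = E + ((n : ℝ) ^ (d + 1))⁻¹ * (((Finset.univ.filter fun J : Fin (d + 1) → Fin n =>
          ¬ Function.Injective J).card : ℝ) * B) := by
        rw [Finset.sum_add_distrib, ← Finset.sum_filter, Finset.sum_const, Finset.sum_const,
          nsmul_eq_mul, nsmul_eq_mul]
        simp only [Finset.card_univ, Fintype.card_pi, Fintype.card_fin, Finset.prod_const,
          Nat.cast_pow]
        field_simp
    _ ≤ E + ((n : ℝ) ^ (d + 1))⁻¹ * ((((d : ℝ) + 1) ^ 2 * (n : ℝ) ^ (d + 1) * (n : ℝ)⁻¹) * B) := by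
        gcongr
    _ = _ := by field_simp

end Moments

/-! ### Bounds for fixed $n$, and the vanishing of $M_1$ and $M_2$ -/

section FiniteSample

variable {Ω S : Type*} [MeasurableSpace Ω] [MeasurableSpace S]

theorem memLp_sq {α : Type*} [MeasurableSpace α] {ν : Measure α} {f : α → ℝ}
    (hp : MemLp f 4 ν) : MemLp (fun x => f x ^ 2) 2 ν := by
  have h4 : MemLp f (4 : ℕ) ν := by exact_mod_cast hp
  have h1 := (memLp_natCast_iff hp.1 four_ne_zero).1 h4
  have h2 : MemLp (fun x => f x ^ 2) (2 : ℕ) ν := by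
    rw [memLp_natCast_iff (f := fun x => f x ^ 2) (hp.1.pow 2) two_ne_zero]
    refine lt_of_eq_of_lt (lintegral_congr fun x => ?_) h1
    rw [enorm_pow, ← pow_mul]
  exact_mod_cast h2

theorem memLp_and_integral_pow_le {α : Type*} [MeasurableSpace α] {ν : Measure α} {f : α → ℝ}
    (hf : AEStronglyMeasurable f ν) {k : ℕ} (hk : k ≠ 0) (hk' : Even k) {b : ℝ} (hb : 0 ≤ b)
    (h : ∫⁻ x, ENNReal.ofReal (f x ^ k) ∂ν ≤ ENNReal.ofReal b) :
    MemLp f k ν ∧ ∫ x, f x ^ k ∂ν ≤ b := by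
  have hEq : ∫⁻ x, ‖f x‖ₑ ^ k ∂ν = ∫⁻ x, ENNReal.ofReal (f x ^ k) ∂ν :=
    lintegral_congr fun x => by
      rw [← hk'.pow_abs, ENNReal.ofReal_pow (abs_nonneg _), Real.enorm_eq_ofReal_abs]
  rw [← hEq] at h
  refine ⟨(memLp_natCast_iff hf hk).2 (h.trans_lt ENNReal.ofReal_lt_top), ?_⟩
  rw [integral_pow_eq_toReal hf hk']
  exact ENNReal.toReal_le_of_le_ofReal hb h

theorem exists_isSample {n : ℕ} (hn : 0 < n) {μ : Measure Ω} [IsProbabilityMeasure μ]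
    {X : Fin n → Ω → S} (hX : ∀ i, Measurable (X i)) (hindep : iIndepFun X μ)
    (hident : ∀ i j, IdentDistrib (X i) (X j) μ μ) :
    ∃ Q : Measure S, IsProbabilityMeasure Q ∧ IsSample μ X Q :=
  ⟨μ.map (X ⟨0, hn⟩), Measure.isProbabilityMeasure_map (hX _).aemeasurable,
    hX, hindep, fun i => (hident i ⟨0, hn⟩).map_eq⟩

variable {n : ℕ} {μ : Measure Ω} [IsProbabilityMeasure μ] {X : Fin n → Ω → S} {Q : Measure S}
  [IsProbabilityMeasure Q] {d : ℕ} {h : (Fin (d + 1) → S) → ℝ}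

/-- The sum of the squared normalised first order projections. -/
noncomputable def normSum (Q : Measure S) (a : (Fin (d + 1) → Fin n) → ℝ)
    (h : (Fin (d + 1) → S) → ℝ) (s : ℝ) (x : S) : ℝ :=
  ∑ i, (projSum Q a h i x / (n * s)) ^ 2

/-- The average of `normSum` over the data. -/
noncomputable def normAvg (Q : Measure S) (a : (Fin (d + 1) → Fin n) → ℝ)
    (h : (Fin (d + 1) → S) → ℝ) (s : ℝ) (x : Fin n → S) : ℝ :=
  (n : ℝ)⁻¹ * ∑ i, ∑ j, (projSum Q a h i (x j) / (n * s)) ^ 2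

theorem normAvg_eq (a : (Fin (d + 1) → Fin n) → ℝ) (s : ℝ) (x : Fin n → S) :
    normAvg Q a h s x = (n : ℝ)⁻¹ * ∑ j, normSum Q a h s (x j) := by
  unfold normAvg normSum
  rw [Finset.sum_comm]

theorem measurable_normSum (hh : Measurable h) (a : (Fin (d + 1) → Fin n) → ℝ) (s : ℝ) :
    Measurable (normSum Q a h s) := by
  unfold normSum
  have := fun i => measurable_projSum (Q := Q) hh a i
  fun_prop

theorem IsSample.integral_normSum (hs : IsSample μ X Q) (hn : 0 < n) (hh : Measurable h)
    (hp : MemLp h 2 (Measure.pi fun _ => Q)) (a : (Fin (d + 1) → Fin n) → ℝ) (s : ℝ) :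
    Integrable (normSum Q a h s) Q ∧ ∫ x, normSum Q a h s x ∂Q = V μ a h X / s ^ 2 := by
  have hn' : (n : ℝ) ≠ 0 := by exact_mod_cast hn.ne'
  have hp' : MemLp h (2 : ℕ) (Measure.pi fun _ => Q) := by exact_mod_cast hp
  have hi : ∀ i, Integrable (fun x => (projSum Q a h i x / (n * s)) ^ 2) Q := fun i => by
    simp_rw [div_pow]
    exact (integrable_pow_of_memLp two_ne_zero (memLp_projSum hh two_ne_zero hp' a i)).div_const _
  refine ⟨integrable_finsetSum _ fun i _ => hi i, ?_⟩
  unfold normSum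
  rw [integral_finsetSum _ fun i _ => hi i, hs.V_eq hh hp]
  simp_rw [div_pow, integral_div]
  rw [← Finset.sum_div, mul_pow, div_mul_eq_div_div, div_eq_inv_mul (∑ i, _)]

theorem IsSample.integral_normAvg (hs : IsSample μ X Q) (hn : 0 < n) (hh : Measurable h)
    (hp : MemLp h 2 (Measure.pi fun _ => Q)) (a : (Fin (d + 1) → Fin n) → ℝ) (s : ℝ) :
    Integrable (fun ω => normAvg Q a h s fun i => X i ω) μ ∧
      ∫ ω, normAvg Q a h s (fun i => X i ω) ∂μ = V μ a h X / s ^ 2 := by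
  have hn' : (n : ℝ) ≠ 0 := by exact_mod_cast hn.ne'
  obtain ⟨h1, h2⟩ := hs.integral_normSum hn hh hp a s
  have hi : ∀ j, Integrable (fun ω => normSum Q a h s (X j ω)) μ := fun j =>
    (hs.measurePreserving j).integrable_comp_of_integrable h1
  simp_rw [normAvg_eq]
  refine ⟨(integrable_finsetSum _ fun j _ => hi j).const_mul _, ?_⟩
  rw [integral_const_mul, integral_finsetSum _ fun j _ => hi j,
    Finset.sum_congr rfl fun j _ => integral_comp_of_measurePreserving (hs.measurePreserving j)
      (measurable_normSum hh a s), h2]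
  simp [hn']

theorem sum_weightCoef_sq_le (hn : 0 < n) (a : (Fin (d + 1) → Fin n) → ℝ) (i : Fin n) :
    ∑ l, weightCoef a l i ^ 2 ≤
      ((d : ℝ) + 1) * (n * normFactor (d + 1) n * absWeight a i) ^ 2 := by
  calc ∑ l, weightCoef a l i ^ 2
      ≤ ∑ _l : Fin (d + 1), (n * normFactor (d + 1) n * absWeight a i) ^ 2 := by
        refine Finset.sum_le_sum fun l _ => ?_
        rw [← sq_abs]
        exact pow_le_pow_left₀ (abs_nonneg _) (abs_weightCoef_le hn a l i) 2
    _ = _ := by simp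

/-- Cauchy–Schwarz twice: once to separate the weights from the projections, once to pass from
squared squares to fourth powers. -/
theorem integral_projSum_pow_four_le (hn : 0 < n) (hh : Measurable h)
    (hp : MemLp h 4 (Measure.pi fun _ => Q)) {M : ℝ}
    (hM : ∫ z, h z ^ 4 ∂(Measure.pi fun _ => Q) ≤ M)
    (a : (Fin (d + 1) → Fin n) → ℝ) (i : Fin n) :
    ∫ x, projSum Q a h i x ^ 4 ∂Q ≤
      16 * ((d : ℝ) + 1) ^ 4 * (n * normFactor (d + 1) n * absWeight a i) ^ 4 * M := by
  have hp' : MemLp h (4 : ℕ) (Measure.pi fun _ => Q) := by exact_mod_cast hp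
  set b := n * normFactor (d + 1) n * absWeight a i with hb
  have hint : ∀ l, Integrable (fun x => projKernel Q h l x ^ 4) Q := fun l =>
    integrable_pow_of_memLp four_ne_zero (memLp_projKernel hh four_ne_zero hp' l)
  have hw := sum_weightCoef_sq_le hn a i
  have hpt : ∀ x, projSum Q a h i x ^ 4 ≤
      (((d : ℝ) + 1) * b ^ 2) ^ 2 * (((d : ℝ) + 1) * ∑ l, projKernel Q h l x ^ 4) := fun x => by
    have h1 : projSum Q a h i x ^ 2 ≤ (((d : ℝ) + 1) * b ^ 2) * ∑ l, projKernel Q h l x ^ 2 :=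
      (Finset.sum_mul_sq_le_sq_mul_sq _ _ _).trans
        (mul_le_mul_of_nonneg_right hw (Finset.sum_nonneg fun _ _ => sq_nonneg _))
    have h2 : (∑ l, projKernel Q h l x ^ 2) ^ 2 ≤ ((d : ℝ) + 1) * ∑ l, projKernel Q h l x ^ 4 := by
      have := sq_sum_le_card_mul_sum_sq (s := (Finset.univ : Finset (Fin (d + 1))))
        (f := fun l => projKernel Q h l x ^ 2)
      simp only [Finset.card_univ, Fintype.card_fin, ← pow_mul] at this
      exact_mod_cast this
    calc projSum Q a h i x ^ 4 = (projSum Q a h i x ^ 2) ^ 2 := by ring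
      _ ≤ ((((d : ℝ) + 1) * b ^ 2) * ∑ l, projKernel Q h l x ^ 2) ^ 2 :=
        pow_le_pow_left₀ (sq_nonneg _) h1 2
      _ = (((d : ℝ) + 1) * b ^ 2) ^ 2 * (∑ l, projKernel Q h l x ^ 2) ^ 2 := by ring
      _ ≤ _ := mul_le_mul_of_nonneg_left h2 (sq_nonneg _)
  calc ∫ x, projSum Q a h i x ^ 4 ∂Q
      ≤ ∫ x, (((d : ℝ) + 1) * b ^ 2) ^ 2 * (((d : ℝ) + 1) * ∑ l, projKernel Q h l x ^ 4) ∂Q :=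
        integral_mono (integrable_pow_of_memLp four_ne_zero (memLp_projSum hh four_ne_zero hp' a i))
          (((integrable_finsetSum _ fun l _ => hint l).const_mul _).const_mul _) hpt
    _ = (((d : ℝ) + 1) * b ^ 2) ^ 2 * (((d : ℝ) + 1) *
          ∑ l, ∫ x, projKernel Q h l x ^ 4 ∂Q) := by
        rw [integral_const_mul, integral_const_mul, integral_finsetSum _ fun l _ => hint l]
    _ ≤ (((d : ℝ) + 1) * b ^ 2) ^ 2 * (((d : ℝ) + 1) * ∑ _l : Fin (d + 1), 16 * M) := by
        gcongr with l
        exact (integral_projKernel_pow_four_le hh hp l).trans (by linarith)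
    _ = _ := by
        simp only [Finset.sum_const, Finset.card_univ, Fintype.card_fin, nsmul_eq_mul]
        push_cast
        ring

/-- The average of $n$ i.i.d. terms has variance at most $n^{-1}$ times their second moment.
Cauchy–Schwarz over the $n$ indices inside `normSum` costs a factor $n$, and the two cancel. -/
theorem IsSample.integral_normAvg_sub_sq_le (hs : IsSample μ X Q) (hn : 0 < n) (hh : Measurable h)
    (hp : MemLp h 4 (Measure.pi fun _ => Q)) {M : ℝ}
    (hM : ∫ z, h z ^ 4 ∂(Measure.pi fun _ => Q) ≤ M)
    (a : (Fin (d + 1) → Fin n) → ℝ) (s : ℝ) :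
    Integrable (fun ω => (normAvg Q a h s (fun i => X i ω) - V μ a h X / s ^ 2) ^ 2) μ ∧
      ∫ ω, (normAvg Q a h s (fun i => X i ω) - V μ a h X / s ^ 2) ^ 2 ∂μ ≤
        16 * ((d : ℝ) + 1) ^ 4 *
          ∑ i, (n * normFactor (d + 1) n * absWeight a i) ^ 4 * M / (n * s) ^ 4 := by
  have hn' : (0 : ℝ) < n := by exact_mod_cast hn
  have hp' : MemLp h (4 : ℕ) (Measure.pi fun _ => Q) := by exact_mod_cast hp
  have hp2 : MemLp h 2 (Measure.pi fun _ => Q) := hp.mono_exponent (by norm_num)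
  obtain ⟨hi, hv⟩ := hs.integral_normSum hn hh hp2 a s
  set v := V μ a h X / s ^ 2
  have hW : ∀ i, MemLp (fun x => projSum Q a h i x / (n * s)) 4 Q := fun i => by
    simp_rw [div_eq_mul_inv]
    have : MemLp (projSum Q a h i) 4 Q := by
      exact_mod_cast memLp_projSum hh four_ne_zero hp' a i
    exact this.mul_const _
  have hG : MemLp (normSum Q a h s) 2 Q := memLp_finsetSum _ fun i _ => memLp_sq (hW i)
  have hf : MemLp (fun x => normSum Q a h s x - v) 2 Q := hG.sub (memLp_const _)
  have hEq : ∀ ω, normAvg Q a h s (fun i => X i ω) - v =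
      (n : ℝ)⁻¹ * ∑ j, (normSum Q a h s (X j ω) - v) := fun ω => by
    rw [normAvg_eq, Finset.sum_sub_distrib]
    simp only [Finset.sum_const, Finset.card_univ, Fintype.card_fin, nsmul_eq_mul]
    field_simp
  simp_rw [hEq]
  refine ⟨((hs.memLp_sum hf).const_mul _).integrable_sq, ?_⟩
  simp_rw [mul_pow _ (∑ j, _)]
  rw [integral_const_mul, hs.integral_sum_sq ((measurable_normSum hh a s).sub_const _) hf
    (by rw [integral_sub hi (integrable_const _), hv]; simp)]
  have h1 : ∫ x, (normSum Q a h s x - v) ^ 2 ∂Q ≤ ∫ x, normSum Q a h s x ^ 2 ∂Q := by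
    have e1 := variance_eq_integral (μ := Q) hG.1.aemeasurable
    have e2 := variance_le_expectation_sq (μ := Q) hG.1
    rw [e1, hv] at e2
    simpa using e2
  have hi4 : ∀ i, Integrable (fun x => (projSum Q a h i x / (n * s)) ^ 4) Q := fun i =>
    integrable_pow_of_memLp four_ne_zero (by exact_mod_cast hW i)
  have h2 : ∫ x, normSum Q a h s x ^ 2 ∂Q ≤
      n * ∑ i, ∫ x, (projSum Q a h i x / (n * s)) ^ 4 ∂Q := by
    rw [← integral_finsetSum _ fun i _ => hi4 i, ← integral_const_mul]
    refine integral_mono hG.integrable_sq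
      ((integrable_finsetSum _ fun i _ => hi4 i).const_mul _) fun x => ?_
    have := sq_sum_le_card_mul_sum_sq (s := (Finset.univ : Finset (Fin n)))
        (f := fun i => (projSum Q a h i x / (n * s)) ^ 2)
    simp only [Finset.card_univ, Fintype.card_fin, ← pow_mul] at this
    exact this
  have h3 : ∀ i, ∫ x, (projSum Q a h i x / (n * s)) ^ 4 ∂Q ≤ 16 * ((d : ℝ) + 1) ^ 4 *
      ((n * normFactor (d + 1) n * absWeight a i) ^ 4 * M / (n * s) ^ 4) := fun i => by
    simp_rw [div_pow _ _ 4]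
    rw [integral_div]
    have he : (0 : ℝ) ≤ (n * s) ^ 4 := Even.pow_nonneg ⟨2, rfl⟩ _
    refine (div_le_div_of_nonneg_right (integral_projSum_pow_four_le hn hh hp hM a i) he).trans
      (le_of_eq ?_)
    ring
  calc ((n : ℝ)⁻¹) ^ 2 * (n * ∫ x, (normSum Q a h s x - v) ^ 2 ∂Q)
      ≤ ((n : ℝ)⁻¹) ^ 2 * (n * (n * ∑ i, ∫ x, (projSum Q a h i x / (n * s)) ^ 4 ∂Q)) := by
        gcongr
        exact h1.trans h2
    _ = ∑ i, ∫ x, (projSum Q a h i x / (n * s)) ^ 4 ∂Q := by field_simp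
    _ ≤ _ := by
        rw [Finset.mul_sum]
        exact Finset.sum_le_sum fun i _ => h3 i

theorem IsSample.integral_sum_sum_sq (hs : IsSample μ X Q) (hn : 0 < n) (hh : Measurable h)
    (hp : MemLp h 2 (Measure.pi fun _ => Q)) (a : (Fin (d + 1) → Fin n) → ℝ) (s : ℝ) :
    Integrable (fun ω => ((n : ℝ) ^ 2)⁻¹ * ∑ i, (∑ j, projSum Q a h i (X j ω) / (n * s)) ^ 2) μ ∧
      ∫ ω, ((n : ℝ) ^ 2)⁻¹ * ∑ i, (∑ j, projSum Q a h i (X j ω) / (n * s)) ^ 2 ∂μ =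
        (n : ℝ)⁻¹ * (V μ a h X / s ^ 2) := by
  have hn' : (n : ℝ) ≠ 0 := by exact_mod_cast hn.ne'
  have hp' : MemLp h (2 : ℕ) (Measure.pi fun _ => Q) := by exact_mod_cast hp
  have hL : ∀ i, MemLp (fun x => projSum Q a h i x / (n * s)) 2 Q := fun i => by
    simp_rw [div_eq_mul_inv]
    have : MemLp (projSum Q a h i) 2 Q := by
      exact_mod_cast memLp_projSum hh two_ne_zero hp' a i
    exact this.mul_const _
  have hi : ∀ i, Integrable (fun ω => (∑ j, projSum Q a h i (X j ω) / (n * s)) ^ 2) μ := fun i =>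
    (hs.memLp_sum (hL i)).integrable_sq
  refine ⟨(integrable_finsetSum _ fun i _ => hi i).const_mul _, ?_⟩
  rw [integral_const_mul, integral_finsetSum _ fun i _ => hi i]
  have h1 : ∀ i, ∫ ω, (∑ j, projSum Q a h i (X j ω) / (n * s)) ^ 2 ∂μ =
      n * ∫ x, (projSum Q a h i x / (n * s)) ^ 2 ∂Q := fun i =>
    hs.integral_sum_sq (f := fun x => projSum Q a h i x / (n * s))
      ((measurable_projSum hh a i).div_const _) (hL i)
      (by rw [integral_div, integral_projSum hh (hp.integrable one_le_two), zero_div])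
  simp_rw [h1]
  rw [← (hs.integral_normSum hn hh hp a s).2]
  unfold normSum
  rw [integral_finsetSum _ fun i _ => (hL i).integrable_sq, ← Finset.mul_sum]
  field_simp

theorem bootstrapVar_eq (s : ℝ) (a : (Fin (d + 1) → Fin n) → ℝ) (x : Fin n → S) :
    bootstrapVar (fun y => s⁻¹ * uStat a h y) x =
      (s ^ 2)⁻¹ * variance (U a h fun i (y : Fin n → S) => y i) (bootstrapLaw x) := by
  unfold bootstrapVar
  rw [← inv_pow, ← variance_const_mul]
  rfl

/-- Expectations under the empirical distribution are averages over the data. The leading term of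
the bootstrap variance is therefore the first heterogeneity average, with empirical projections. -/
theorem V_bootstrap_eq (hn : 0 < n) (hh : Measurable h) (s : ℝ)
    (a : (Fin (d + 1) → Fin n) → ℝ) (x : Fin n → S) :
    (s ^ 2)⁻¹ * V (bootstrapLaw x) a h (fun i (y : Fin n → S) => y i) =
      normAvg (empirical x) a h s x := by
  have hn' : (n : ℝ) ≠ 0 := by exact_mod_cast hn.ne'
  have := isProbabilityMeasure_empirical hn x
  have : IsProbabilityMeasure (bootstrapLaw x) := by unfold bootstrapLaw; infer_instance
  rw [(isSample_bootstrapLaw hn x).V_eq hh (memLp_pi_empirical hn x hh 2)]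
  simp_rw [integral_empirical hn x ((measurable_projSum hh a _).pow_const 2)]
  unfold normAvg
  simp_rw [div_pow]
  rw [Finset.mul_sum, Finset.mul_sum, Finset.mul_sum]
  refine Finset.sum_congr rfl fun i _ => ?_
  rw [← Finset.sum_div, mul_pow]
  field_simp

/-- The bound for the relative contribution of the remainder to the variance, per unit of second
moment of the kernel. -/
noncomputable def remainderFactor (a : (Fin (d + 1) → Fin n) → ℝ) (s : ℝ) : ℝ :=
  (s ^ 2)⁻¹ * (normFactor (d + 1) n ^ 2 *
    (∑ T ∈ sharingAtLeast 2 2 (d + 1) n, |∏ k, a (T k)|) * (6 + 12 * ((d : ℝ) + 1) ^ 2))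

theorem remainderFactor_nonneg (a : (Fin (d + 1) → Fin n) → ℝ) (s : ℝ) :
    0 ≤ remainderFactor a s := by
  have := normFactor_nonneg (d + 1) n
  unfold remainderFactor
  have h2 : 0 ≤ ∑ T ∈ sharingAtLeast 2 2 (d + 1) n, |∏ k, a (T k)| :=
    Finset.sum_nonneg fun _ _ => abs_nonneg _
  positivity

/-- The variance decomposition applied to the bootstrap sample. It holds for every realisation $x$,
and no moment condition is needed since all empirical moments are finite. -/
theorem abs_bootstrapVar_sub_normAvg_le (hn : 0 < n) (hh : Measurable h) (s : ℝ)
    (a : (Fin (d + 1) → Fin n) → ℝ) (x : Fin n → S) :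
    |bootstrapVar (fun y => s⁻¹ * uStat a h y) x - normAvg (empirical x) a h s x| ≤
      remainderFactor a s * ∫ z, h z ^ 2 ∂(Measure.pi fun _ => empirical x) := by
  have := isProbabilityMeasure_empirical hn x
  have : IsProbabilityMeasure (bootstrapLaw x) := by unfold bootstrapLaw; infer_instance
  have hs := isSample_bootstrapLaw hn x
  have hp := memLp_pi_empirical (k := d + 1) hn x hh 2
  have h1 := hs.V_le_variance_U hn hh hp a
  have h2 := hs.variance_U_le hn hh hp a
  have h0 : (0 : ℝ) ≤ (s ^ 2)⁻¹ := by positivity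
  rw [bootstrapVar_eq, ← V_bootstrap_eq hn hh, ← mul_sub, abs_mul, abs_of_nonneg h0,
    abs_of_nonneg (sub_nonneg.2 h1)]
  unfold remainderFactor
  rw [mul_assoc]
  refine mul_le_mul_of_nonneg_left ?_ h0
  linarith

/-- The cross term $2v(u-v)$ is split by the weighted inequality of the means. The part $\varepsilon
v^2$ is affordable because the average of $v^2$ stays bounded in mean. -/
theorem abs_sq_sub_sq_le {ε : ℝ} (hε : 0 < ε) (u v : ℝ) :
    |u ^ 2 - v ^ 2| ≤ (1 + ε⁻¹) * (u - v) ^ 2 + ε * v ^ 2 := by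
  have h1 : ε⁻¹ * (u - v) ^ 2 + ε * v ^ 2 - 2 * |v * (u - v)| =
      ε⁻¹ * (|u - v| - ε * |v|) ^ 2 := by
    rw [abs_mul, ← sq_abs (u - v), ← sq_abs v]
    field_simp
    ring
  have h2 : 0 ≤ ε⁻¹ * (|u - v| - ε * |v|) ^ 2 := by positivity
  have h3 : u ^ 2 - v ^ 2 = (u - v) ^ 2 + 2 * (v * (u - v)) := by ring
  rw [h3]
  refine (abs_add_le _ _).trans ?_
  rw [abs_of_nonneg (sq_nonneg (u - v)), abs_mul, abs_two]
  linarith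

theorem abs_normAvg_empirical_sub_le (hn : 0 < n) (hh : Measurable h) (s : ℝ)
    (a : (Fin (d + 1) → Fin n) → ℝ) (x : Fin n → S) {ε : ℝ} (hε : 0 < ε) :
    |normAvg (empirical x) a h s x - normAvg Q a h s x| ≤
      (1 + ε⁻¹) * (((n * s) ^ 2)⁻¹ * (((d : ℝ) + 1) *
        ∑ i, (n * normFactor (d + 1) n * absWeight a i) ^ 2) * projError Q h x) +
      ε * normAvg Q a h s x := by
  have hn0 : (0 : ℝ) ≤ (n : ℝ)⁻¹ := by positivity
  have hε' : 0 ≤ 1 + ε⁻¹ := by positivity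
  have hdiff : (n : ℝ)⁻¹ * ∑ i, ∑ j, (projSum (empirical x) a h i (x j) / (n * s) -
      projSum Q a h i (x j) / (n * s)) ^ 2 ≤ ((n * s) ^ 2)⁻¹ * (((d : ℝ) + 1) *
        ∑ i, (n * normFactor (d + 1) n * absWeight a i) ^ 2) * projError Q h x := by
    have e1 : ∀ i j, (projSum (empirical x) a h i (x j) / (n * s) -
        projSum Q a h i (x j) / (n * s)) ^ 2 ≤ ((n * s) ^ 2)⁻¹ *
          ((((d : ℝ) + 1) * (n * normFactor (d + 1) n * absWeight a i) ^ 2) *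
          ∑ l, (projKernel (empirical x) h l (x j) - projKernel Q h l (x j)) ^ 2) := fun i j => by
      rw [← sub_div, div_pow, div_eq_inv_mul]
      refine mul_le_mul_of_nonneg_left ?_ (by positivity)
      unfold projSum
      rw [← Finset.sum_sub_distrib]
      simp_rw [← mul_sub]
      exact (Finset.sum_mul_sq_le_sq_mul_sq _ _ _).trans (mul_le_mul_of_nonneg_right
        (sum_weightCoef_sq_le hn a i) (Finset.sum_nonneg fun _ _ => sq_nonneg _))
    calc _ ≤ (n : ℝ)⁻¹ * ∑ i, ∑ j, ((n * s) ^ 2)⁻¹ *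
          ((((d : ℝ) + 1) * (n * normFactor (d + 1) n * absWeight a i) ^ 2) *
          ∑ l, (projKernel (empirical x) h l (x j) - projKernel Q h l (x j)) ^ 2) := by
          gcongr with i _ j _
          exact e1 i j
      _ = ((n * s) ^ 2)⁻¹ * (((d : ℝ) + 1) *
          ∑ i, (n * normFactor (d + 1) n * absWeight a i) ^ 2) * ((n : ℝ)⁻¹ *
          ∑ j, ∑ l, (projKernel (empirical x) h l (x j) - projKernel Q h l (x j)) ^ 2) := by
          simp_rw [← Finset.mul_sum, ← Finset.sum_mul]
          rw [← Finset.mul_sum]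
          ring
      _ ≤ _ := by
          refine mul_le_mul_of_nonneg_left (sum_projKernel_empirical_sub_sq_le hn hh x) ?_
          have : 0 ≤ ∑ i, (n * normFactor (d + 1) n * absWeight a i) ^ 2 :=
            Finset.sum_nonneg fun _ _ => sq_nonneg _
          positivity
  calc |normAvg (empirical x) a h s x - normAvg Q a h s x|
      = (n : ℝ)⁻¹ * |∑ i, ∑ j, ((projSum (empirical x) a h i (x j) / (n * s)) ^ 2 -
          (projSum Q a h i (x j) / (n * s)) ^ 2)| := by
        unfold normAvg
        rw [← mul_sub, abs_mul, abs_of_nonneg hn0]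
        simp_rw [Finset.sum_sub_distrib]
    _ ≤ (n : ℝ)⁻¹ * ∑ i, ∑ j, ((1 + ε⁻¹) * (projSum (empirical x) a h i (x j) / (n * s) -
          projSum Q a h i (x j) / (n * s)) ^ 2 + ε * (projSum Q a h i (x j) / (n * s)) ^ 2) := by
        refine mul_le_mul_of_nonneg_left ?_ hn0
        refine (Finset.abs_sum_le_sum_abs _ _).trans (Finset.sum_le_sum fun i _ => ?_)
        refine (Finset.abs_sum_le_sum_abs _ _).trans (Finset.sum_le_sum fun j _ => ?_)
        exact abs_sq_sub_sq_le hε _ _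
    _ = (1 + ε⁻¹) * ((n : ℝ)⁻¹ * ∑ i, ∑ j, (projSum (empirical x) a h i (x j) / (n * s) -
          projSum Q a h i (x j) / (n * s)) ^ 2) + ε * normAvg Q a h s x := by
        unfold normAvg
        simp_rw [Finset.sum_add_distrib, ← Finset.mul_sum]
        ring
    _ ≤ _ := by gcongr

theorem IsSample.M1_eq_zero (hs : IsSample μ X Q) (hh : Measurable h) : M1 μ h X = 0 := by
  have : ∀ I ∈ indexSet (d + 1) n, theta μ h X I = meanKernel Q h := fun I hI =>
    integral_comp_of_measurePreserving (hs.measurePreserving_tuple (mem_indexSet.1 hI)) hh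
  unfold M1
  refine le_antisymm (Real.sSup_nonpos ?_) (Real.sSup_nonneg ?_)
  · rintro v ⟨I, hI, J, hJ, rfl⟩
    simp [this I hI, this J hJ]
  · rintro v ⟨I, hI, J, hJ, rfl⟩
    exact abs_nonneg _

/-- Given the observations at $s$, the tuple sharing only the index at position $p$ contributes $d$
fresh independent draws. Both sides are thus one integral that depends on $p$, $q$ and $s$ only. -/
theorem IsSample.integral_mul_eq (hs : IsSample μ X Q) (hh : Measurable h)
    {r s k : Fin (d + 1) → Fin n} (hr : Function.Injective r) (hk : Function.Injective k)
    {p q : Fin (d + 1)}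
    (hrs : r p = s q ∧ Set.range r ∩ Set.range s = {s q})
    (hks : k p = s q ∧ Set.range k ∩ Set.range s = {s q}) :
    ∫ ω, h (fun j => X (r j) ω) * h (fun j => X (s j) ω) ∂μ =
      ∫ ω, h (fun j => X (k j) ω) * h (fun j => X (s j) ω) ∂μ := by
  have key : ∀ t : Fin (d + 1) → Fin n, Function.Injective t →
      (t p = s q ∧ Set.range t ∩ Set.range s = {s q}) →
      ∫ ω, h (fun j => X (t j) ω) * h (fun j => X (s j) ω) ∂μ =
      ∫ z, h (Fin.insertNth (α := fun _ => S) p (z.1 q) z.2) * h z.1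
        ∂((μ.map fun ω j => X (s j) ω).prod (Measure.pi fun _ : Fin d => Q)) := by
    intro t ht hts
    have hdis : ∀ j (l : Fin d), s j ≠ t (p.succAbove l) := fun j l hj => by
      have : t (p.succAbove l) ∈ Set.range t ∩ Set.range s := ⟨⟨_, rfl⟩, ⟨j, hj⟩⟩
      rw [hts.2, Set.mem_singleton_iff, ← hts.1] at this
      exact Fin.succAbove_ne p l (ht this)
    have hind := hs.indepFun_tuple hdis
    have hA := hs.measurable_tuple s
    have hB := hs.measurable_tuple fun l => t (p.succAbove l)
    have hmap := (indepFun_iff_map_prod_eq_prod_map_map hA.aemeasurable hB.aemeasurable).1 hind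
    have hlaw := (hs.measurePreserving_tuple (I := fun l => t (p.succAbove l))
      (ht.comp Fin.succAbove_right_injective)).map_eq
    rw [hlaw] at hmap
    have hm : Measurable fun z : (Fin (d + 1) → S) × (Fin d → S) =>
        h (Fin.insertNth (α := fun _ => S) p (z.1 q) z.2) * h z.1 :=
      (hh.comp ((measurable_insertNth p).comp
        (((measurable_pi_apply q).comp measurable_fst).prodMk measurable_snd))).mul
        (hh.comp measurable_fst)
    rw [← hmap, integral_map (hA.prodMk hB).aemeasurable hm.aestronglyMeasurable]
    refine integral_congr_ae (ae_of_all _ fun ω => ?_)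
    simp only
    congr 2
    rw [← hts.1]
    exact (Fin.insertNth_self_removeNth p fun j => X (t j) ω).symm
  rw [key r hr hrs, key k hk hks]

theorem IsSample.M2_eq_zero (hs : IsSample μ X Q) (hh : Measurable h) : M2 μ h X = 0 := by
  unfold M2
  refine le_antisymm (Real.sSup_nonpos ?_) (Real.sSup_nonneg ?_)
  · rintro v ⟨p, q, r, hr, s, _, k, hk, hrs, hks, rfl⟩
    unfold meanCondProd
    rw [integral_condExp (hs.measurable (k p)).comap_le,
      integral_condExp (hs.measurable (k p)).comap_le,
      hs.integral_mul_eq hh (mem_indexSet.1 hr) (mem_indexSet.1 hk) hrs hks]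
    simp
  · rintro v ⟨p, q, r, hr, s, _, k, hk, hrs, hks, rfl⟩
    exact abs_nonneg _

end FiniteSample

/-! ### Passage to the limit: bounds in terms of the hypotheses -/

section Asymptotics

variable {Ω S : Type*} [MeasurableSpace Ω] [MeasurableSpace S]

/-- Markov's inequality for a dominating variable $W$. Only $W$ has to be integrable, so the
measurability of $Z_n$, in particular of the bootstrap variance as a function of the data, is never
needed. -/
theorem tendstoInMeasure_of_integral_bound {μ : Measure Ω} [IsProbabilityMeasure μ]
    {Z : ℕ → Ω → ℝ} {c : ℝ}
    (hZ : ∀ δ : ℝ, 0 < δ → ∀ᶠ n in atTop, ∃ W : Ω → ℝ, Integrable W μ ∧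
      (∀ ω, |Z n ω - c| ≤ W ω) ∧ ∫ ω, W ω ∂μ ≤ δ) :
    TendstoInMeasure μ Z atTop fun _ => c := by
  rw [tendstoInMeasure_iff_measureReal_dist]
  intro ε hε
  rw [Metric.tendsto_nhds]
  intro η hη
  filter_upwards [hZ (ε * (η / 2)) (by positivity)] with n hn
  obtain ⟨W, hW, hle, hint⟩ := hn
  have hW0 : 0 ≤ᵐ[μ] W := ae_of_all _ fun ω => (abs_nonneg _).trans (hle ω)
  have h1 := mul_meas_ge_le_integral_of_nonneg hW0 hW ε
  have h2 : μ.real {ω | ε ≤ dist (Z n ω) c} ≤ μ.real {ω | ε ≤ W ω} :=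
    measureReal_mono fun ω hω => le_trans hω (by simpa [Real.dist_eq] using hle ω)
  have h3 : μ.real {ω | ε ≤ dist (Z n ω) c} ≤ η / 2 :=
    h2.trans (le_of_mul_le_mul_left (h1.trans hint) hε)
  rw [Real.dist_eq, sub_zero, abs_of_nonneg measureReal_nonneg]
  linarith

theorem tendsto_zero_of_le_const_mul {f g : ℕ → ℝ} (hg : Tendsto g atTop (𝓝 0)) (c : ℝ)
    (h0 : ∀ᶠ n in atTop, 0 ≤ f n) (hle : ∀ᶠ n in atTop, f n ≤ c * g n) :
    Tendsto f atTop (𝓝 0) :=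
  squeeze_zero' h0 hle (by simpa using hg.const_mul c)

variable {n d : ℕ}

theorem remainderFactor_mul_le (hn : d + 1 ≤ n) (a : (Fin (d + 1) → Fin n) → ℝ) {s v c : ℝ}
    (hv : 0 < v) (hvs : v ≤ s ^ 2) (hc : 0 ≤ c) :
    remainderFactor a s * c ≤ (((d + 1 : ℕ) : ℝ) ^ 4 * (((d + 1 : ℕ) : ℝ) ^ (d + 1)) ^ 2 *
      (6 + 12 * ((d : ℝ) + 1) ^ 2)) * ((n : ℝ) ^ (-2 : ℤ) * v ^ (-1 : ℤ) * avgWeight 2 2 a * c) := by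
  have h1 := sq_normFactor_mul_sum_two_two_le (by omega) hn a
  have hA := avgWeight_nonneg 2 2 a
  have h2 : (s ^ 2)⁻¹ ≤ v⁻¹ := inv_anti₀ hv hvs
  have hz : (n : ℝ) ^ (-2 : ℤ) = ((n : ℝ) ^ 2)⁻¹ := by rw [zpow_neg]; norm_cast
  have h0 : 0 ≤ normFactor (d + 1) n ^ 2 *
      ∑ T ∈ sharingAtLeast 2 2 (d + 1) n, |∏ k, a (T k)| :=
    mul_nonneg (sq_nonneg _) (Finset.sum_nonneg fun _ _ => abs_nonneg _)
  unfold remainderFactor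
  rw [hz, zpow_neg_one]
  calc _ ≤ v⁻¹ * ((((d + 1 : ℕ) : ℝ) ^ 4 * (((d + 1 : ℕ) : ℝ) ^ (d + 1)) ^ 2 *
        ((n : ℝ) ^ 2)⁻¹ * avgWeight 2 2 a) * (6 + 12 * ((d : ℝ) + 1) ^ 2)) * c := by gcongr
    _ = _ := by ring

theorem remainderFactor_mul_inv_le (hn : d + 1 ≤ n) (a : (Fin (d + 1) → Fin n) → ℝ) (s : ℝ) :
    remainderFactor a s * (n : ℝ)⁻¹ ≤ ((((d + 1 : ℕ) : ℝ) ^ (d + 1 + 1)) ^ 2 *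
      (6 + 12 * ((d : ℝ) + 1) ^ 2)) *
      ((n : ℝ) ^ (-2 : ℤ) * s ^ (-2 : ℤ) * avgWeight 2 1 a) := by
  have h1 := sq_normFactor_mul_sum_two_two_le' (by omega) hn a
  have hA := avgWeight_nonneg 2 1 a
  have hz : ∀ t : ℝ, t ^ (-2 : ℤ) = (t ^ 2)⁻¹ := fun t => by rw [zpow_neg]; norm_cast
  unfold remainderFactor
  rw [hz, hz]
  calc _ ≤ (s ^ 2)⁻¹ * (((((d + 1 : ℕ) : ℝ) ^ (d + 1 + 1)) ^ 2 * (n : ℝ)⁻¹ * avgWeight 2 1 a) *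
        (6 + 12 * ((d : ℝ) + 1) ^ 2)) * (n : ℝ)⁻¹ := by gcongr
    _ = _ := by ring

theorem inv_mul_sum_sq_absWeight_le (hn : d + 1 ≤ n) (a : (Fin (d + 1) → Fin n) → ℝ) (s : ℝ) :
    ((n * s) ^ 2)⁻¹ * (((d : ℝ) + 1) *
      ∑ i, (n * normFactor (d + 1) n * absWeight a i) ^ 2) * (n : ℝ)⁻¹ ≤
      (((d : ℝ) + 1) * ((d + 1 : ℕ) * (((d + 1 : ℕ) : ℝ) ^ (d + 1 + 1)) ^ 2)) *
      ((n : ℝ) ^ (-2 : ℤ) * s ^ (-2 : ℤ) * avgWeight 2 1 a) := by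
  have hn' : (n : ℝ) ≠ 0 := by
    have : n ≠ 0 := by omega
    exact_mod_cast this
  have h1 := sum_pow_absWeight_le (K := 2) two_pos hn a
  have hz : ∀ t : ℝ, t ^ (-2 : ℤ) = (t ^ 2)⁻¹ := fun t => by rw [zpow_neg]; norm_cast
  rw [hz, hz]
  calc _ ≤ ((n * s) ^ 2)⁻¹ * (((d : ℝ) + 1) *
      ((d + 1 : ℕ) * (((d + 1 : ℕ) : ℝ) ^ (d + 1 + 1)) ^ 2 * n * avgWeight 2 1 a)) * (n : ℝ)⁻¹ := by
        gcongr
    _ = _ := by rw [mul_pow, mul_inv]; field_simp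

/-- Attaching $M^{1/4}$ to each weight makes third powers carry $M^{3/4}$ and fourth powers carry
$M$, so one normalised quantity serves both. The bound $s^{-3}\le v^{-3/2}$ replaces $\sigma_n$ by
$V(n)$. -/
theorem sum_absWeight_pow_three_le (hn : d + 1 ≤ n) (a : (Fin (d + 1) → Fin n) → ℝ)
    {s v M : ℝ} (hv : 0 < v) (hs : 0 < s) (hvs : v ≤ s ^ 2) (hM : 0 < M) :
    ∑ i, (n * normFactor (d + 1) n * absWeight a i * M ^ (1 / 4 : ℝ) / (n * s)) ^ 3 ≤
      ((d + 1 : ℕ) * (((d + 1 : ℕ) : ℝ) ^ (d + 1 + 1)) ^ 3) *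
      ((n : ℝ) ^ (-2 : ℤ) * v ^ (-(3 / 2) : ℝ) * avgWeight 3 1 a * M ^ (3 / 4 : ℝ)) := by
  have hn' : (0 : ℝ) < n := by
    have : 0 < n := by omega
    exact_mod_cast this
  have h1 := sum_pow_absWeight_le (K := 3) three_pos hn a
  have hA := avgWeight_nonneg 3 1 a
  have hz : (n : ℝ) ^ (-2 : ℤ) = ((n : ℝ) ^ 2)⁻¹ := by rw [zpow_neg]; norm_cast
  have hM3 : (M ^ (1 / 4 : ℝ)) ^ 3 = M ^ (3 / 4 : ℝ) := by
    rw [← Real.rpow_natCast, ← Real.rpow_mul hM.le]; norm_num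
  have hM0 : 0 < M ^ (3 / 4 : ℝ) := Real.rpow_pos_of_pos hM _
  have hvr : (s ^ 3)⁻¹ ≤ v ^ (-(3 / 2) : ℝ) := by
    rw [Real.rpow_neg hv.le]
    refine inv_anti₀ (Real.rpow_pos_of_pos hv _) ?_
    calc v ^ (3 / 2 : ℝ) ≤ (s ^ 2) ^ (3 / 2 : ℝ) := Real.rpow_le_rpow hv.le hvs (by norm_num)
      _ = s ^ 3 := by
        rw [← Real.rpow_natCast, ← Real.rpow_mul hs.le, ← Real.rpow_natCast]; norm_num
  have hEq : ∀ i, (n * normFactor (d + 1) n * absWeight a i * M ^ (1 / 4 : ℝ) / (n * s)) ^ 3 =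
      (n * normFactor (d + 1) n * absWeight a i) ^ 3 *
        (((n : ℝ) ^ 3)⁻¹ * (s ^ 3)⁻¹ * M ^ (3 / 4 : ℝ)) := fun i => by
    rw [div_pow, mul_pow _ (M ^ (1 / 4 : ℝ)), hM3, mul_pow (n : ℝ) s]
    field_simp
  simp_rw [hEq]
  rw [← Finset.sum_mul, hz]
  calc _ ≤ ((d + 1 : ℕ) * (((d + 1 : ℕ) : ℝ) ^ (d + 1 + 1)) ^ 3 * n * avgWeight 3 1 a) *
        (((n : ℝ) ^ 3)⁻¹ * v ^ (-(3 / 2) : ℝ) * M ^ (3 / 4 : ℝ)) := by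
        gcongr
    _ = _ := by field_simp

variable {μ : Measure Ω} [IsProbabilityMeasure μ] {X : Fin n → Ω → S} {h : (Fin (d + 1) → S) → ℝ}

theorem integral_sq_le_rpow {Q : Measure S} [IsProbabilityMeasure Q] (hh : Measurable h)
    (hp : MemLp h 4 (Measure.pi fun _ => Q)) {M : ℝ}
    (hle : ∫ z, h z ^ 4 ∂(Measure.pi fun _ => Q) ≤ M) :
    ∫ z, h z ^ 2 ∂(Measure.pi fun _ => Q) ≤ M ^ (1 / 2 : ℝ) := by
  have h1 := meanKernel_pow_le (Q := Q) (h := fun z => h z ^ 2) (hh.pow_const 2) two_ne_zero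
    even_two (by exact_mod_cast memLp_sq hp)
  simp_rw [← pow_mul] at h1
  rw [← Real.sqrt_eq_rpow]
  exact Real.le_sqrt_of_sq_le (h1.trans hle)

/-- For fixed `n`: the data are a sample from some law, and the moment assumptions hold for it. -/
theorem exists_sample_of_moments (hn : d + 1 ≤ n) (hX : ∀ i, Measurable (X i))
    (hh : Measurable h) (hindep : iIndepFun X μ) (hident : ∀ i j, IdentDistrib (X i) (X j) μ μ)
    {M : ℝ} (hM : 0 < M)
    (hmoment : ∀ I ∈ indexSet (d + 1) n,
      ∫⁻ ω, ENNReal.ofReal (h (fun k => X (I k) ω) ^ 4) ∂μ ≤ ENNReal.ofReal M) :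
    ∃ Q : Measure S, IsProbabilityMeasure Q ∧ IsSample μ X Q ∧
      MemLp h 4 (Measure.pi fun _ => Q) ∧ ∫ z, h z ^ 4 ∂(Measure.pi fun _ => Q) ≤ M ∧
      ∀ B : ℝ, 0 ≤ B → (∀ I : Fin (d + 1) → Fin n,
        ∫⁻ ω, ENNReal.ofReal (h (fun k => X (I k) ω) ^ 2) ∂μ ≤ ENNReal.ofReal B) →
        SecondMomentBound μ X Q h B := by
  obtain ⟨Q, hQ, hs⟩ := exists_isSample (by omega) hX hindep hident
  refine ⟨Q, hQ, hs, ?_⟩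
  -- The tuple of the first $d+1$ indices is injective and transfers the moment bounds to the
  -- product law.
  have hI := Fin.castLE_injective hn
  have hmp := hs.measurePreserving_tuple hI
  have h4 : MemLp h (4 : ℕ) (Measure.pi fun _ => Q) ∧
      ∫ z, h z ^ 4 ∂(Measure.pi fun _ => Q) ≤ M := by
    refine memLp_and_integral_pow_le hh.aestronglyMeasurable four_ne_zero ⟨2, rfl⟩ hM.le ?_
    rw [← hmp.lintegral_comp (hh.pow_const 4).ennreal_ofReal]
    exact hmoment _ (mem_indexSet.2 hI)
  refine ⟨by exact_mod_cast h4.1, h4.2, fun B hB0 hB => ?_⟩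
  have h2 : MemLp h (2 : ℕ) (Measure.pi fun _ => Q) ∧
      ∫ z, h z ^ 2 ∂(Measure.pi fun _ => Q) ≤ B := by
    refine memLp_and_integral_pow_le hh.aestronglyMeasurable two_ne_zero even_two hB0 ?_
    rw [← hmp.lintegral_comp (hh.pow_const 2).ennreal_ofReal]
    exact hB _
  have hI2 : ∀ I : Fin (d + 1) → Fin n, MemLp (fun ω => h fun k => X (I k) ω) (2 : ℕ) μ ∧
      ∫ ω, h (fun k => X (I k) ω) ^ 2 ∂μ ≤ B := fun I =>
    memLp_and_integral_pow_le (hh.comp (hs.measurable_tuple I)).aestronglyMeasurable two_ne_zero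
      even_two hB0 (hB I)
  exact ⟨fun I => by exact_mod_cast (hI2 I).1, fun I => (hI2 I).2, by exact_mod_cast h2.1, h2.2⟩

theorem sigma_sq (a : (Fin (d + 1) → Fin n) → ℝ) :
    sigma μ a h X ^ 2 = variance (U a h X) μ :=
  Real.sq_sqrt (variance_nonneg _ _)

/-- For fixed `n`: the bounds on which the limit theorem rests, in terms of the sample law. -/
theorem abs_V_div_sub_one_le {Q : Measure S} [IsProbabilityMeasure Q] (hs : IsSample μ X Q)
    (hn : 0 < n) (hh : Measurable h) (hp : MemLp h 4 (Measure.pi fun _ => Q)) {M : ℝ}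
    (hle : ∫ z, h z ^ 4 ∂(Measure.pi fun _ => Q) ≤ M) (a : (Fin (d + 1) → Fin n) → ℝ)
    (hV : 0 < V μ a h X) :
    V μ a h X ≤ sigma μ a h X ^ 2 ∧ 0 < sigma μ a h X ∧
    |V μ a h X / sigma μ a h X ^ 2 - 1| ≤
      remainderFactor a (sigma μ a h X) * M ^ (1 / 2 : ℝ) := by
  have hp2 : MemLp h 2 (Measure.pi fun _ => Q) := hp.mono_exponent (by norm_num)
  have h1 := hs.V_le_variance_U hn hh hp2 a
  have h2 := hs.variance_U_le hn hh hp2 a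
  have h3 := integral_sq_le_rpow hh hp hle
  rw [← sigma_sq] at h1 h2
  have hpos : 0 < sigma μ a h X ^ 2 := hV.trans_le h1
  refine ⟨h1, lt_of_le_of_ne (Real.sqrt_nonneg _) fun h0 => ?_, ?_⟩
  · rw [← h0] at hpos; simp at hpos
  · have h4 : V μ a h X / sigma μ a h X ^ 2 ≤ 1 := (div_le_one hpos).2 h1
    rw [abs_sub_comm, abs_of_nonneg (sub_nonneg.2 h4)]
    refine le_trans ?_ (mul_le_mul_of_nonneg_left h3 (remainderFactor_nonneg a _))
    unfold remainderFactor
    rw [mul_assoc, ← div_eq_inv_mul, le_div_iff₀ hpos, sub_mul, div_mul_cancel₀ _ hpos.ne']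
    linarith

/-- An integrable bound for the fluctuation of the average of the squared projections. -/
theorem IsSample.exists_bound_normAvg {Q : Measure S} [IsProbabilityMeasure Q]
    (hs : IsSample μ X Q) (hn : 0 < n) (hh : Measurable h)
    (hp : MemLp h 4 (Measure.pi fun _ => Q)) {M : ℝ} (hM : 0 < M)
    (hle : ∫ z, h z ^ 4 ∂(Measure.pi fun _ => Q) ≤ M) (a : (Fin (d + 1) → Fin n) → ℝ)
    (s : ℝ) {ε : ℝ} (hε : 0 < ε) :
    ∃ W : Ω → ℝ, Integrable W μ ∧ (∀ ω, |normAvg Q a h s (fun i => X i ω) - 1| ≤ W ω) ∧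
      ∫ ω, W ω ∂μ ≤ ε + ε⁻¹ * (16 * ((d : ℝ) + 1) ^ 4 *
        ∑ i, (n * normFactor (d + 1) n * absWeight a i * M ^ (1 / 4 : ℝ) / (n * s)) ^ 4) +
        |V μ a h X / s ^ 2 - 1| := by
  obtain ⟨hi, hb⟩ := hs.integral_normAvg_sub_sq_le hn hh hp hle a s
  have hM4 : (M ^ (1 / 4 : ℝ)) ^ 4 = M := by
    rw [← Real.rpow_natCast, ← Real.rpow_mul hM.le]; norm_num
  have hint : Integrable (fun ω => ε + ε⁻¹ * (normAvg Q a h s (fun i => X i ω) -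
      V μ a h X / s ^ 2) ^ 2) μ := (integrable_const ε).add (hi.const_mul _)
  refine ⟨fun ω => ε + ε⁻¹ * (normAvg Q a h s (fun i => X i ω) - V μ a h X / s ^ 2) ^ 2 +
    |V μ a h X / s ^ 2 - 1|, hint.add (integrable_const _), fun ω => ?_, ?_⟩
  · set y := normAvg Q a h s fun i => X i ω
    set v := V μ a h X / s ^ 2
    have h1 : |y - 1| ≤ |y - v| + |v - 1| := abs_sub_le _ _ _
    -- The inequality of the means converts the mean square bound into a bound on the absolute
    -- error, with $\varepsilon$ still free.
    have h2 : |y - v| ≤ ε + ε⁻¹ * (y - v) ^ 2 := by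
      have h3 : ε + ε⁻¹ * (y - v) ^ 2 - 2 * |y - v| = ε⁻¹ * (|y - v| - ε) ^ 2 := by
        rw [← sq_abs (y - v)]; field_simp; ring
      have h4 : 0 ≤ ε⁻¹ * (|y - v| - ε) ^ 2 := by positivity
      linarith [abs_nonneg (y - v)]
    linarith
  · rw [integral_add hint (integrable_const _), integral_add (integrable_const _) (hi.const_mul _),
      integral_const_mul]
    simp only [integral_const, probReal_univ, one_smul]
    simp_rw [div_pow _ (n * s), mul_pow _ (M ^ (1 / 4 : ℝ)), hM4]
    gcongr

/-- An integrable bound for the error of the bootstrap variance estimate. -/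
theorem IsSample.exists_bound_bootstrapVar {Q : Measure S} [IsProbabilityMeasure Q]
    (hs : IsSample μ X Q) (hn : 0 < n) (hh : Measurable h)
    (hp : MemLp h 4 (Measure.pi fun _ => Q)) {M : ℝ} (hM : 0 < M)
    (hle : ∫ z, h z ^ 4 ∂(Measure.pi fun _ => Q) ≤ M) {B : ℝ} (hB : SecondMomentBound μ X Q h B)
    (a : (Fin (d + 1) → Fin n) → ℝ) (s : ℝ) {ε : ℝ} (hε : 0 < ε) :
    ∃ W : Ω → ℝ, Integrable W μ ∧
      (∀ ω, |bootstrapVar (fun y => s⁻¹ * uStat a h y) (fun i => X i ω) - 1| ≤ W ω) ∧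
      ∫ ω, W ω ∂μ ≤ (remainderFactor a s * M ^ (1 / 2 : ℝ) +
          ((d : ℝ) + 1) ^ 2 * B * (remainderFactor a s * (n : ℝ)⁻¹)) +
        ((1 + ε⁻¹) * (((d : ℝ) + 1) * (24 * (2 * (d : ℝ) ^ 2 + d) + 12) * B *
          (((n * s) ^ 2)⁻¹ * (((d : ℝ) + 1) *
            ∑ i, (n * normFactor (d + 1) n * absWeight a i) ^ 2) * (n : ℝ)⁻¹)) +
          ε * (V μ a h X / s ^ 2)) +
        (ε + ε⁻¹ * (16 * ((d : ℝ) + 1) ^ 4 *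
          ∑ i, (n * normFactor (d + 1) n * absWeight a i * M ^ (1 / 4 : ℝ) / (n * s)) ^ 4) +
        |V μ a h X / s ^ 2 - 1|) := by
  obtain ⟨W, hW, hWle, hWint⟩ := hs.exists_bound_normAvg hn hh hp hM hle a s hε
  have hp2 : MemLp h 2 (Measure.pi fun _ => Q) := hp.mono_exponent (by norm_num)
  obtain ⟨hi1, he1⟩ := hB.integral_empirical_sq_le hn hs hh
  obtain ⟨hi3, he3⟩ := hs.integral_normAvg hn hh hp2 a s
  have hi2 := hB.integrable_projError hn hs hh
  have he2 := hB.integral_projError_le hn hs hh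
  have h3 := integral_sq_le_rpow hh hp hle
  have hρ := remainderFactor_nonneg a s
  set ρ := remainderFactor a s
  set κ := ((n * s) ^ 2)⁻¹ * (((d : ℝ) + 1) *
            ∑ i, (n * normFactor (d + 1) n * absWeight a i) ^ 2) with hκ
  have hκ0 : 0 ≤ κ := by
    have : 0 ≤ ∑ i, (n * normFactor (d + 1) n * absWeight a i) ^ 2 :=
      Finset.sum_nonneg fun _ _ => sq_nonneg _
    positivity
  have hε' : 0 ≤ 1 + ε⁻¹ := by positivity
  have hA : Integrable (fun ω => ρ *
      ∫ z, h z ^ 2 ∂(Measure.pi fun _ => empirical fun i => X i ω)) μ := hi1.const_mul _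
  have hC : Integrable (fun ω => (1 + ε⁻¹) * (κ * projError Q h fun i => X i ω)) μ :=
    (hi2.const_mul _).const_mul _
  have hD : Integrable (fun ω => ε * normAvg Q a h s fun i => X i ω) μ := hi3.const_mul _
  have hCD : Integrable (fun ω => (1 + ε⁻¹) * (κ * projError Q h fun i => X i ω) +
      ε * normAvg Q a h s fun i => X i ω) μ := hC.add hD
  have hACD : Integrable (fun ω => ρ *
      (∫ z, h z ^ 2 ∂(Measure.pi fun _ => empirical fun i => X i ω)) +
      ((1 + ε⁻¹) * (κ * projError Q h fun i => X i ω) +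
      ε * normAvg Q a h s fun i => X i ω)) μ := hA.add hCD
  refine ⟨fun ω => ρ * (∫ z, h z ^ 2 ∂(Measure.pi fun _ => empirical fun i => X i ω)) +
      ((1 + ε⁻¹) * (κ * projError Q h fun i => X i ω) +
      ε * normAvg Q a h s fun i => X i ω) + W ω, hACD.add hW, fun ω => ?_, ?_⟩
  · have e1 := abs_bootstrapVar_sub_normAvg_le hn hh s a fun i => X i ω
    have e2 := abs_normAvg_empirical_sub_le (Q := Q) hn hh s a (fun i => X i ω) hε
    have e3 := hWle ω
    have e4 := abs_sub_le (bootstrapVar (fun y => s⁻¹ * uStat a h y) (fun i => X i ω))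
      (normAvg (empirical fun i => X i ω) a h s fun i => X i ω) 1
    have e5 := abs_sub_le (normAvg (empirical fun i => X i ω) a h s fun i => X i ω)
      (normAvg Q a h s fun i => X i ω) 1
    linarith
  · rw [integral_add hACD hW, integral_add hA hCD, integral_add hC hD, integral_const_mul,
      integral_const_mul, integral_const_mul, integral_const_mul, he3]
    have f1 : ρ * ∫ ω, ∫ z, h z ^ 2 ∂(Measure.pi fun _ => empirical fun i => X i ω) ∂μ ≤
        ρ * M ^ (1 / 2 : ℝ) + ((d : ℝ) + 1) ^ 2 * B * (ρ * (n : ℝ)⁻¹) := by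
      refine (mul_le_mul_of_nonneg_left (he1.trans (add_le_add_left h3 _)) hρ).trans
        (le_of_eq ?_)
      ring
    have f2 : (1 + ε⁻¹) * (κ * ∫ ω, projError Q h (fun i => X i ω) ∂μ) ≤
        (1 + ε⁻¹) * (((d : ℝ) + 1) * (24 * (2 * (d : ℝ) ^ 2 + d) + 12) * B *
          (κ * (n : ℝ)⁻¹)) := by
      refine mul_le_mul_of_nonneg_left ?_ hε'
      refine (mul_le_mul_of_nonneg_left he2 hκ0).trans (le_of_eq ?_)
      ring
    linarith

end Asymptotics

end WeightedU

/-! ### The limit theorem -/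

theorem mainTheorem4 {Ω S : Type*} [MeasurableSpace Ω] [MeasurableSpace S]
    (μ : Measure Ω) [IsProbabilityMeasure μ]
    -- the degree is `m = d + 1`
    (d : ℕ)
    -- triangular array of data, weights and kernels
    (X : (n : ℕ) → Fin n → Ω → S)
    (a : (n : ℕ) → (Fin (d + 1) → Fin n) → ℝ)
    (h : ℕ → (Fin (d + 1) → S) → ℝ)
    (hX : ∀ n i, Measurable (X n i))
    (hh : ∀ n, Measurable (h n))
    -- for each `n`, the data are i.i.d.
    (hindep : ∀ n, iIndepFun (X n) μ)
    (hident : ∀ n i j, IdentDistrib (X n i) (X n j) μ μ)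
    -- fourth moments
    (M : ℕ → ℝ) (hM : ∀ n, 0 < M n)
    (hmoment : ∀ n, ∀ I ∈ WeightedU.indexSet (d + 1) n,
      ∫⁻ ω, ENNReal.ofReal (h n (fun k => X n (I k) ω) ^ 4) ∂μ ≤ ENNReal.ofReal (M n))
    -- the main term is nondegenerate
    (hV : ∀ᶠ n in atTop, 0 < WeightedU.V μ (a n) (h n) (X n))
    (hclt1 : Tendsto (fun n : ℕ => (n : ℝ) ^ (-2 : ℤ) *
        WeightedU.V μ (a n) (h n) (X n) ^ (-1 : ℤ) *
        WeightedU.avgWeight 2 2 (a n) * M n ^ (1 / 2 : ℝ)) atTop (𝓝 0))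
    (hclt2 : Tendsto (fun n : ℕ => (n : ℝ) ^ (-2 : ℤ) *
        WeightedU.V μ (a n) (h n) (X n) ^ (-(3 / 2) : ℝ) *
        WeightedU.avgWeight 3 1 (a n) * M n ^ (3 / 4 : ℝ)) atTop (𝓝 0))
    -- bounded second moment of von Mises type
    (hmises : limsup (fun n : ℕ => ⨆ I : Fin (d + 1) → Fin n,
        ∫⁻ ω, ENNReal.ofReal (h n (fun k => X n (I k) ω) ^ 2) ∂μ) atTop < ⊤)
    (hA : Tendsto (fun n : ℕ => (n : ℝ) ^ (-2 : ℤ) *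
        WeightedU.sigma μ (a n) (h n) (X n) ^ (-2 : ℤ) *
        WeightedU.avgWeight 2 1 (a n)) atTop (𝓝 0)) :
    -- the three heterogeneity conditions
    TendstoInMeasure μ (fun (n : ℕ) ω => (n : ℝ)⁻¹ * ∑ i : Fin n, ∑ j : Fin n,
        (WeightedU.h1 μ (a n) (h n) (X n) i (X n j ω) /
          (n * WeightedU.sigma μ (a n) (h n) (X n))) ^ 2) atTop (fun _ => (1 : ℝ)) ∧
    TendstoInMeasure μ (fun (n : ℕ) ω => ((n : ℝ) ^ 2)⁻¹ * ∑ i : Fin n, (∑ j : Fin n,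
        WeightedU.h1 μ (a n) (h n) (X n) i (X n j ω) /
          (n * WeightedU.sigma μ (a n) (h n) (X n))) ^ 2) atTop (fun _ => (0 : ℝ)) ∧
    Tendsto (fun n : ℕ => (n : ℝ)⁻¹ * WeightedU.sigma μ (a n) (h n) (X n) ^ (-2 : ℤ) *
        WeightedU.avgWeight 2 1 (a n) *
        (WeightedU.M1 μ (h n) (X n) ^ 2 + WeightedU.M2 μ (h n) (X n) + (n : ℝ)⁻¹))
      atTop (𝓝 0) ∧
    -- consistency of the bootstrap variance estimate
    TendstoInMeasure μ (fun (n : ℕ) ω =>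
        |WeightedU.bootstrapVar
            (fun y => (WeightedU.sigma μ (a n) (h n) (X n))⁻¹ * WeightedU.uStat (a n) (h n) y)
            (fun i => X n i ω) -
          variance (fun ω' => (WeightedU.sigma μ (a n) (h n) (X n))⁻¹ *
            WeightedU.U (a n) (h n) (X n) ω') μ|) atTop (fun _ => (0 : ℝ)) := by
  have hlarge : ∀ᶠ n : ℕ in atTop, d + 1 ≤ n := eventually_ge_atTop _
  obtain ⟨B, hB0, hB⟩ : ∃ B : ℝ, 0 ≤ B ∧ ∀ᶠ n : ℕ in atTop, ∀ I : Fin (d + 1) → Fin n,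
      ∫⁻ ω, ENNReal.ofReal (h n (fun k => X n (I k) ω) ^ 2) ∂μ ≤ ENNReal.ofReal B := by
    -- Any value strictly between the limit superior and $\infty$ is eventually a uniform bound.
    obtain ⟨b, hb1, hb2⟩ := exists_between hmises
    refine ⟨b.toReal, ENNReal.toReal_nonneg, ?_⟩
    filter_upwards [eventually_lt_of_limsup_lt hb1] with n hn I
    rw [ENNReal.ofReal_toReal hb2.ne]
    exact (le_iSup (fun I : Fin (d + 1) → Fin n =>
      ∫⁻ ω, ENNReal.ofReal (h n (fun k => X n (I k) ω) ^ 2) ∂μ) I).trans hn.le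
  set s : ℕ → ℝ := fun n => WeightedU.sigma μ (a n) (h n) (X n)
  set v : ℕ → ℝ := fun n => WeightedU.V μ (a n) (h n) (X n) / s n ^ 2
  set ρ : ℕ → ℝ := fun n => WeightedU.remainderFactor (a n) (s n)
  set κ : ℕ → ℝ := fun n => ((n * s n) ^ 2)⁻¹ * (((d : ℝ) + 1) *
    ∑ i, (n * WeightedU.normFactor (d + 1) n * WeightedU.absWeight (a n) i) ^ 2) * (n : ℝ)⁻¹
    with hκ_def
  set τ : ℕ → ℝ := fun n => ∑ i, (n * WeightedU.normFactor (d + 1) n *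
    WeightedU.absWeight (a n) i * M n ^ (1 / 4 : ℝ) / (n * s n)) ^ 4
  -- facts for large `n`
  have hfacts : ∀ᶠ n : ℕ in atTop, d + 1 ≤ n ∧ 0 < s n ∧
      WeightedU.V μ (a n) (h n) (X n) ≤ s n ^ 2 ∧ |v n - 1| ≤ ρ n * M n ^ (1 / 2 : ℝ) ∧
      ∃ Q : Measure S, IsProbabilityMeasure Q ∧ WeightedU.IsSample μ (X n) Q ∧
        MemLp (h n) 4 (Measure.pi fun _ => Q) ∧
        ∫ z, h n z ^ 4 ∂(Measure.pi fun _ => Q) ≤ M n ∧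
        WeightedU.SecondMomentBound μ (X n) Q (h n) B := by
    filter_upwards [hlarge, hB, hV] with n hn hBn hVn
    obtain ⟨Q, hQ, hS, hp, hle, hsm⟩ := WeightedU.exists_sample_of_moments hn (hX n) (hh n)
      (hindep n) (hident n) (hM n) (hmoment n)
    obtain ⟨h1, h2, h3⟩ := WeightedU.abs_V_div_sub_one_le hS (by omega) (hh n) hp hle
      (a n) hVn
    exact ⟨hn, h2, h1, h3, Q, hQ, hS, hp, hle, hsm B hB0 hBn⟩
  have hρM : Tendsto (fun n => ρ n * M n ^ (1 / 2 : ℝ)) atTop (𝓝 0) := by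
    refine WeightedU.tendsto_zero_of_le_const_mul hclt1 (((d + 1 : ℕ) : ℝ) ^ 4 *
        (((d + 1 : ℕ) : ℝ) ^ (d + 1)) ^ 2 * (6 + 12 * ((d : ℝ) + 1) ^ 2))
      (Eventually.of_forall fun n => mul_nonneg
        (WeightedU.remainderFactor_nonneg _ _) (Real.rpow_nonneg (hM n).le _)) ?_
    filter_upwards [hfacts, hV] with n hn hVn
    exact WeightedU.remainderFactor_mul_le hn.1 (a n) hVn hn.2.2.1 (Real.rpow_nonneg (hM n).le _)
  have hρn : Tendsto (fun n : ℕ => ρ n * (n : ℝ)⁻¹) atTop (𝓝 0) := by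
    refine WeightedU.tendsto_zero_of_le_const_mul hA ((((d + 1 : ℕ) : ℝ) ^ (d + 1 + 1)) ^ 2 *
        (6 + 12 * ((d : ℝ) + 1) ^ 2)) (Eventually.of_forall fun n => mul_nonneg
      (WeightedU.remainderFactor_nonneg _ _) (by positivity)) ?_
    filter_upwards [hlarge] with n hn
    exact WeightedU.remainderFactor_mul_inv_le hn (a n) (s n)
  have hκ : Tendsto κ atTop (𝓝 0) := by
    refine WeightedU.tendsto_zero_of_le_const_mul hA (((d : ℝ) + 1) * ((d + 1 : ℕ) *
        (((d + 1 : ℕ) : ℝ) ^ (d + 1 + 1)) ^ 2)) (Eventually.of_forall fun n => ?_) ?_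
    · have : 0 ≤ ∑ i, (n * WeightedU.normFactor (d + 1) n * WeightedU.absWeight (a n) i) ^ 2 :=
        Finset.sum_nonneg fun _ _ => sq_nonneg _
      simp only [hκ_def]
      positivity
    · filter_upwards [hlarge] with n hn
      exact WeightedU.inv_mul_sum_sq_absWeight_le hn (a n) (s n)
  have hv : Tendsto (fun n => |v n - 1|) atTop (𝓝 0) :=
    squeeze_zero' (Eventually.of_forall fun n => abs_nonneg _)
      (hfacts.mono fun n hn => hn.2.2.2.1) hρM
  have hv1 : Tendsto v atTop (𝓝 1) := by
    rw [tendsto_iff_dist_tendsto_zero]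
    simpa [Real.dist_eq] using hv
  have hτ : Tendsto τ atTop (𝓝 0) := by
    have hτ3 : Tendsto (fun n : ℕ => ∑ i, (n * WeightedU.normFactor (d + 1) n *
        WeightedU.absWeight (a n) i * M n ^ (1 / 4 : ℝ) / (n * s n)) ^ 3) atTop (𝓝 0) := by
      refine WeightedU.tendsto_zero_of_le_const_mul hclt2
        (((d + 1 : ℕ) : ℝ) * (((d + 1 : ℕ) : ℝ) ^ (d + 1 + 1)) ^ 3) ?_ ?_
      · filter_upwards [hfacts] with n hn
        refine Finset.sum_nonneg fun i _ => ?_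
        have h1 := WeightedU.normFactor_nonneg (d + 1) n
        have h2 := WeightedU.absWeight_nonneg (a n) i
        have h3 := hn.2.1
        have h4 := hM n
        positivity
      · filter_upwards [hfacts, hV] with n hn hVn
        exact WeightedU.sum_absWeight_pow_three_le hn.1 (a n) hVn hn.2.1 hn.2.2.1 (hM n)
    -- Since the sum of cubes tends to zero, each nonnegative term is eventually at most $1$, and
    -- its fourth power is below its cube.
    refine squeeze_zero' (Eventually.of_forall fun n => Finset.sum_nonneg fun i _ =>
      Even.pow_nonneg ⟨2, rfl⟩ _) ?_ hτ3
    filter_upwards [hfacts, hτ3.eventually_le_const zero_lt_one] with n hn hn1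
    have hnn : ∀ i, 0 ≤ n * WeightedU.normFactor (d + 1) n * WeightedU.absWeight (a n) i *
        M n ^ (1 / 4 : ℝ) / (n * s n) := fun i => by
      have h1 := WeightedU.normFactor_nonneg (d + 1) n
      have h2 := WeightedU.absWeight_nonneg (a n) i
      have h3 := hn.2.1
      have h4 := hM n
      positivity
    refine Finset.sum_le_sum fun i hi => ?_
    have h1 := (Finset.single_le_sum (fun j _ => pow_nonneg (hnn j) 3) hi).trans hn1
    have h2 := (pow_le_one_iff_of_nonneg (hnn i) three_ne_zero).1 h1
    exact pow_le_pow_of_le_one (hnn i) h2 (by norm_num)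
  refine ⟨?_, ?_, ?_, ?_⟩
  · refine WeightedU.tendstoInMeasure_of_integral_bound fun δ hδ => ?_
    -- With $\varepsilon=\delta/2$ the bound tends to $\delta/2$, hence is eventually below
    -- $\delta$.
    have hlim : Tendsto (fun n => δ / 2 + (δ / 2)⁻¹ * (16 * ((d : ℝ) + 1) ^ 4 * τ n) + |v n - 1|)
        atTop (𝓝 (δ / 2 + (δ / 2)⁻¹ * (16 * ((d : ℝ) + 1) ^ 4 * 0) + 0)) :=
      (((hτ.const_mul _).const_mul _).const_add _).add hv
    filter_upwards [hfacts, hlim.eventually_le_const (u := δ) (by simp; linarith)] with n hn hnδ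
    obtain ⟨hnd, _, _, _, Q, hQ, hS, hp, hle, _⟩ := hn
    obtain ⟨W, hW1, hW2, hW3⟩ := hS.exists_bound_normAvg (by omega) (hh n) hp (hM n) hle (a n)
      (s n) (half_pos hδ)
    refine ⟨W, hW1, fun ω => ?_, hW3.trans hnδ⟩
    simp_rw [hS.h1_eq (hh n)]
    exact hW2 ω
  · refine WeightedU.tendstoInMeasure_of_integral_bound fun δ hδ => ?_
    have hlim : Tendsto (fun n : ℕ => (n : ℝ)⁻¹ * v n) atTop (𝓝 (0 * 1)) :=
      tendsto_inv_atTop_nhds_zero_nat.mul hv1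
    filter_upwards [hfacts, hlim.eventually_le_const (u := δ) (by simpa using hδ)] with n hn hnδ
    obtain ⟨hnd, _, _, _, Q, hQ, hS, hp, hle, hBn⟩ := hn
    obtain ⟨h1, h2⟩ := hS.integral_sum_sum_sq (by omega) (hh n) hBn.memLp_pi (a n) (s n)
    refine ⟨_, h1, fun ω => ?_, h2.le.trans hnδ⟩
    simp_rw [hS.h1_eq (hh n)]
    rw [sub_zero, abs_of_nonneg]
    exact mul_nonneg (by positivity) (Finset.sum_nonneg fun _ _ => sq_nonneg _)
  -- With $M_1=M_2=0$ only the term $n^{-1}$ is left in the bracket, and the expression equals the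
  -- one in `hA`.
  · refine hA.congr' ?_
    filter_upwards [hfacts] with n hn
    obtain ⟨hnd, _, _, _, Q, hQ, hS, _⟩ := hn
    rw [hS.M1_eq_zero (hh n), hS.M2_eq_zero (hh n)]
    have hz : (n : ℝ) ^ (-2 : ℤ) = (n : ℝ)⁻¹ * (n : ℝ)⁻¹ := by
      rw [zpow_neg, ← mul_inv, ← sq]; norm_cast
    rw [hz]
    ring
  · refine WeightedU.tendstoInMeasure_of_integral_bound fun δ hδ => ?_
    -- The bound tends to $\varepsilon\cdot1+\varepsilon=\delta/2$, the first term because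
    -- $V(n)/\sigma_n^2\to1$.
    set ε := δ / 4 with hε
    have hε0 : 0 < ε := by positivity
    have hlim : Tendsto (fun n : ℕ => (ρ n * M n ^ (1 / 2 : ℝ) +
        ((d : ℝ) + 1) ^ 2 * B * (ρ n * (n : ℝ)⁻¹)) +
        ((1 + ε⁻¹) * (((d : ℝ) + 1) * (24 * (2 * (d : ℝ) ^ 2 + d) + 12) * B * κ n) + ε * v n) +
        (ε + ε⁻¹ * (16 * ((d : ℝ) + 1) ^ 4 * τ n) + |v n - 1|)) atTop
        (𝓝 ((0 + ((d : ℝ) + 1) ^ 2 * B * 0) +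
        ((1 + ε⁻¹) * (((d : ℝ) + 1) * (24 * (2 * (d : ℝ) ^ 2 + d) + 12) * B * 0) + ε * 1) +
        (ε + ε⁻¹ * (16 * ((d : ℝ) + 1) ^ 4 * 0) + 0))) :=
      ((hρM.add (hρn.const_mul _)).add
        (((hκ.const_mul _).const_mul _).add (hv1.const_mul _))).add
        ((((hτ.const_mul _).const_mul _).const_add _).add hv)
    filter_upwards [hfacts, hlim.eventually_le_const (u := δ) (by simp; linarith)] with n hn hnδ
    obtain ⟨hnd, hsn, _, _, Q, hQ, hS, hp, hle, hBn⟩ := hn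
    obtain ⟨W, hW1, hW2, hW3⟩ := hS.exists_bound_bootstrapVar (by omega) (hh n) hp (hM n) hle hBn
      (a n) (s n) hε0
    refine ⟨W, hW1, fun ω => ?_, hW3.trans hnδ⟩
    have hone : variance (fun ω' => (s n)⁻¹ * WeightedU.U (a n) (h n) (X n) ω') μ = 1 := by
      rw [variance_const_mul, ← WeightedU.sigma_sq, inv_pow]
      exact inv_mul_cancel₀ (pow_ne_zero 2 hsn.ne')
    rw [hone, sub_zero, abs_abs]
    exact hW2 ω
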